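/- Let $n\in\mathbb N$, $1\le p\le 2$, $1\le q\le\infty$, $s\in\mathbb R$, with conjugate exponents $p',q'$, and suppose that either $q=1$ and $s\ge 0$, or $1<q\le p'$ and $s>n/q'$. Write $\langle x\rangle=(1+|x|^2)^{1/2}$ and $\hat f(\xi)=\int_{\mathbb R^n} f(x)e^{-ix\xi}\,dx$, extended to tempered distributions. The Fourier–Wermer algebra $\mathcal FL^q_s(\mathbb R^n)$ is the space of all tempered distributions $f$ with $\|f\|_{\mathcal FL^q_s}=\|\langle\cdot\rangle^s\hat f\|_{L^q}<\infty$. Fix a Schwartz function $\varphi$ with $\operatorname{supp}\varphi\subset[-1,1]^n$ and $\sum_{k\in\mathbb Z^n}\varphi(\xi-k)=1$ for all $\xi\in\mathbb R^n$. The modulation space $M^{p,q}_s(\mathbb R^n)$ is the space of all tempered distributions $f$ with $$\|f\|_{M^{p,q}_s}=\Big(\sum_{k\in\mathbb Z^n}\langle k\rangle^{sq}\,\big\|\mathcal F^{-1}(\varphi(\cdot-k)\hat f)\big\|_{L^p}^q\Big)^{1/q}<\infty$$ (with the supremum over $k$ if $q=\infty$). For these parameters the elements of both spaces are identified with continuous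 functions. For $X$ one of these spaces and $E\subset\mathbb R^n$ closed, let $I(E)=\{f\in X: f|_E=0\}$, and let $J(E)$ be the closed ideal of $X$ (under pointwise multiplication) generated by $\{f\in X: f=0\text{ in a neighborhood of }E\}$, that is, the intersection of all closed ideals of $X$ containing this set. The set $E$ is called a set of spectral synthesis for $X$ if $I(E)=J(E)$. Then a compact set $K\subset\mathbb R^n$ is a set of spectral synthesis for $M^{p,q}_s(\mathbb R^n)$ if and only if it is a set of spectral synthesis for $\mathcal FL^q_s(\mathbb R^n)$. -/

import Mathlib

open MeasureTheory SchwartzMap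
open scoped ENNReal FourierTransform

noncomputable section

namespace SpectralSynthesis

/-- `ℝⁿ` with the Euclidean norm. -/
abbrev Eucl (n : ℕ) : Type := EuclideanSpace ℝ (Fin n)

/-- The Japanese bracket `⟨x⟩ = (1 + |x|²)^{1/2}`. -/
def bracket {n : ℕ} (x : Eucl n) : ℝ := Real.sqrt (1 + ‖x‖ ^ 2)

/-- The lattice point `k ∈ ℤⁿ`, seen in `ℝⁿ`. -/
def latticePt {n : ℕ} (k : Fin n → ℤ) : Eucl n := WithLp.toLp 2 (fun i => (k i : ℝ))

/-! ### Fourier transform in the angular normalization -/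

/-- The dilation `x ↦ c x` of `ℝⁿ`, for `c ≠ 0`. -/
def dilation (n : ℕ) (c : ℝ) (hc : c ≠ 0) : Eucl n ≃L[ℝ] Eucl n :=
  ContinuousLinearEquiv.smulLeft (Units.mk0 c hc)

theorem two_pi_ne_zero : (2 * Real.pi : ℝ) ≠ 0 := by positivity

/-- On Schwartz functions, `ψ̂(ξ) = ∫ ψ(x) e^{-i x ξ} dx`, that is `ψ̂(ξ) = (𝓕 ψ)(ξ / 2π)`
with `𝓕 ψ (η) = ∫ ψ(x) e^{-2π i x η} dx`. -/
def schwartzFourier (n : ℕ) : 𝓢(Eucl n, ℂ) →L[ℂ] 𝓢(Eucl n, ℂ) :=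
  (compCLMOfContinuousLinearEquiv ℂ (dilation n (2 * Real.pi)⁻¹ (inv_ne_zero two_pi_ne_zero))).comp
    (FourierTransform.fourierCLM ℂ 𝓢(Eucl n, ℂ))

/-- On Schwartz functions, `x ↦ (2π)^{-n} ∫ ψ(ξ) e^{i x ξ} dξ`, that is the inverse transform
`𝓕⁻` (kernel `e^{2π i x η}`) of `η ↦ ψ(2π η)`. -/
def schwartzFourierInv (n : ℕ) : 𝓢(Eucl n, ℂ) →L[ℂ] 𝓢(Eucl n, ℂ) :=
  (FourierTransform.fourierInvCLM ℂ 𝓢(Eucl n, ℂ)).comp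
    (compCLMOfContinuousLinearEquiv ℂ (dilation n (2 * Real.pi) two_pi_ne_zero))

/-- The Fourier transform of tempered distributions, by duality: `f̂(ψ) = f(ψ̂)`. -/
def distFourier {n : ℕ} (f : 𝓢'(Eucl n, ℂ)) : 𝓢'(Eucl n, ℂ) :=
  PointwiseConvergenceCLM.precomp ℂ (schwartzFourier n) f

/-- The inverse Fourier transform of tempered distributions, by duality. -/
def distFourierInv {n : ℕ} (f : 𝓢'(Eucl n, ℂ)) : 𝓢'(Eucl n, ℂ) :=
  PointwiseConvergenceCLM.precomp ℂ (schwartzFourierInv n) f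

/-! ### Distributions given by functions -/

/-- The tempered distribution `f` is given by the function `u`: `f(ψ) = ∫ ψ(x) u(x) dx` for all
Schwartz functions `ψ`, the integrals being absolutely convergent. -/
def IsGivenBy {n : ℕ} (f : 𝓢'(Eucl n, ℂ)) (u : Eucl n → ℂ) : Prop :=
  ∀ ψ : 𝓢(Eucl n, ℂ), Integrable (fun x => ψ x * u x) ∧ f ψ = ∫ x, ψ x * u x

/-- The weighted norm `‖⟨·⟩^s f‖_{L^p}` of a tempered distribution: the value at the function
that gives `f` (it is unique up to null sets), and `∞` if `f` is not given by a function. -/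
def weightedLpNorm {n : ℕ} (p : ℝ≥0∞) (s : ℝ) (f : 𝓢'(Eucl n, ℂ)) : ℝ≥0∞ :=
  ⨅ (u : Eucl n → ℂ) (_ : IsGivenBy f u),
    eLpNorm (fun x => (bracket x ^ s : ℝ) • u x) p volume

/-! ### The Fourier-Wermer algebra and the modulation spaces -/

/-- The norm of `𝓕L^q_s(ℝⁿ)`, `‖f‖ = ‖⟨·⟩^s f̂‖_{L^q}`, with values in `[0, ∞]`; the space consists
of the tempered distributions of finite norm. -/
def fourierWermerNorm {n : ℕ} (q : ℝ≥0∞) (s : ℝ) (f : 𝓢'(Eucl n, ℂ)) : ℝ≥0∞ :=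
  weightedLpNorm q s (distFourier f)

/-- A smooth partition of unity by the translates of `φ`:
`supp φ ⊂ [-1,1]ⁿ` and `∑_{k ∈ ℤⁿ} φ(ξ - k) = 1` for all `ξ`. -/
def IsUnifPartition {n : ℕ} (φ : 𝓢(Eucl n, ℂ)) : Prop :=
  tsupport (φ : Eucl n → ℂ) ⊆ {ξ | ∀ i, ξ i ∈ Set.Icc (-1 : ℝ) 1} ∧
    ∀ ξ : Eucl n, HasSum (fun k : Fin n → ℤ => φ (ξ - latticePt k)) 1

/-- The frequency-localized piece `φ(D - k) f = 𝓕⁻¹(φ(· - k) f̂)`. -/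
def freqPiece {n : ℕ} (φ : 𝓢(Eucl n, ℂ)) (k : Fin n → ℤ) (f : 𝓢'(Eucl n, ℂ)) : 𝓢'(Eucl n, ℂ) :=
  distFourierInv
    (TemperedDistribution.smulLeftCLM ℂ (fun ξ => φ (ξ - latticePt k)) (distFourier f))

/-- The norm of `M^{p,q}_s(ℝⁿ)`: the `ℓ^q(ℤⁿ)` norm of `k ↦ ⟨k⟩^s ‖φ(D - k) f‖_{L^p}`, with values
in `[0, ∞]`; the space consists of the tempered distributions of finite norm. -/
def modulationNorm {n : ℕ} (φ : 𝓢(Eucl n, ℂ)) (p q : ℝ≥0∞) (s : ℝ) (f : 𝓢'(Eucl n, ℂ)) : ℝ≥0∞ :=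
  eLpNorm
    (fun k : Fin n → ℤ =>
      ENNReal.ofReal (bracket (latticePt k) ^ s) * weightedLpNorm p 0 (freqPiece φ k f))
    q Measure.count

/-! ### Spectral synthesis

Here `N : 𝓢'(ℝⁿ) → [0, ∞]` is the norm of a space of tempered distributions. -/

/-- The space `X` of all tempered distributions of finite norm `N`. -/
def space {n : ℕ} (N : 𝓢'(Eucl n, ℂ) → ℝ≥0∞) : Set (𝓢'(Eucl n, ℂ)) := {f | N f < ∞}

/-- `f` is given by a continuous function which vanishes at every point of `A`. -/
def VanishesOn {n : ℕ} (f : 𝓢'(Eucl n, ℂ)) (A : Set (Eucl n)) : Prop :=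
  ∃ u : Eucl n → ℂ, Continuous u ∧ IsGivenBy f u ∧ ∀ x ∈ A, u x = 0

/-- `h` is the pointwise product of `f` and `g`, all three being given by continuous functions. -/
def IsPointwiseProduct {n : ℕ} (f g h : 𝓢'(Eucl n, ℂ)) : Prop :=
  ∃ u v : Eucl n → ℂ, Continuous u ∧ Continuous v ∧
    IsGivenBy f u ∧ IsGivenBy g v ∧ IsGivenBy h (fun x => u x * v x)

/-- `I` is a closed ideal in `X`: a linear subspace of `X` with `f g ∈ I` whenever `f ∈ X` and
`g ∈ I`, which contains every `f ∈ X` that is a limit in norm of elements of `I`. -/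
structure IsClosedIdeal {n : ℕ} (N : 𝓢'(Eucl n, ℂ) → ℝ≥0∞)
    (I : Submodule ℂ (𝓢'(Eucl n, ℂ))) : Prop where
  subset_space : ∀ f ∈ I, f ∈ space N
  mul_mem : ∀ f ∈ space N, ∀ g ∈ I, ∃ h ∈ I, IsPointwiseProduct f g h
  closed : ∀ f ∈ space N, (∀ ε : ℝ≥0∞, 0 < ε → ∃ g ∈ I, N (f - g) < ε) → f ∈ I

/-- `I(E)`: the elements of `X` which vanish on `E`. -/
def vanishingIdeal {n : ℕ} (N : 𝓢'(Eucl n, ℂ) → ℝ≥0∞) (E : Set (Eucl n)) :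
    Set (𝓢'(Eucl n, ℂ)) :=
  {f | f ∈ space N ∧ VanishesOn f E}

/-- `J₀(E)`: the elements of `X` which vanish in a neighborhood of `E`. -/
def vanishingNear {n : ℕ} (N : 𝓢'(Eucl n, ℂ) → ℝ≥0∞) (E : Set (Eucl n)) :
    Set (𝓢'(Eucl n, ℂ)) :=
  {f | f ∈ space N ∧ ∃ U : Set (Eucl n), IsOpen U ∧ E ⊆ U ∧ VanishesOn f U}

/-- `J(E)`: the closed ideal in `X` generated by `J₀(E)`. -/
def minimalIdeal {n : ℕ} (N : 𝓢'(Eucl n, ℂ) → ℝ≥0∞) (E : Set (Eucl n)) :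
    Set (𝓢'(Eucl n, ℂ)) :=
  {f | f ∈ space N ∧ ∀ I : Submodule ℂ (𝓢'(Eucl n, ℂ)),
    IsClosedIdeal N I → vanishingNear N E ⊆ I → f ∈ I}

/-- `E` is a set of spectral synthesis for `X` if `I(E) = J(E)`. -/
def IsSetOfSpectralSynthesis {n : ℕ} (N : 𝓢'(Eucl n, ℂ) → ℝ≥0∞) (E : Set (Eucl n)) : Prop :=
  vanishingIdeal N E = minimalIdeal N E

end SpectralSynthesis

end

/-!
Both spaces consist of functions with integrable Fourier transform, and both are Banach algebras
under pointwise multiplication, since for the parameters in question the weighted spaces `L^q_s(ℝⁿ)`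
and `ℓ^q_s(ℤⁿ)` embed into `L^1`, respectively `ℓ^1`, and are closed under convolution. The result
rests on the fact that the two algebras coincide locally: if `χ` is a test function and `f` belongs
to one of them, then `χ f` belongs to the other one, with an estimate of its norm.

Once this is known, the transfer of spectral synthesis is formal. In an algebra of this kind the
ideal `J(E)` is the closure of the functions vanishing near `E`, and it is contained in `I(E)`. Let
`K` be a set of synthesis for the first algebra, let `f` in the second one vanish on `K`, and let
`χ` be a test function equal to `1` near `K`. Then `(1 - χ) f` vanishes near `K`, and `χ f` is in
the first algebra, where it is the limit of functions vanishing near `K`. Multiplication of these by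
a second test function, equal to `1` on the support of `χ`, gives an approximation of `χ f` in the
second algebra. This is `IsSetOfSpectralSynthesis.of_locallyLE`, stated for two abstract norms with
the properties `IsFourierAlgebraNorm`.

For the local comparison let `X` be the Fourier transform of `χ` and `F` the Fourier transform
of `f`. From `𝓕L^q_s` to `M^{p,q}_s`, the function `φ(D - k)(χ f)` is the superposition over `η` of
`F(η)` times the inverse Fourier transforms of `φ(· - k) X(· - η)`, which decay rapidly both in
space and in `k - η`. In the other direction the Fourier transform `X ∗ F` of `χ f` at `ξ` is, up to
a constant, the sum over `k` of the pairings of `φ(D - k) f` in `L^p` with functions whose norm in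
`L^{p'}` decays rapidly in `ξ - k`. In both cases Schur's test for the kernel `⟨ξ - k⟩^{-N}`
(`eLpNorm_weight_kernel_le`) concludes.

The restriction `p ≤ 2` enters through Bernstein's inequality: the Fourier transform of a
band-limited function in `L^p` is integrable, uniformly over the unit cubes containing its support
(`exists_integrable_of_eLpNorm_fourierInv`). It follows from Plancherel's theorem by duality, as the
Fourier transform maps functions in `L^2` supported in a fixed cube to `L^{p'}`, where `p' ≥ 2`.

Functions with integrable Fourier transform are handled through their Fourier transform `F`: they
are `invF F`, and products correspond to the normalized convolution `nconv`. Norms take their values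
in `[0, ∞]`, so that no finiteness has to be known in advance.
-/

noncomputable section

namespace SpectralSynthesis

/-! ### Integral operators on weighted Lebesgue spaces -/

/-- Hölder's inequality with respect to the measure `k dν` (Jensen's inequality, up to
normalization). -/
theorem lintegral_mul_rpow_le {β : Type*} [MeasurableSpace β] (ν : Measure β) {k a : β → ℝ≥0∞}
    (hk : Measurable k) (ha : AEMeasurable a ν) {r : ℝ} (hr : 1 ≤ r) :
    (∫⁻ y, k y * a y ∂ν) ^ r ≤ (∫⁻ y, k y ∂ν) ^ (r - 1) * ∫⁻ y, k y * a y ^ r ∂ν := by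
  rcases hr.eq_or_lt with rfl | hr'
  · simp
  have hr0 : 0 < r := by linarith
  have hc : r.HolderConjugate (r.conjExponent) := Real.HolderConjugate.conjExponent hr'
  have h := ENNReal.lintegral_mul_le_Lp_mul_Lq ν hc
    (f := fun y => k y ^ (1 / r) * a y) (g := fun y => k y ^ (1 / r.conjExponent))
    ((hk.pow_const _).aemeasurable.mul ha) (hk.pow_const _).aemeasurable
  have e1 : ∀ y, ((fun y => k y ^ (1 / r) * a y) * fun y => k y ^ (1 / r.conjExponent)) y
      = k y * a y := by
    intro y
    have : k y = k y ^ (1 / r) * k y ^ (1 / r.conjExponent) := by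
      rw [← ENNReal.rpow_add_of_nonneg _ _ (by positivity) (by have := hc.symm.pos; positivity)]
      have := hc.inv_add_inv_eq_one
      simp only [one_div, this, ENNReal.rpow_one]
    calc _ = (k y ^ (1 / r) * k y ^ (1 / r.conjExponent)) * a y := by
            simp only [Pi.mul_apply]; ring
      _ = _ := by rw [← this]
  simp only [e1] at h
  have e2 : ∀ y, (k y ^ (1 / r) * a y) ^ r = k y * a y ^ r := by
    intro y
    rw [ENNReal.mul_rpow_of_nonneg _ _ hr0.le, ← ENNReal.rpow_mul, one_div,
      inv_mul_cancel₀ hr0.ne', ENNReal.rpow_one]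
  have e3 : ∀ y, (k y ^ (1 / r.conjExponent)) ^ r.conjExponent = k y := by
    intro y
    rw [← ENNReal.rpow_mul, one_div, inv_mul_cancel₀ hc.symm.pos.ne', ENNReal.rpow_one]
  simp only [e2, e3] at h
  calc _ ≤ _ := ENNReal.rpow_le_rpow h hr0.le
    _ = _ := by
      rw [ENNReal.mul_rpow_of_nonneg _ _ hr0.le, ← ENNReal.rpow_mul, ← ENNReal.rpow_mul, mul_comm]
      congr 1
      · congr 1
        have := hc.sub_one_mul_conj
        rw [one_div, inv_mul_eq_div, div_eq_iff hc.symm.pos.ne', this]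
      · rw [one_div, inv_mul_cancel₀ hr0.ne', ENNReal.rpow_one]

/-- Schur's test: an integral operator whose nonnegative kernel has all row and column integrals
bounded by `A` is bounded by `A` on every `L^q`, `1 ≤ q ≤ ∞`. -/
theorem eLpNorm_lintegral_kernel_le {α β : Type*} [MeasurableSpace α] [MeasurableSpace β]
    (μ : Measure α) (ν : Measure β) [SFinite μ] [SFinite ν] {k : α → β → ℝ≥0∞}
    (hk : Measurable (Function.uncurry k)) {a : β → ℝ≥0∞} (ha : AEMeasurable a ν)
    {q : ℝ≥0∞} (hq : 1 ≤ q) {A : ℝ≥0∞}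
    (h1 : ∀ x, ∫⁻ y, k x y ∂ν ≤ A) (h2 : ∀ y, ∫⁻ x, k x y ∂μ ≤ A) :
    eLpNorm (fun x => ∫⁻ y, k x y * a y ∂ν) q μ ≤ A * eLpNorm a q ν := by
  wlog hm : Measurable a generalizing a
  · have hc : ∀ x, ∫⁻ y, k x y * a y ∂ν = ∫⁻ y, k x y * ha.mk a y ∂ν := fun x =>
      lintegral_congr_ae (ha.ae_eq_mk.mono fun y hy => by simp [hy])
    simp only [hc]
    rw [eLpNorm_congr_ae ha.ae_eq_mk]
    exact this ha.measurable_mk.aemeasurable ha.measurable_mk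
  rcases eq_or_ne q ∞ with rfl | hq'
  · simp only [eLpNorm_exponent_top]
    refine essSup_le_of_ae_le _ (ae_of_all _ fun x => ?_)
    simp only [enorm_eq_self]
    calc ∫⁻ y, k x y * a y ∂ν ≤ ∫⁻ y, k x y * eLpNormEssSup a ν ∂ν := by
          refine lintegral_mono_ae ?_
          filter_upwards [enorm_ae_le_eLpNormEssSup a ν] with y hy
          gcongr
          simpa using hy
      _ = (∫⁻ y, k x y ∂ν) * eLpNormEssSup a ν :=
          lintegral_mul_const _ hk.of_uncurry_left
      _ ≤ _ := by gcongr; exact h1 x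
  have hr : 1 ≤ q.toReal := by
    rwa [← ENNReal.toReal_one, ENNReal.toReal_le_toReal (by simp) hq']
  have hr0 : 0 < q.toReal := by linarith
  have hq0 : q ≠ 0 := by rintro rfl; simp at hq
  rw [eLpNorm_eq_lintegral_rpow_enorm_toReal hq0 hq',
    eLpNorm_eq_lintegral_rpow_enorm_toReal hq0 hq']
  simp only [enorm_eq_self]
  set r := q.toReal
  have key : ∫⁻ x, (∫⁻ y, k x y * a y ∂ν) ^ r ∂μ ≤ A ^ r * ∫⁻ y, a y ^ r ∂ν := by
    calc ∫⁻ x, (∫⁻ y, k x y * a y ∂ν) ^ r ∂μ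
        ≤ ∫⁻ x, A ^ (r - 1) * ∫⁻ y, k x y * a y ^ r ∂ν ∂μ := by
          refine lintegral_mono fun x => (lintegral_mul_rpow_le ν hk.of_uncurry_left ha hr).trans ?_
          exact mul_le_mul_left (ENNReal.rpow_le_rpow (h1 x) (by linarith)) _
      _ = A ^ (r - 1) * ∫⁻ x, ∫⁻ y, k x y * a y ^ r ∂ν ∂μ := by
          refine lintegral_const_mul _ ?_
          exact Measurable.lintegral_prod_right'
            (f := fun z : α × β => k z.1 z.2 * a z.2 ^ r)
            (hk.mul ((hm.comp measurable_snd).pow_const r))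
      _ = A ^ (r - 1) * ∫⁻ y, (∫⁻ x, k x y ∂μ) * a y ^ r ∂ν := by
          rw [lintegral_lintegral_swap]
          · congr 1
            refine lintegral_congr fun y => ?_
            rw [lintegral_mul_const]
            exact hk.of_uncurry_right
          · exact (hk.mul ((hm.comp measurable_snd).pow_const r)).aemeasurable
      _ ≤ A ^ (r - 1) * ∫⁻ y, A * a y ^ r ∂ν := by
          gcongr with y
          exact h2 y
      _ = A ^ (r - 1) * A * ∫⁻ y, a y ^ r ∂ν := by
          rw [lintegral_const_mul _ (hm.pow_const r), mul_assoc]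
      _ = _ := by
          congr 1
          conv_lhs => rw [← ENNReal.rpow_one A, ← ENNReal.rpow_mul, one_mul]
          rw [← ENNReal.rpow_add_of_nonneg _ _ (by linarith) (by linarith)]
          congr 1; ring
  calc _ ≤ (A ^ r * ∫⁻ y, a y ^ r ∂ν) ^ (1 / r) := by gcongr
    _ = _ := by
      rw [ENNReal.mul_rpow_of_nonneg _ _ (by positivity), ← ENNReal.rpow_mul, one_div,
        mul_inv_cancel₀ hr0.ne', ENNReal.rpow_one]

section Group

variable {G : Type*} [AddCommGroup G] [MeasurableSpace G] [MeasurableAdd₂ G] [MeasurableNeg G]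
  (μ : Measure G) [SFinite μ] [μ.IsAddLeftInvariant] [μ.IsNegInvariant]

omit [SFinite μ] in
theorem lintegral_sub_left_mul_comm (a b : G → ℝ≥0∞) (x : G) :
    ∫⁻ y, a (x - y) * b y ∂μ = ∫⁻ y, b (x - y) * a y ∂μ := by
  rw [← lintegral_sub_left_eq_self (fun y => a (x - y) * b y) x]
  simp [mul_comm]

/-- Young's inequality `‖a ∗ b‖_q ≤ ‖a‖_1 ‖b‖_q`. -/
theorem eLpNorm_lintegral_sub_left_mul_le {a b : G → ℝ≥0∞} (ha : AEMeasurable a μ)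
    (hb : AEMeasurable b μ) {q : ℝ≥0∞} (hq : 1 ≤ q) :
    eLpNorm (fun x => ∫⁻ y, a (x - y) * b y ∂μ) q μ ≤ (∫⁻ y, a y ∂μ) * eLpNorm b q μ := by
  have hc : ∀ x, ∫⁻ y, a (x - y) * b y ∂μ = ∫⁻ y, ha.mk a (x - y) * b y ∂μ := fun x => by
    rw [lintegral_sub_left_mul_comm, lintegral_sub_left_mul_comm μ (ha.mk a)]
    exact lintegral_congr_ae (ha.ae_eq_mk.mono fun y hy => by simp [hy])
  simp only [hc]
  rw [lintegral_congr_ae ha.ae_eq_mk]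
  refine eLpNorm_lintegral_kernel_le μ μ (k := fun x y => ha.mk a (x - y))
    (ha.measurable_mk.comp (measurable_fst.sub measurable_snd)) hb hq (fun x => ?_) (fun y => ?_)
  · exact (lintegral_sub_left_eq_self (ha.mk a) x).le
  · exact (lintegral_sub_right_eq_self (ha.mk a) y).le

/-- `L^q` with a weight `w` satisfying `w(x+y) ≤ C (w(x) + w(y))` is closed under convolution if it
embeds into `L^1`. -/
theorem eLpNorm_weight_mul_conv_le {w : G → ℝ≥0∞} (hw : Measurable w) {C D q : ℝ≥0∞} (hq : 1 ≤ q)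
    (hadd : ∀ x y, w (x + y) ≤ C * (w x + w y))
    (hemb : ∀ a : G → ℝ≥0∞, AEMeasurable a μ →
      ∫⁻ x, a x ∂μ ≤ D * eLpNorm (fun x => w x * a x) q μ)
    {a b : G → ℝ≥0∞} (ha : AEMeasurable a μ) (hb : AEMeasurable b μ) :
    eLpNorm (fun x => w x * ∫⁻ y, a (x - y) * b y ∂μ) q μ ≤
      2 * C * D * eLpNorm (fun x => w x * a x) q μ * eLpNorm (fun x => w x * b x) q μ := by
  wlog hm : Measurable a ∧ Measurable b generalizing a b
  · have hc : ∀ x, ∫⁻ y, a (x - y) * b y ∂μ = ∫⁻ y, ha.mk a (x - y) * hb.mk b y ∂μ := fun x => by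
      rw [lintegral_congr_ae (hb.ae_eq_mk.mono fun y hy => by rw [hy]),
        lintegral_sub_left_mul_comm, lintegral_sub_left_mul_comm μ (ha.mk a)]
      exact lintegral_congr_ae (ha.ae_eq_mk.mono fun y hy => by simp [hy])
    simp only [hc]
    have e1 : (fun x => w x * a x) =ᵐ[μ] fun x => w x * ha.mk a x :=
      ha.ae_eq_mk.mono fun y hy => congrArg (w y * ·) hy
    have e2 : (fun x => w x * b x) =ᵐ[μ] fun x => w x * hb.mk b x :=
      hb.ae_eq_mk.mono fun y hy => congrArg (w y * ·) hy
    rw [eLpNorm_congr_ae e1, eLpNorm_congr_ae e2]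
    exact this ha.measurable_mk.aemeasurable hb.measurable_mk.aemeasurable
      ⟨ha.measurable_mk, hb.measurable_mk⟩
  obtain ⟨ham, hbm⟩ := hm
  have hmeas : ∀ {f g : G → ℝ≥0∞}, Measurable f → Measurable g →
      Measurable fun x => ∫⁻ y, f (x - y) * g y ∂μ := fun {f g} hf hg =>
    Measurable.lintegral_prod_right' (f := fun z : G × G => f (z.1 - z.2) * g z.2)
      ((hf.comp (measurable_fst.sub measurable_snd)).mul (hg.comp measurable_snd))
  have hpt : ∀ x, w x * ∫⁻ y, a (x - y) * b y ∂μ ≤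
      C * ((∫⁻ y, b (x - y) * (w y * a y) ∂μ) + ∫⁻ y, a (x - y) * (w y * b y) ∂μ) := by
    intro x
    rw [lintegral_sub_left_mul_comm μ b (fun y => w y * a y), ← lintegral_add_left,
      ← lintegral_const_mul, ← lintegral_const_mul]
    · refine lintegral_mono fun y => ?_
      have := hadd (x - y) y
      rw [sub_add_cancel] at this
      calc w x * (a (x - y) * b y) ≤ C * (w (x - y) + w y) * (a (x - y) * b y) := by gcongr
        _ = _ := by ring
    all_goals fun_prop
  have n1 := eLpNorm_lintegral_sub_left_mul_le μ hb (hw.mul ham).aemeasurable hq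
  have n2 := eLpNorm_lintegral_sub_left_mul_le μ ha (hw.mul hbm).aemeasurable hq
  calc eLpNorm (fun x => w x * ∫⁻ y, a (x - y) * b y ∂μ) q μ
    _ ≤ eLpNorm (fun x => C * ((∫⁻ y, b (x - y) * (w y * a y) ∂μ)
            + ∫⁻ y, a (x - y) * (w y * b y) ∂μ)) q μ :=
        eLpNorm_mono_enorm fun x => by simpa using hpt x
    _ ≤ C * (eLpNorm (fun x => ∫⁻ y, b (x - y) * (w y * a y) ∂μ) q μ
          + eLpNorm (fun x => ∫⁻ y, a (x - y) * (w y * b y) ∂μ) q μ) := by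
        refine (eLpNorm_le_mul_eLpNorm_of_ae_le_mul'' q (c := C)
          (g := fun x => (∫⁻ y, b (x - y) * (w y * a y) ∂μ)
            + ∫⁻ y, a (x - y) * (w y * b y) ∂μ)
          ((hmeas hbm (hw.mul ham)).add (hmeas ham (hw.mul hbm))).aestronglyMeasurable
          (ae_of_all _ fun x => by simp)).trans ?_
        gcongr
        exact eLpNorm_add_le (hmeas hbm (hw.mul ham)).aestronglyMeasurable
          (hmeas ham (hw.mul hbm)).aestronglyMeasurable hq
    _ ≤ C * (D * eLpNorm (fun x => w x * b x) q μ * eLpNorm (fun x => w x * a x) q μ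
          + D * eLpNorm (fun x => w x * a x) q μ * eLpNorm (fun x => w x * b x) q μ) := by
        gcongr
        · exact n1.trans (mul_le_mul' (hemb b hb) le_rfl)
        · exact n2.trans (mul_le_mul' (hemb a ha) le_rfl)
    _ = _ := by ring

end Group

/-- Minkowski's inequality for countable sums of nonnegative functions. -/
theorem eLpNorm_tsum_le_tsum {α ι : Type*} [MeasurableSpace α] [Countable ι] (μ : Measure α)
    {f : ι → α → ℝ≥0∞} (hf : ∀ i, Measurable (f i)) {p : ℝ≥0∞} (hp : 1 ≤ p) :
    eLpNorm (fun x => ∑' i, f i x) p μ ≤ ∑' i, eLpNorm (f i) p μ := by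
  rcases eq_or_ne p ∞ with rfl | hp'
  · simp only [eLpNorm_exponent_top]
    refine essSup_le_of_ae_le _ ?_
    have : ∀ᵐ x ∂μ, ∀ i, ‖f i x‖ₑ ≤ eLpNormEssSup (f i) μ :=
      ae_all_iff.2 fun i => enorm_ae_le_eLpNormEssSup (f i) μ
    filter_upwards [this] with x hx
    exact ENNReal.tsum_le_tsum hx
  have hp0 : p ≠ 0 := by rintro rfl; simp at hp
  have hr0 : 0 < p.toReal := ENNReal.toReal_pos hp0 hp'
  have hfin : ∀ S : Finset ι, eLpNorm (fun x => ∑ i ∈ S, f i x) p μ ≤ ∑' i, eLpNorm (f i) p μ :=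
    fun S => by
      have h := eLpNorm_sum_le (f := f) (s := S) (p := p) (μ := μ)
        (fun i _ => (hf i).aestronglyMeasurable) hp
      have e : (∑ i ∈ S, f i) = fun x => ∑ i ∈ S, f i x := by ext x; simp
      rw [e] at h
      exact h.trans (ENNReal.sum_le_tsum S)
  rw [eLpNorm_eq_lintegral_rpow_enorm_toReal hp0 hp', one_div,
    ENNReal.rpow_inv_le_iff hr0]
  simp only [enorm_eq_self]
  have e : ∀ x, (∑' i, f i x) ^ p.toReal = ⨆ S : Finset ι, (∑ i ∈ S, f i x) ^ p.toReal := by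
    intro x
    rw [ENNReal.tsum_eq_iSup_sum]
    exact (ENNReal.orderIsoRpow p.toReal hr0).map_iSup _
  simp only [e]
  rw [lintegral_iSup_directed
    (fun S => ((Finset.measurable_fun_sum S fun i _ => hf i).pow_const _).aemeasurable)]
  · refine iSup_le fun S => ?_
    have := hfin S
    rw [eLpNorm_eq_lintegral_rpow_enorm_toReal hp0 hp', one_div,
      ENNReal.rpow_inv_le_iff hr0] at this
    simpa only [enorm_eq_self] using this
  · intro S T
    classical
    refine ⟨S ∪ T, fun x => ?_, fun x => ?_⟩
    · exact ENNReal.rpow_le_rpow (Finset.sum_le_sum_of_subset Finset.subset_union_left) hr0.le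
    · exact ENNReal.rpow_le_rpow (Finset.sum_le_sum_of_subset Finset.subset_union_right) hr0.le

/-! ### The weights `⟨x⟩^s` on `ℝⁿ` and on `ℤⁿ` -/

variable {n : ℕ}

theorem one_le_bracket (x : Eucl n) : 1 ≤ bracket x := by
  rw [bracket, Real.one_le_sqrt]; nlinarith [sq_nonneg ‖x‖]

theorem bracket_pos (x : Eucl n) : 0 < bracket x := one_pos.trans_le (one_le_bracket x)

theorem continuous_bracket : Continuous (bracket : Eucl n → ℝ) := by
  unfold bracket; fun_prop

theorem bracket_neg (x : Eucl n) : bracket (-x) = bracket x := by simp [bracket]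

theorem bracket_le_one_add_norm (x : Eucl n) : bracket x ≤ 1 + ‖x‖ := by
  rw [bracket, Real.sqrt_le_left (by positivity)]; nlinarith [norm_nonneg x]

theorem bracket_add_le_mul (x y : Eucl n) : bracket (x + y) ≤ 2 * (bracket x * bracket y) := by
  have h := norm_add_le x y
  rw [bracket, bracket, bracket, ← Real.sqrt_mul (by positivity), Real.sqrt_le_left (by positivity),
    mul_pow, Real.sq_sqrt (by positivity)]
  nlinarith [norm_nonneg x, norm_nonneg y, norm_nonneg (x + y), sq_nonneg (‖x‖ - ‖y‖),
    mul_nonneg (sq_nonneg ‖x‖) (sq_nonneg ‖y‖)]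

theorem bracket_add_le_max (x y : Eucl n) : bracket (x + y) ≤ 2 * max (bracket x) (bracket y) := by
  have h := norm_add_le x y
  wlog hxy : ‖x‖ ≤ ‖y‖ generalizing x y
  · have := this y x (by rwa [add_comm, add_comm ‖y‖]) (le_of_not_ge hxy)
    rwa [add_comm, max_comm]
  refine le_trans ?_ (mul_le_mul_of_nonneg_left (le_max_right _ _) zero_le_two)
  rw [bracket, Real.sqrt_le_left (by have := (bracket_pos y).le; positivity), mul_pow, bracket,
    Real.sq_sqrt (by positivity)]
  nlinarith [norm_nonneg x, norm_nonneg y, norm_nonneg (x + y)]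

/-- The weight `⟨x⟩^s`, with values in `[0, ∞]`. -/
def weight (s : ℝ) (x : Eucl n) : ℝ≥0∞ := ENNReal.ofReal (bracket x ^ s)

theorem weight_ne_top (s : ℝ) (x : Eucl n) : weight s x ≠ ∞ := ENNReal.ofReal_ne_top

theorem measurable_weight (s : ℝ) : Measurable (weight s : Eucl n → ℝ≥0∞) :=
  ENNReal.measurable_ofReal.comp (continuous_bracket.measurable.pow_const s)

theorem weight_neg (s : ℝ) (x : Eucl n) : weight s (-x) = weight s x := by
  simp [weight, bracket_neg]

theorem weight_add (s t : ℝ) (x : Eucl n) : weight (s + t) x = weight s x * weight t x := by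
  rw [weight, weight, weight, ← ENNReal.ofReal_mul (by have := bracket_pos x; positivity),
    Real.rpow_add (bracket_pos x)]

theorem weight_zero (x : Eucl n) : weight 0 x = 1 := by simp [weight]

theorem weight_rpow (s r : ℝ) (x : Eucl n) : weight s x ^ r = weight (s * r) x := by
  rw [weight, ENNReal.ofReal_rpow_of_pos (Real.rpow_pos_of_pos (bracket_pos x) s),
    ← Real.rpow_mul (bracket_pos x).le, weight]

theorem one_le_weight {s : ℝ} (hs : 0 ≤ s) (x : Eucl n) : 1 ≤ weight s x := by
  rw [weight, ENNReal.one_le_ofReal]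
  exact Real.one_le_rpow (one_le_bracket x) hs

/-- The weight `⟨x⟩^s` is weakly subadditive. -/
theorem weight_add_le {s : ℝ} (hs : 0 ≤ s) (x y : Eucl n) :
    weight s (x + y) ≤ ENNReal.ofReal (2 ^ s) * (weight s x + weight s y) := by
  have hx := (bracket_pos x).le
  have hy := (bracket_pos y).le
  rw [weight, weight, weight, ← ENNReal.ofReal_add (by positivity) (by positivity),
    ← ENNReal.ofReal_mul (by positivity)]
  refine ENNReal.ofReal_le_ofReal ?_
  calc bracket (x + y) ^ s ≤ (2 * max (bracket x) (bracket y)) ^ s :=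
        Real.rpow_le_rpow (bracket_pos _).le (bracket_add_le_max x y) hs
    _ = 2 ^ s * max (bracket x) (bracket y) ^ s := Real.mul_rpow zero_le_two (le_max_of_le_left hx)
    _ ≤ _ := by
      gcongr
      rcases max_cases (bracket x) (bracket y) with h | h <;> rw [h.1]
      · have : 0 ≤ bracket y ^ s := by positivity
        linarith
      · have : 0 ≤ bracket x ^ s := by positivity
        linarith

/-- Peetre's inequality. -/
theorem weight_add_le_mul {s : ℝ} (hs : 0 ≤ s) (x y : Eucl n) :
    weight s (x + y) ≤ ENNReal.ofReal (2 ^ s) * (weight s x * weight s y) := by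
  have hx := (bracket_pos x).le
  have hy := (bracket_pos y).le
  rw [weight, weight, weight, ← ENNReal.ofReal_mul (by positivity),
    ← ENNReal.ofReal_mul (by positivity), ← Real.mul_rpow hx hy,
    ← Real.mul_rpow zero_le_two (by positivity)]
  exact ENNReal.ofReal_le_ofReal (Real.rpow_le_rpow (bracket_pos _).le (bracket_add_le_mul x y) hs)

/-- On a ball the weight `⟨x⟩^{-t}` is bounded below. -/
theorem one_le_mul_weight_neg {t R : ℝ} (ht : 0 ≤ t) {x : Eucl n} (hx : ‖x‖ ≤ R) :
    1 ≤ ENNReal.ofReal ((1 + R) ^ t) * weight (-t) x := by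
  calc (1 : ℝ≥0∞) = weight t x * weight (-t) x := by
        rw [← weight_add, add_neg_cancel, weight_zero]
    _ ≤ _ := by
      refine mul_le_mul_left (ENNReal.ofReal_le_ofReal ?_) _
      exact Real.rpow_le_rpow (bracket_pos _).le
        ((bracket_le_one_add_norm _).trans (by gcongr)) ht

theorem lintegral_weight_neg_lt_top {t : ℝ} (ht : n < t) :
    ∫⁻ x : Eucl n, weight (-t) x < ∞ := by
  have h := integrable_rpow_neg_one_add_norm_sq (E := Eucl n) (μ := volume) (r := t)
    (by simpa using ht)
  have h2 := h.lintegral_lt_top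
  convert h2 using 4 with x
  rw [weight, bracket, Real.sqrt_eq_rpow, ← Real.rpow_mul (by positivity)]
  congr 2; ring

@[simp] theorem latticePt_add (k l : Fin n → ℤ) :
    latticePt (k + l) = latticePt k + latticePt l := by
  ext i; simp [latticePt]

@[simp] theorem latticePt_apply (k : Fin n → ℤ) (i : Fin n) : latticePt k i = k i := rfl

/-- The half-open unit cube with lower corner `k`. -/
def unitCube (k : Fin n → ℤ) : Set (Eucl n) := {y | ∀ i, ⌊y i⌋ = k i}

theorem measurableSet_unitCube (k : Fin n → ℤ) : MeasurableSet (unitCube k) := by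
  have : unitCube k = ⋂ i, {y : Eucl n | ⌊y i⌋ = k i} := by ext; simp [unitCube]
  rw [this]
  refine MeasurableSet.iInter fun i => ?_
  have : Measurable fun y : Eucl n => ⌊y i⌋ := Int.measurable_floor.comp (by fun_prop)
  exact this (measurableSet_singleton (k i))

theorem volume_unitCube (k : Fin n → ℤ) : volume (unitCube k) = 1 := by
  have e : unitCube k = (WithLp.ofLp : Eucl n → Fin n → ℝ) ⁻¹'
      (Set.univ.pi fun i => Set.Ico (k i : ℝ) (k i + 1)) := by
    ext y; simp [unitCube, Int.floor_eq_iff]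
  rw [e, (PiLp.volume_preserving_ofLp (Fin n)).measure_preimage
    (MeasurableSet.univ_pi fun i => measurableSet_Ico).nullMeasurableSet, Real.volume_pi_Ico]
  simp

theorem pairwise_disjoint_unitCube : Pairwise (Function.onFun Disjoint (unitCube (n := n))) := by
  intro k l hkl
  refine Set.disjoint_left.2 fun y hk hl => hkl ?_
  ext i; exact (hk i).symm.trans (hl i)

theorem iUnion_unitCube : ⋃ k, unitCube (n := n) k = Set.univ :=
  Set.eq_univ_of_forall fun y => Set.mem_iUnion.2 ⟨fun i => ⌊y i⌋, fun _ => rfl⟩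

theorem norm_sub_latticePt_le {k : Fin n → ℤ} {y : Eucl n} (hy : y ∈ unitCube k) :
    ‖latticePt k - y‖ ≤ n := by
  have h1 : ‖latticePt k - y‖ ^ 2 ≤ n := by
    rw [EuclideanSpace.norm_sq_eq]
    calc _ ≤ ∑ i : Fin n, (1 : ℝ) := by
          refine Finset.sum_le_sum fun i _ => ?_
          have := (Int.floor_eq_iff.1 (hy i))
          rw [Real.norm_eq_abs, sq_abs]
          simp only [PiLp.sub_apply, latticePt_apply]
          nlinarith
      _ = n := by simp
  have h2 : (n : ℝ) ≤ (n : ℝ) ^ 2 := by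
    norm_cast; nlinarith [Nat.zero_le n, sq_nonneg ((n : ℤ) - 1), Nat.le_self_pow two_ne_zero n]
  exact (sq_le_sq₀ (norm_nonneg _) (by positivity)).1 (h1.trans h2)

/-- Sums of `⟨x - k⟩^{-t}` over the lattice are bounded uniformly in `x` for `t > n`, by comparison
with the integral. -/
theorem exists_tsum_weight_neg_le {t : ℝ} (ht : n < t) :
    ∃ A : ℝ≥0∞, A ≠ ∞ ∧ ∀ x : Eucl n, ∑' k : Fin n → ℤ, weight (-t) (x - latticePt k) ≤ A := by
  have ht0 : 0 ≤ t := (Nat.cast_nonneg n).trans ht.le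
  -- By Peetre's inequality, the value at `k` is controlled by the mean value over the unit cube.
  set c : ℝ≥0∞ := ENNReal.ofReal (2 ^ t) * ENNReal.ofReal ((1 + n) ^ t)
  refine ⟨c * ∫⁻ x : Eucl n, weight (-t) x,
    ENNReal.mul_ne_top (by finiteness) (lintegral_weight_neg_lt_top ht).ne, fun x => ?_⟩
  have key : ∀ k : Fin n → ℤ, weight (-t) (x - latticePt k) ≤
      ∫⁻ y in unitCube k, c * weight (-t) (x - y) := by
    intro k
    calc weight (-t) (x - latticePt k)
        = ∫⁻ y in unitCube k, weight (-t) (x - latticePt k) := by simp [volume_unitCube]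
      _ ≤ _ := by
        refine setLIntegral_mono' (measurableSet_unitCube k) fun y hy => ?_
        have h1 := weight_add_le_mul ht0 (x - latticePt k) (latticePt k - y)
        rw [sub_add_sub_cancel] at h1
        have h2 : weight t (latticePt k - y) ≤ ENNReal.ofReal ((1 + n) ^ t) := by
          refine ENNReal.ofReal_le_ofReal (Real.rpow_le_rpow (bracket_pos _).le ?_ ht0)
          exact (bracket_le_one_add_norm _).trans (by gcongr; exact norm_sub_latticePt_le hy)
        have h3 : weight t (x - y) ≤ c * weight t (x - latticePt k) :=
          h1.trans (by
            calc _ ≤ ENNReal.ofReal (2 ^ t) *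
                  (weight t (x - latticePt k) * ENNReal.ofReal ((1 + n) ^ t)) := by gcongr
              _ = _ := by simp only [c]; ring)
        have i1 : weight (-t) (x - y) * weight t (x - y) = 1 := by
          rw [← weight_add, neg_add_cancel, weight_zero]
        have i2 : weight t (x - latticePt k) * weight (-t) (x - latticePt k) = 1 := by
          rw [← weight_add, add_neg_cancel, weight_zero]
        calc weight (-t) (x - latticePt k)
            = weight (-t) (x - y) * weight t (x - y) * weight (-t) (x - latticePt k) := by
              rw [i1, one_mul]
          _ ≤ weight (-t) (x - y) * (c * weight t (x - latticePt k)) *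
                weight (-t) (x - latticePt k) := by gcongr
          _ = c * weight (-t) (x - y) *
                (weight t (x - latticePt k) * weight (-t) (x - latticePt k)) := by ring
          _ = _ := by rw [i2, mul_one]
  calc _ ≤ ∑' k : Fin n → ℤ, ∫⁻ y in unitCube k, c * weight (-t) (x - y) :=
        ENNReal.tsum_le_tsum key
    _ = ∫⁻ y, c * weight (-t) (x - y) := by
        rw [← lintegral_iUnion measurableSet_unitCube pairwise_disjoint_unitCube, iUnion_unitCube,
          setLIntegral_univ]
    _ = c * ∫⁻ y, weight (-t) (x - y) :=
        lintegral_const_mul _ ((measurable_weight _).comp (measurable_const.sub measurable_id))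
    _ = _ := by rw [lintegral_sub_left_eq_self (fun y => weight (-t) y) x]

/-- The condition on `(q, s)` under which `L^q_s(ℝⁿ)` and `ℓ^q_s(ℤⁿ)` are convolution algebras. -/
def AdmissibleWeight (n : ℕ) (q : ℝ≥0∞) (s : ℝ) : Prop :=
  (q = 1 ∧ 0 ≤ s) ∨ (1 < q ∧ (n : ℝ) / (ENNReal.conjExponent q).toReal < s)

theorem AdmissibleWeight.one_le {q : ℝ≥0∞} {s : ℝ} (h : AdmissibleWeight n q s) : 1 ≤ q := by
  rcases h with h | h
  · exact h.1.ge
  · exact h.1.le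

theorem AdmissibleWeight.nonneg {q : ℝ≥0∞} {s : ℝ} (h : AdmissibleWeight n q s) : 0 ≤ s := by
  rcases h with h | h
  · exact h.2
  · exact le_trans (by positivity) h.2.le

/-- Hölder's inequality: `L^q_s ⊆ L^1`, because `⟨·⟩^{-s}` is in `L^{q'}`. The integral over `ℝⁿ`
and the sum over `ℤⁿ` are treated together. -/
theorem exists_lintegral_le_mul_eLpNorm_weight {α : Type*} [MeasurableSpace α] (μ : Measure α)
    {ι : α → Eucl n} (hι : Measurable ι) {q : ℝ≥0∞} {s : ℝ} (h : AdmissibleWeight n q s)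
    (hint : ∀ t : ℝ, n < t → ∫⁻ x, weight (-t) (ι x) ∂μ < ∞) :
    ∃ D : ℝ≥0∞, D ≠ ∞ ∧ ∀ a : α → ℝ≥0∞, AEMeasurable a μ →
      ∫⁻ x, a x ∂μ ≤ D * eLpNorm (fun x => weight s (ι x) * a x) q μ := by
  have hsplit : ∀ (a : α → ℝ≥0∞) x, a x = weight (-s) (ι x) * (weight s (ι x) * a x) := by
    intro a x
    rw [← mul_assoc, ← weight_add, neg_add_cancel, weight_zero, one_mul]
  have hs := h.nonneg
  rcases h with ⟨rfl, hs⟩ | ⟨hq, hns⟩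
  · refine ⟨1, by simp, fun a _ => ?_⟩
    rw [eLpNorm_one_eq_lintegral_enorm, one_mul]
    exact lintegral_mono fun x => le_mul_of_one_le_left' (one_le_weight hs _)
  have hm : Measurable fun x => weight (-s) (ι x) := (measurable_weight _).comp hι
  rcases eq_or_ne q ∞ with rfl | hq'
  · refine ⟨∫⁻ x, weight (-s) (ι x) ∂μ, (hint s ?_).ne, fun a ha => ?_⟩
    · simpa [ENNReal.conjExponent] using hns
    calc ∫⁻ x, a x ∂μ = ∫⁻ x, weight (-s) (ι x) * (weight s (ι x) * a x) ∂μ := by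
          simp only [← hsplit]
      _ ≤ ∫⁻ x, weight (-s) (ι x) * eLpNorm (fun x => weight s (ι x) * a x) ∞ μ ∂μ := by
          refine lintegral_mono_ae ?_
          rw [eLpNorm_exponent_top]
          filter_upwards [enorm_ae_le_eLpNormEssSup (fun x => weight s (ι x) * a x) μ] with x hx
          gcongr
          simpa using hx
      _ = _ := lintegral_mul_const _ hm
  have hr : 1 < q.toReal := by
    rwa [← ENNReal.toReal_one, ENNReal.toReal_lt_toReal (by simp) hq']
  have hc : (q.toReal).HolderConjugate q.conjExponent.toReal := by
    have : ENNReal.HolderConjugate q q.conjExponent := ENNReal.HolderConjugate.conjExponent hq.le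
    rw [Real.holderConjugate_iff]
    refine ⟨hr, ?_⟩
    have h1 := this.inv_add_inv_eq_one
    have h2 := congrArg ENNReal.toReal h1
    rw [ENNReal.toReal_add] at h2
    · simpa using h2
    · exact ENNReal.inv_ne_top.2 (one_pos.trans hq).ne'
    · simp; exact this.symm.ne_zero
  set r' := q.conjExponent.toReal
  have hr' : 0 < r' := hc.symm.pos
  refine ⟨(∫⁻ x, weight (-(s * r')) (ι x) ∂μ) ^ (1 / r'), ?_, fun a ha => ?_⟩
  · refine (ENNReal.rpow_lt_top_of_nonneg (by positivity) (hint _ ?_).ne).ne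
    rwa [div_lt_iff₀ hr'] at hns
  have := ENNReal.lintegral_mul_le_Lp_mul_Lq μ hc.symm (f := fun x => weight (-s) (ι x))
    (g := fun x => weight s (ι x) * a x) hm.aemeasurable
    (((measurable_weight s).comp hι).aemeasurable.mul ha)
  simp only [Pi.mul_apply, ← hsplit, weight_rpow, neg_mul] at this
  rw [eLpNorm_eq_lintegral_rpow_enorm_toReal (one_pos.trans hq).ne' hq']
  simpa only [enorm_eq_self] using this

theorem exists_lintegral_le_mul_eLpNorm_weight_volume {q : ℝ≥0∞} {s : ℝ}
    (h : AdmissibleWeight n q s) :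
    ∃ D : ℝ≥0∞, D ≠ ∞ ∧ ∀ a : Eucl n → ℝ≥0∞, AEMeasurable a volume →
      ∫⁻ x, a x ≤ D * eLpNorm (fun x => weight s x * a x) q volume :=
  exists_lintegral_le_mul_eLpNorm_weight volume measurable_id h
    fun _ ht => lintegral_weight_neg_lt_top ht

theorem exists_tsum_le_mul_eLpNorm_weight_count {q : ℝ≥0∞} {s : ℝ} (h : AdmissibleWeight n q s) :
    ∃ D : ℝ≥0∞, D ≠ ∞ ∧ ∀ a : (Fin n → ℤ) → ℝ≥0∞,
      ∑' k, a k ≤ D * eLpNorm (fun k => weight s (latticePt k) * a k) q Measure.count := by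
  obtain ⟨D, hD, h⟩ := exists_lintegral_le_mul_eLpNorm_weight (Measure.count (α := Fin n → ℤ))
    (ι := latticePt) (measurable_of_countable _) h (fun t ht => by
      obtain ⟨A, hA, h⟩ := exists_tsum_weight_neg_le ht
      rw [lintegral_count]
      have := h 0
      simp only [zero_sub, weight_neg] at this
      exact this.trans_lt hA.lt_top)
  refine ⟨D, hD, fun a => ?_⟩
  rw [← lintegral_count]
  exact h a (measurable_of_countable a).aemeasurable

/-- `L^q_s(ℝⁿ)` is a convolution algebra. -/
theorem exists_eLpNorm_weight_conv_le_volume {q : ℝ≥0∞} {s : ℝ} (h : AdmissibleWeight n q s) :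
    ∃ C : ℝ≥0∞, C ≠ ∞ ∧ ∀ a b : Eucl n → ℝ≥0∞, AEMeasurable a volume → AEMeasurable b volume →
      eLpNorm (fun x => weight s x * ∫⁻ y, a (x - y) * b y) q volume ≤
        C * eLpNorm (fun x => weight s x * a x) q volume *
          eLpNorm (fun x => weight s x * b x) q volume := by
  obtain ⟨D, hD, hemb⟩ := exists_lintegral_le_mul_eLpNorm_weight_volume h
  refine ⟨2 * ENNReal.ofReal (2 ^ s) * D, by finiteness, fun a b ha hb => ?_⟩
  exact eLpNorm_weight_mul_conv_le volume (measurable_weight s) h.one_le (weight_add_le h.nonneg)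
    hemb ha hb

/-- `ℓ^q_s(ℤⁿ)` is a convolution algebra. -/
theorem exists_eLpNorm_weight_conv_le_count {q : ℝ≥0∞} {s : ℝ} (h : AdmissibleWeight n q s) :
    ∃ C : ℝ≥0∞, C ≠ ∞ ∧ ∀ a b : (Fin n → ℤ) → ℝ≥0∞,
      eLpNorm (fun k => weight s (latticePt k) * ∑' l, a (k - l) * b l) q Measure.count ≤
        C * eLpNorm (fun k => weight s (latticePt k) * a k) q Measure.count *
          eLpNorm (fun k => weight s (latticePt k) * b k) q Measure.count := by
  obtain ⟨D, hD, hemb⟩ := exists_tsum_le_mul_eLpNorm_weight_count h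
  refine ⟨2 * ENNReal.ofReal (2 ^ s) * D, by finiteness, fun a b => ?_⟩
  have := eLpNorm_weight_mul_conv_le (Measure.count (α := Fin n → ℤ))
    (w := fun k => weight s (latticePt k)) (measurable_of_countable _) h.one_le
    (fun k l => by simpa using weight_add_le h.nonneg (latticePt k) (latticePt l))
    (fun a _ => by rw [lintegral_count]; exact hemb a)
    (measurable_of_countable a).aemeasurable (measurable_of_countable b).aemeasurable
  simpa only [lintegral_count] using this

/-- Passage between `L^q_s(ℝⁿ)` and `ℓ^q_s(ℤⁿ)` (in either direction) by a kernel which decays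
rapidly off the diagonal. -/
theorem eLpNorm_weight_kernel_le {α β : Type*} [MeasurableSpace α] [MeasurableSpace β]
    (μ : Measure α) (ν : Measure β) [SFinite μ] [SFinite ν] {ι : α → Eucl n} {κ : β → Eucl n}
    (hι : Measurable ι) (hκ : Measurable κ) {q : ℝ≥0∞} (hq : 1 ≤ q) {s t : ℝ} (hs : 0 ≤ s)
    {A : ℝ≥0∞} (h1 : ∀ x : Eucl n, ∫⁻ y, weight (-t) (x - κ y) ∂ν ≤ A)
    (h2 : ∀ y : Eucl n, ∫⁻ x, weight (-t) (y - ι x) ∂μ ≤ A) {a : β → ℝ≥0∞}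
    (ha : AEMeasurable a ν) :
    eLpNorm (fun x => weight s (ι x) * ∫⁻ y, weight (-(t + s)) (ι x - κ y) * a y ∂ν) q μ ≤
      ENNReal.ofReal (2 ^ s) * A * eLpNorm (fun y => weight s (κ y) * a y) q ν := by
  have hm : Measurable fun z : α × β => weight (-t) (ι z.1 - κ z.2) :=
    (measurable_weight _).comp ((hι.comp measurable_fst).sub (hκ.comp measurable_snd))
  have hsch := eLpNorm_lintegral_kernel_le μ ν
    (k := fun x y => ENNReal.ofReal (2 ^ s) * weight (-t) (ι x - κ y))
    (hm.const_mul _) (((measurable_weight s).comp hκ).aemeasurable.mul ha) hq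
    (A := ENNReal.ofReal (2 ^ s) * A)
    (fun x => by
      rw [lintegral_const_mul]
      · gcongr; exact h1 _
      · exact hm.of_uncurry_left (f := fun x y => weight (-t) (ι x - κ y)))
    (fun y => by
      rw [lintegral_const_mul]
      · gcongr
        simpa only [← weight_neg (-t) (ι _ - κ _), neg_sub] using h2 (κ y)
      · exact hm.of_uncurry_right (f := fun x y => weight (-t) (ι x - κ y)))
  refine (eLpNorm_mono_enorm fun x => ?_).trans hsch
  simp only [enorm_eq_self]
  rw [← lintegral_const_mul' _ _ (weight_ne_top _ _)]
  refine lintegral_mono fun y => ?_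
  have hp := weight_add_le_mul hs (ι x - κ y) (κ y)
  rw [sub_add_cancel] at hp
  calc weight s (ι x) * (weight (-(t + s)) (ι x - κ y) * a y)
      ≤ (ENNReal.ofReal (2 ^ s) * (weight s (ι x - κ y) * weight s (κ y))) *
          (weight (-(t + s)) (ι x - κ y) * a y) := by gcongr
    _ = ENNReal.ofReal (2 ^ s) * (weight s (ι x - κ y) * weight (-(t + s)) (ι x - κ y)) *
          (weight s (κ y) * a y) := by ring
    _ = _ := by
      rw [← weight_add, show s + -(t + s) = -t by ring]
      rfl

/-! ### Tempered distributions given by functions -/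

/-- A smooth compactly supported function, equal to `1` on the ball of radius `|R| + 1` and to `0`
outside the ball of radius `|R| + 2`. -/
def cutoff (n : ℕ) (R : ℝ) : 𝓢(Eucl n, ℂ) :=
  let b : ContDiffBump (0 : Eucl n) := ⟨|R| + 1, |R| + 2, by positivity, by linarith⟩
  have hb : HasCompactSupport (Complex.ofRealCLM ∘ b) := b.hasCompactSupport.comp_left rfl
  hb.toSchwartzMap (Complex.ofRealCLM.contDiff.comp b.contDiff)

theorem cutoff_eq_one {n : ℕ} {R : ℝ} {x : Eucl n} (hx : ‖x‖ ≤ |R| + 1) : cutoff n R x = 1 := by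
  let b : ContDiffBump (0 : Eucl n) := ⟨|R| + 1, |R| + 2, by positivity, by linarith⟩
  have : b x = 1 := b.one_of_mem_closedBall (by simpa [b] using hx)
  change ((b x : ℝ) : ℂ) = 1
  rw [this, Complex.ofReal_one]

theorem cutoff_eq_zero {n : ℕ} {R : ℝ} {x : Eucl n} (hx : |R| + 2 ≤ ‖x‖) : cutoff n R x = 0 := by
  let b : ContDiffBump (0 : Eucl n) := ⟨|R| + 1, |R| + 2, by positivity, by linarith⟩
  have : b x = 0 := b.zero_of_le_dist (by simpa [b] using hx)
  change ((b x : ℝ) : ℂ) = 0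
  rw [this, Complex.ofReal_zero]

section GivenBy

variable {f g : 𝓢'(Eucl n, ℂ)} {u v : Eucl n → ℂ}

theorem IsGivenBy.integrableOn (h : IsGivenBy f u) (R : ℝ) :
    IntegrableOn u (Metric.closedBall 0 R) := by
  have h1 := (h (cutoff n R)).1.integrableOn (s := Metric.closedBall 0 R)
  refine h1.congr_fun (fun x hx => ?_) Metric.isClosed_closedBall.measurableSet
  have : ‖x‖ ≤ R := by simpa using hx
  simp only [cutoff_eq_one (this.trans ((le_abs_self R).trans (by linarith))), one_mul]

theorem IsGivenBy.locallyIntegrable (h : IsGivenBy f u) : LocallyIntegrable u := by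
  rw [locallyIntegrable_iff]
  intro K hK
  obtain ⟨R, hR⟩ := hK.isBounded.subset_closedBall 0
  exact (h.integrableOn R).mono_set hR

theorem IsGivenBy.aestronglyMeasurable (h : IsGivenBy f u) : AEStronglyMeasurable u volume :=
  h.locallyIntegrable.aestronglyMeasurable

theorem IsGivenBy.ae_eq (hu : IsGivenBy f u) (hv : IsGivenBy f v) : u =ᵐ[volume] v := by
  refine ae_eq_of_integral_contDiff_smul_eq hu.locallyIntegrable hv.locallyIntegrable
    fun g hg hgs => ?_
  have hb : HasCompactSupport (Complex.ofRealCLM ∘ g) := hgs.comp_left rfl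
  have hb' : ContDiff ℝ (⊤ : ℕ∞) (Complex.ofRealCLM ∘ g) := Complex.ofRealCLM.contDiff.comp hg
  have h1 := (hu (hb.toSchwartzMap hb')).2
  have h2 := (hv (hb.toSchwartzMap hb')).2
  exact h1.symm.trans h2

theorem IsGivenBy.eq_of_continuous (hu : IsGivenBy f u) (hv : IsGivenBy f v) (cu : Continuous u)
    (cv : Continuous v) : u = v :=
  (cu.ae_eq_iff_eq volume cv).1 (hu.ae_eq hv)

theorem IsGivenBy.add (hu : IsGivenBy f u) (hv : IsGivenBy g v) :
    IsGivenBy (f + g) (fun x => u x + v x) := fun ψ => by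
  simp only [mul_add]
  refine ⟨(hu ψ).1.add (hv ψ).1, ?_⟩
  rw [integral_add (hu ψ).1 (hv ψ).1, ← (hu ψ).2, ← (hv ψ).2]; rfl

theorem IsGivenBy.const_smul (hu : IsGivenBy f u) (c : ℂ) :
    IsGivenBy (c • f) (fun x => c * u x) := fun ψ => by
  have e : ∀ x, ψ x * (c * u x) = c * (ψ x * u x) := fun x => by ring
  simp only [e]
  refine ⟨(hu ψ).1.const_mul c, ?_⟩
  rw [integral_const_mul, ← (hu ψ).2]; rfl

theorem IsGivenBy.sub (hu : IsGivenBy f u) (hv : IsGivenBy g v) :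
    IsGivenBy (f - g) (fun x => u x - v x) := fun ψ => by
  simp only [mul_sub]
  refine ⟨(hu ψ).1.sub (hv ψ).1, ?_⟩
  rw [integral_sub (hu ψ).1 (hv ψ).1, ← (hu ψ).2, ← (hv ψ).2]; rfl

theorem IsGivenBy.unique (hu : IsGivenBy f u) (hv : IsGivenBy g u) : f = g := by
  ext ψ; rw [(hu ψ).2, (hv ψ).2]

/-- `0` is given by the function `0`. -/
theorem isGivenBy_zero : IsGivenBy (0 : 𝓢'(Eucl n, ℂ)) (fun _ => 0) := fun ψ => by simp

theorem weightedLpNorm_eq (hu : IsGivenBy f u) (p : ℝ≥0∞) (s : ℝ) :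
    weightedLpNorm p s f = eLpNorm (fun x => weight s x * ‖u x‖ₑ) p volume := by
  have key : ∀ v, IsGivenBy f v → eLpNorm (fun x => (bracket x ^ s : ℝ) • v x) p volume =
      eLpNorm (fun x => weight s x * ‖u x‖ₑ) p volume := by
    intro v hv
    have e : ∀ᵐ x, ‖(bracket x ^ s : ℝ) • v x‖ₑ = ‖weight s x * ‖u x‖ₑ‖ₑ := by
      filter_upwards [hu.ae_eq hv] with x hx
      rw [enorm_smul, hx, weight, enorm_eq_self,
        Real.enorm_of_nonneg (Real.rpow_nonneg (bracket_pos x).le s)]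
    exact le_antisymm (eLpNorm_mono_enorm_ae (e.mono fun _ h => h.le))
      (eLpNorm_mono_enorm_ae (e.mono fun _ h => h.ge))
  rw [weightedLpNorm]
  refine le_antisymm ((iInf₂_le u hu).trans (key u hu).le) (le_iInf₂ fun v hv => (key v hv).ge)

/-- The infimum which defines `weightedLpNorm` is `∞` when it runs over the empty set. -/
theorem exists_isGivenBy_of_weightedLpNorm_lt_top {p : ℝ≥0∞} {s : ℝ}
    (h : weightedLpNorm p s f < ∞) : ∃ u, IsGivenBy f u := by
  by_contra hc
  push Not at hc
  simp [weightedLpNorm, hc] at h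

theorem weightedLpNorm_zero_eq (hu : IsGivenBy f u) (p : ℝ≥0∞) :
    weightedLpNorm p 0 f = eLpNorm u p volume := by
  rw [weightedLpNorm_eq hu]
  simp only [weight_zero, one_mul, eLpNorm_enorm]

theorem exists_isGivenBy_of_integrable {F : Eucl n → ℂ} (hF : Integrable F) :
    ∃ T : 𝓢'(Eucl n, ℂ), IsGivenBy T F := by
  have hm : MemLp F 1 volume := memLp_one_iff_integrable.2 hF
  refine ⟨Lp.toTemperedDistribution (hm.toLp F), fun ψ => ⟨?_, ?_⟩⟩
  · exact hF.bdd_mul ψ.continuous.aestronglyMeasurable (c := SchwartzMap.seminorm ℝ 0 0 ψ)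
      (ae_of_all _ fun x => SchwartzMap.norm_le_seminorm ℝ ψ x)
  · rw [Lp.toTemperedDistribution_apply]
    refine integral_congr_ae ?_
    filter_upwards [hm.coeFn_toLp] with x hx
    rw [hx, smul_eq_mul]

end GivenBy

/-! ### The inverse Fourier transform of integrable functions -/

theorem schwartzFourier_apply (ψ : 𝓢(Eucl n, ℂ)) (ξ : Eucl n) :
    schwartzFourier n ψ ξ = 𝓕 (ψ : Eucl n → ℂ) ((2 * Real.pi)⁻¹ • ξ) := rfl

@[simp] theorem schwartzFourier_schwartzFourierInv (ψ : 𝓢(Eucl n, ℂ)) :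
    schwartzFourier n (schwartzFourierInv n ψ) = ψ := by
  ext ξ
  let θ : 𝓢(Eucl n, ℂ) :=
    compCLMOfContinuousLinearEquiv ℂ (dilation n (2 * Real.pi) two_pi_ne_zero) ψ
  have h : 𝓕 (𝓕⁻ θ) = θ := FourierTransform.fourier_fourierInv_eq _
  have h2 := DFunLike.congr_fun h ((2 * Real.pi)⁻¹ • ξ)
  refine h2.trans ?_
  change ψ ((2 * Real.pi) • (2 * Real.pi)⁻¹ • ξ) = ψ ξ
  rw [smul_inv_smul₀ two_pi_ne_zero]

@[simp] theorem schwartzFourierInv_schwartzFourier (ψ : 𝓢(Eucl n, ℂ)) :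
    schwartzFourierInv n (schwartzFourier n ψ) = ψ := by
  have h : compCLMOfContinuousLinearEquiv ℂ (dilation n (2 * Real.pi) two_pi_ne_zero)
      (schwartzFourier n ψ) = 𝓕 ψ := by
    ext η
    change 𝓕 (ψ : Eucl n → ℂ) ((2 * Real.pi)⁻¹ • (2 * Real.pi) • η) = 𝓕 (ψ : Eucl n → ℂ) η
    rw [inv_smul_smul₀ two_pi_ne_zero]
  change 𝓕⁻ (compCLMOfContinuousLinearEquiv ℂ (dilation n (2 * Real.pi) two_pi_ne_zero)
    (schwartzFourier n ψ)) = ψ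
  rw [h]
  exact FourierTransform.fourierInv_fourier_eq (F := 𝓢(Eucl n, ℂ)) ψ

@[simp] theorem distFourier_distFourierInv (f : 𝓢'(Eucl n, ℂ)) :
    distFourier (distFourierInv f) = f := by
  ext ψ
  change f (schwartzFourierInv n (schwartzFourier n ψ)) = f ψ
  simp

/-- The constant `(2π)^{-n}`. -/
def fourierConst (n : ℕ) : ℝ := ((2 * Real.pi) ^ n)⁻¹

theorem fourierConst_pos : 0 < fourierConst n := by unfold fourierConst; positivity

theorem fourierConst_le_one : fourierConst n ≤ 1 :=
  inv_le_one_of_one_le₀ (one_le_pow₀ (by linarith [Real.pi_gt_three]))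

/-- The inverse Fourier transform `x ↦ (2π)^{-n} ∫ F(ξ) e^{i x ξ} dξ` of a function. -/
def invF (F : Eucl n → ℂ) (x : Eucl n) : ℂ := fourierConst n * 𝓕⁻ F ((2 * Real.pi)⁻¹ • x)

theorem continuous_invF {F : Eucl n → ℂ} (hF : Integrable F) : Continuous (invF F) := by
  have h0 : Continuous fun p : Eucl n × Eucl n => (-innerₗ (Eucl n)) p.1 p.2 :=
    (continuous_inner (𝕜 := ℝ) (E := Eucl n)).neg
  have : Continuous (𝓕⁻ F) :=
    VectorFourier.fourierIntegral_continuous Real.continuous_fourierChar h0 hF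
  exact continuous_const.mul (this.comp (continuous_const_smul _))

theorem enorm_fourierConst_le : ‖(fourierConst n : ℂ)‖ₑ ≤ 1 := by
  rw [← ofReal_norm, Complex.norm_real, Real.norm_of_nonneg fourierConst_pos.le]
  simpa using fourierConst_le_one

theorem enorm_invF_le (F : Eucl n → ℂ) (x : Eucl n) : ‖invF F x‖ₑ ≤ ∫⁻ ξ, ‖F ξ‖ₑ := by
  rw [invF, enorm_mul]
  calc _ ≤ 1 * ∫⁻ ξ, ‖F ξ‖ₑ := by
        refine mul_le_mul' enorm_fourierConst_le ?_
        rw [Real.fourierInv_eq]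
        refine (enorm_integral_le_lintegral_enorm _).trans_eq (lintegral_congr fun ξ => ?_)
        rw [← ofReal_norm, Circle.norm_smul, ofReal_norm]
    _ = _ := one_mul _

theorem invF_add {F G : Eucl n → ℂ} (hF : Integrable F) (hG : Integrable G) (x : Eucl n) :
    invF (fun ξ => F ξ + G ξ) x = invF F x + invF G x := by
  rw [invF, invF, invF, ← mul_add, Real.fourierInv_eq, Real.fourierInv_eq, Real.fourierInv_eq,
    ← integral_add]
  · simp only [smul_add]
  · simpa only [neg_neg, inner_neg_right] using
      (Real.fourierIntegral_convergent_iff (-((2 * Real.pi)⁻¹ • x))).2 hF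
  · simpa only [neg_neg, inner_neg_right] using
      (Real.fourierIntegral_convergent_iff (-((2 * Real.pi)⁻¹ • x))).2 hG

theorem invF_const_mul (c : ℂ) (F : Eucl n → ℂ) (x : Eucl n) :
    invF (fun ξ => c * F ξ) x = c * invF F x := by
  rw [invF, invF, Real.fourierInv_eq, Real.fourierInv_eq, mul_left_comm]
  congr 1
  rw [← integral_const_mul]
  refine integral_congr_ae (ae_of_all _ fun ξ => ?_)
  simp only [Circle.smul_def, smul_eq_mul]; ring

theorem invF_congr_ae {F G : Eucl n → ℂ} (h : F =ᵐ[volume] G) : invF F = invF G := by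
  ext x
  rw [invF, invF, Real.fourierInv_congr_ae h]

/-- A translation of `F` multiplies `invF F` by a unimodular function. -/
theorem norm_invF_comp_sub (F : Eucl n → ℂ) (a x : Eucl n) :
    ‖invF (fun ξ => F (ξ - a)) x‖ = ‖invF F x‖ := by
  have h := congrFun (VectorFourier.fourierIntegral_comp_add_right Real.fourierChar
    (volume : Measure (Eucl n)) (-innerₗ (Eucl n)) F (-a)) ((2 * Real.pi)⁻¹ • x)
  have h' : 𝓕⁻ (fun ξ => F (ξ - a)) ((2 * Real.pi)⁻¹ • x) =
      Real.fourierChar ((-innerₗ (Eucl n)) (-a) ((2 * Real.pi)⁻¹ • x)) •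
        𝓕⁻ F ((2 * Real.pi)⁻¹ • x) := by
    simp only [sub_eq_add_neg]
    exact h
  rw [invF, h', norm_mul, invF, norm_mul, Circle.norm_smul]

theorem schwartzFourierInv_apply (ψ : 𝓢(Eucl n, ℂ)) (x : Eucl n) :
    schwartzFourierInv n ψ x = 𝓕⁻ (fun η => ψ ((2 * Real.pi) • η)) x := by
  change 𝓕⁻ (compCLMOfContinuousLinearEquiv ℂ (dilation n (2 * Real.pi) two_pi_ne_zero) ψ) x = _
  rw [SchwartzMap.fourierInv_coe]
  rfl

/-- On Schwartz functions `invF` is the inverse Fourier transform. -/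
theorem invF_schwartz (ψ : 𝓢(Eucl n, ℂ)) : invF ψ = schwartzFourierInv n ψ := by
  ext x
  rw [schwartzFourierInv_apply, invF, Real.fourierInv_eq, Real.fourierInv_eq]
  have h := Measure.integral_comp_smul (volume : Measure (Eucl n))
    (fun v => Real.fourierChar (inner ℝ v ((2 * Real.pi)⁻¹ • x)) • ψ v) (2 * Real.pi)
  rw [finrank_euclideanSpace_fin, abs_of_pos (by positivity)] at h
  rw [fourierConst, ← smul_eq_mul, Complex.coe_smul, ← h]
  congr 1; ext v
  rw [inner_smul_left, inner_smul_right]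
  congr 2
  simp [← mul_assoc]

/-- The inverse Fourier transform is its own transpose. -/
theorem integral_mul_schwartzFourierInv {F : Eucl n → ℂ} (hF : Integrable F)
    (ψ : 𝓢(Eucl n, ℂ)) : ∫ ξ, F ξ * schwartzFourierInv n ψ ξ = ∫ x, invF F x * ψ x := by
  have h0 : Continuous fun p : Eucl n × Eucl n => (-innerₗ (Eucl n)) p.1 p.2 :=
    (continuous_inner (𝕜 := ℝ) (E := Eucl n)).neg
  have hψ : Integrable fun η => ψ ((2 * Real.pi) • η) :=
    (compCLMOfContinuousLinearEquiv ℂ (dilation n (2 * Real.pi) two_pi_ne_zero) ψ).integrable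
  have h := VectorFourier.integral_fourierIntegral_smul_eq_flip (μ := (volume : Measure (Eucl n)))
    (ν := (volume : Measure (Eucl n))) (L := -innerₗ (Eucl n))
    Real.continuous_fourierChar h0 hF hψ
  have e : (-innerₗ (Eucl n)).flip = -innerₗ (Eucl n) := by
    ext x y; simp [real_inner_comm]
  rw [e] at h
  have h1 : ∫ ξ, F ξ * schwartzFourierInv n ψ ξ =
      ∫ η, 𝓕⁻ F η * ψ ((2 * Real.pi) • η) := by
    simp only [schwartzFourierInv_apply]
    exact h.symm
  have h2 := Measure.integral_comp_smul (volume : Measure (Eucl n))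
    (fun x => 𝓕⁻ F ((2 * Real.pi)⁻¹ • x) * ψ x) (2 * Real.pi)
  rw [finrank_euclideanSpace_fin, abs_of_pos (by positivity)] at h2
  simp only [inv_smul_smul₀ two_pi_ne_zero] at h2
  rw [h1, h2, ← Complex.coe_smul, smul_eq_mul, ← integral_const_mul]
  simp only [invF, fourierConst, mul_assoc]

theorem integral_mul_eq_integral_invF_mul {F : Eucl n → ℂ} (hF : Integrable F)
    (ψ : 𝓢(Eucl n, ℂ)) : ∫ ξ, F ξ * ψ ξ = ∫ x, invF F x * schwartzFourier n ψ x := by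
  rw [← integral_mul_schwartzFourierInv hF, schwartzFourierInv_schwartzFourier]

theorem integrable_schwartz_mul_invF {F : Eucl n → ℂ} (hF : Integrable F) (ψ : 𝓢(Eucl n, ℂ)) :
    Integrable fun x => ψ x * invF F x := by
  refine ψ.integrable.mul_bdd (c := (∫⁻ ξ, ‖F ξ‖ₑ).toReal)
    (continuous_invF hF).aestronglyMeasurable (ae_of_all _ fun x => ?_)
  rw [← toReal_enorm]
  exact ENNReal.toReal_mono hF.2.ne (enorm_invF_le F x)

theorem integrable_schwartz_mul {F : Eucl n → ℂ} (hF : Integrable F) (ψ : 𝓢(Eucl n, ℂ)) :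
    Integrable fun x => ψ x * F x :=
  hF.bdd_mul ψ.continuous.aestronglyMeasurable (c := SchwartzMap.seminorm ℝ 0 0 ψ)
    (ae_of_all _ fun x => SchwartzMap.norm_le_seminorm ℝ ψ x)

theorem isGivenBy_distFourierInv {f : 𝓢'(Eucl n, ℂ)} {F : Eucl n → ℂ} (hF : Integrable F)
    (h : IsGivenBy f F) : IsGivenBy (distFourierInv f) (invF F) := fun ψ => by
  refine ⟨integrable_schwartz_mul_invF hF ψ, ?_⟩
  change f (schwartzFourierInv n ψ) = _
  rw [(h _).2]
  simpa only [mul_comm] using integral_mul_schwartzFourierInv hF ψ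

/-- Fourier inversion for tempered distributions with integrable Fourier transform. -/
theorem isGivenBy_invF_iff {f : 𝓢'(Eucl n, ℂ)} {F : Eucl n → ℂ} (hF : Integrable F) :
    IsGivenBy f (invF F) ↔ IsGivenBy (distFourier f) F := by
  constructor
  · intro h ψ
    refine ⟨integrable_schwartz_mul hF ψ, ?_⟩
    change f (schwartzFourier n ψ) = _
    rw [(h _).2]
    simpa only [mul_comm] using (integral_mul_eq_integral_invF_mul hF ψ).symm
  · intro h ψ
    refine ⟨integrable_schwartz_mul_invF hF ψ, ?_⟩
    have : f ψ = distFourier f (schwartzFourierInv n ψ) := by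
      change _ = f (schwartzFourier n (schwartzFourierInv n ψ))
      simp
    rw [this, (h _).2]
    simpa only [mul_comm] using integral_mul_schwartzFourierInv hF ψ

/-- Every integrable function is the Fourier transform of a tempered distribution. -/
theorem exists_distFourier_isGivenBy {F : Eucl n → ℂ} (hF : Integrable F) :
    ∃ f : 𝓢'(Eucl n, ℂ), IsGivenBy (distFourier f) F := by
  obtain ⟨T, hT⟩ := exists_isGivenBy_of_integrable hF
  exact ⟨distFourierInv T, by rwa [distFourier_distFourierInv]⟩

/-- The normalized convolution `(2π)^{-n} F ∗ G`, the Fourier transform of the pointwise product of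
the inverse Fourier transforms of `F` and `G`. -/
def nconv (F G : Eucl n → ℂ) (ξ : Eucl n) : ℂ := fourierConst n * ∫ η, F η * G (ξ - η)

theorem integrable_nconv {F G : Eucl n → ℂ} (hF : Integrable F) (hG : Integrable G) :
    Integrable (nconv F G) :=
  (hF.integrable_convolution (ContinuousLinearMap.mul ℂ ℂ) hG).const_mul _

theorem invF_nconv {F G : Eucl n → ℂ} (hF : Integrable F) (hG : Integrable G) (x : Eucl n) :
    invF (nconv F G) x = invF F x * invF G x := by
  unfold nconv
  rw [invF_const_mul, invF, Real.fourierInv_eq_fourier_neg]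
  have h := Real.fourier_mul_convolution_eq hF hG (-((2 * Real.pi)⁻¹ • x))
  have h' : 𝓕 (fun ξ => ∫ η, F η * G (ξ - η)) (-((2 * Real.pi)⁻¹ • x)) = _ := h
  rw [h', invF, invF, Real.fourierInv_eq_fourier_neg, Real.fourierInv_eq_fourier_neg]
  ring

theorem enorm_nconv_le (F G : Eucl n → ℂ) (ξ : Eucl n) :
    ‖nconv F G ξ‖ₑ ≤ ∫⁻ η, ‖F η‖ₑ * ‖G (ξ - η)‖ₑ := by
  rw [nconv, enorm_mul]
  calc _ ≤ 1 * ∫⁻ η, ‖F η‖ₑ * ‖G (ξ - η)‖ₑ := by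
        refine mul_le_mul' enorm_fourierConst_le ?_
        refine (enorm_integral_le_lintegral_enorm _).trans_eq ?_
        simp only [enorm_mul]
    _ = _ := one_mul _

theorem isGivenBy_freqPiece (φ : 𝓢(Eucl n, ℂ)) (k : Fin n → ℤ) {f : 𝓢'(Eucl n, ℂ)}
    {F : Eucl n → ℂ} (hF : Integrable F) (h : IsGivenBy (distFourier f) F) :
    IsGivenBy (freqPiece φ k f) (invF fun ξ => φ (ξ - latticePt k) * F ξ) := by
  have hφ : (fun ξ => φ (ξ - latticePt k)).HasTemperateGrowth :=
    (compSubConstCLM ℂ (latticePt k) φ).hasTemperateGrowth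
  refine isGivenBy_distFourierInv
    (integrable_schwartz_mul hF (compSubConstCLM ℂ (latticePt k) φ)) fun ψ => ?_
  have e : ∀ ξ, SchwartzMap.smulLeftCLM ℂ (fun ξ => φ (ξ - latticePt k)) ψ ξ * F ξ =
      ψ ξ * (φ (ξ - latticePt k) * F ξ) := fun ξ => by
    rw [SchwartzMap.smulLeftCLM_apply_apply hφ, smul_eq_mul]; ring
  have h1 := h (SchwartzMap.smulLeftCLM ℂ (fun ξ => φ (ξ - latticePt k)) ψ)
  simp only [e] at h1
  exact h1

/-! ### Almost orthogonality of translates of Schwartz functions -/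

/-- The Schwartz function `ξ ↦ A(ξ) B(ξ - ζ)`. -/
def shiftMul (A B : 𝓢(Eucl n, ℂ)) (ζ : Eucl n) : 𝓢(Eucl n, ℂ) :=
  SchwartzMap.pairing (ContinuousLinearMap.mul ℂ ℂ) A (compSubConstCLM ℂ ζ B)

@[simp] theorem shiftMul_apply (A B : 𝓢(Eucl n, ℂ)) (ζ ξ : Eucl n) :
    shiftMul A B ζ ξ = A ξ * B (ξ - ζ) := rfl

/-- The Schwartz seminorms of `A(·) B(· - ζ)` decay rapidly in `ζ`. -/
theorem exists_seminorm_shiftMul_le (A B : 𝓢(Eucl n, ℂ)) (a b N : ℕ) :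
    ∃ C : ℝ, 0 ≤ C ∧ ∀ ζ, (1 + ‖ζ‖) ^ N * SchwartzMap.seminorm ℂ a b (shiftMul A B ζ) ≤ C := by
  set PA : ℝ := 2 ^ (a + N) *
    (Finset.Iic (a + N, b)).sup (fun m => SchwartzMap.seminorm ℂ m.1 m.2) A with hPA
  set PB : ℝ := 2 ^ N * (Finset.Iic (N, b)).sup (fun m => SchwartzMap.seminorm ℂ m.1 m.2) B with hPB
  have hA0 : 0 ≤ PA := mul_nonneg (by positivity) (apply_nonneg _ _)
  have hB0 : 0 ≤ PB := mul_nonneg (by positivity) (apply_nonneg _ _)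
  set C : ℝ := ∑ i ∈ Finset.range (b + 1), (b.choose i : ℝ) * (PA * PB)
  have hC : 0 ≤ C := Finset.sum_nonneg fun i _ => by positivity
  refine ⟨C, hC, fun ζ => ?_⟩
  have hpos : 0 < (1 + ‖ζ‖) ^ N := by positivity
  rw [← le_div_iff₀' hpos]
  refine SchwartzMap.seminorm_le_bound ℂ a b _ (by positivity) fun ξ => ?_
  rw [le_div_iff₀' hpos]
  have hB : ContDiff ℝ (⊤ : ℕ∞) fun ξ => B (ξ - ζ) := (compSubConstCLM ℂ ζ B).smooth _
  have hD := norm_iteratedFDeriv_mul_le (A.smooth ⊤) hB ξ (n := b) (mod_cast le_top)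
  have hζ : (1 + ‖ζ‖) ^ N ≤ (1 + ‖ξ‖) ^ N * (1 + ‖ξ - ζ‖) ^ N := by
    rw [← mul_pow]
    gcongr
    have : ‖ζ‖ ≤ ‖ξ‖ + ‖ξ - ζ‖ := by
      rw [norm_sub_rev]; simpa using norm_add_le ξ (ζ - ξ)
    nlinarith [norm_nonneg ξ, norm_nonneg (ξ - ζ)]
  calc (1 + ‖ζ‖) ^ N * (‖ξ‖ ^ a * ‖iteratedFDeriv ℝ b (shiftMul A B ζ) ξ‖)
      ≤ (1 + ‖ζ‖) ^ N * (‖ξ‖ ^ a * ∑ i ∈ Finset.range (b + 1), (b.choose i : ℝ) *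
          ‖iteratedFDeriv ℝ i A ξ‖ * ‖iteratedFDeriv ℝ (b - i) (fun ξ => B (ξ - ζ)) ξ‖) := by
        gcongr
        exact hD
    _ = ∑ i ∈ Finset.range (b + 1), (b.choose i : ℝ) * ((1 + ‖ζ‖) ^ N * ‖ξ‖ ^ a *
          (‖iteratedFDeriv ℝ i A ξ‖ * ‖iteratedFDeriv ℝ (b - i) B (ξ - ζ)‖)) := by
        rw [Finset.mul_sum, Finset.mul_sum]
        refine Finset.sum_congr rfl fun i _ => ?_
        rw [iteratedFDeriv_comp_sub]
        ring
    _ ≤ C := by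
        refine Finset.sum_le_sum fun i hi => mul_le_mul_of_nonneg_left ?_ (Nat.cast_nonneg _)
        have hi' : i ≤ b := by simpa [Nat.lt_succ_iff] using hi
        have h1 : (1 + ‖ξ‖) ^ (a + N) * ‖iteratedFDeriv ℝ i A ξ‖ ≤ PA :=
          SchwartzMap.one_add_le_sup_seminorm_apply (𝕜 := ℂ) (m := (a + N, b)) le_rfl hi' A ξ
        have h2 : (1 + ‖ξ - ζ‖) ^ N * ‖iteratedFDeriv ℝ (b - i) B (ξ - ζ)‖ ≤ PB :=
          SchwartzMap.one_add_le_sup_seminorm_apply (𝕜 := ℂ) (m := (N, b)) le_rfl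
            (Nat.sub_le b i) B (ξ - ζ)
        have h3 : ‖ξ‖ ^ a ≤ (1 + ‖ξ‖) ^ a := by gcongr; linarith
        calc _ ≤ (1 + ‖ξ‖) ^ N * (1 + ‖ξ - ζ‖) ^ N * (1 + ‖ξ‖) ^ a *
              (‖iteratedFDeriv ℝ i A ξ‖ * ‖iteratedFDeriv ℝ (b - i) B (ξ - ζ)‖) :=
              mul_le_mul_of_nonneg_right (mul_le_mul hζ h3 (by positivity) (by positivity))
                (by positivity)
          _ = ((1 + ‖ξ‖) ^ (a + N) * ‖iteratedFDeriv ℝ i A ξ‖) *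
              ((1 + ‖ξ - ζ‖) ^ N * ‖iteratedFDeriv ℝ (b - i) B (ξ - ζ)‖) := by
              rw [pow_add]; ring
          _ ≤ PA * PB := mul_le_mul h1 h2 (by positivity) hA0

/-- Every continuous seminorm of `A(·) B(· - ζ)` decays rapidly in `ζ`. -/
theorem exists_ofReal_seminorm_shiftMul_le (A B : 𝓢(Eucl n, ℂ)) {r : Seminorm ℂ 𝓢(Eucl n, ℂ)}
    (hr : Continuous r) (t : ℝ) :
    ∃ C : ℝ≥0∞, C ≠ ∞ ∧ ∀ ζ, ENNReal.ofReal (r (shiftMul A B ζ)) ≤ C * weight (-t) ζ := by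
  obtain ⟨N, hN⟩ := exists_nat_ge t
  obtain ⟨S, C₀, -, hS⟩ := Seminorm.bound_of_continuous (schwartz_withSeminorms ℂ (Eucl n) ℂ) r hr
  choose C hC0 hC using fun m : ℕ × ℕ => exists_seminorm_shiftMul_le A B m.1 m.2 N
  have hCS : 0 ≤ ∑ m ∈ S, C m := Finset.sum_nonneg fun m _ => hC0 m
  refine ⟨ENNReal.ofReal (C₀ * ∑ m ∈ S, C m), ENNReal.ofReal_ne_top, fun ζ => ?_⟩
  have hb := bracket_pos ζ
  rw [weight, ← ENNReal.ofReal_mul (by positivity)]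
  refine ENNReal.ofReal_le_ofReal ?_
  have hpos : 0 < (1 + ‖ζ‖) ^ N := by positivity
  have h1 : r (shiftMul A B ζ) ≤
      C₀ * ∑ m ∈ S, schwartzSeminormFamily ℂ (Eucl n) ℂ m (shiftMul A B ζ) := by
    refine (hS _).trans ?_
    rw [smul_apply, NNReal.smul_def, smul_eq_mul]
    gcongr
    refine Seminorm.finset_sup_apply_le (p := schwartzSeminormFamily ℂ (Eucl n) ℂ)
      (Finset.sum_nonneg fun m _ => apply_nonneg _ _) fun m hm => ?_
    exact Finset.single_le_sum
      (f := fun m => schwartzSeminormFamily ℂ (Eucl n) ℂ m (shiftMul A B ζ))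
      (fun m _ => apply_nonneg _ _) hm
  have h2 : r (shiftMul A B ζ) ≤ C₀ * ∑ m ∈ S, C m / (1 + ‖ζ‖) ^ N := by
    refine h1.trans ?_
    gcongr with m
    rw [le_div_iff₀' hpos]
    exact hC m ζ
  rw [← Finset.sum_div, ← mul_div_assoc, div_eq_mul_inv] at h2
  refine h2.trans ?_
  gcongr
  rw [Real.rpow_neg hb.le]
  gcongr
  calc bracket ζ ^ t ≤ bracket ζ ^ (N : ℝ) :=
        Real.rpow_le_rpow_of_exponent_le (one_le_bracket ζ) hN
    _ = bracket ζ ^ N := Real.rpow_natCast _ _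
    _ ≤ _ := by gcongr; exact bracket_le_one_add_norm ζ

theorem continuous_sup_seminorm_comp (S : Finset (ℕ × ℕ))
    (L : 𝓢(Eucl n, ℂ) →L[ℂ] 𝓢(Eucl n, ℂ)) :
    Continuous ((S.sup (schwartzSeminormFamily ℂ (Eucl n) ℂ)).comp L.toLinearMap) := by
  have h := (schwartz_withSeminorms ℂ (Eucl n) ℂ).finset_sups.continuous_seminorm S
  exact h.comp L.continuous

/-- Pointwise decay of the inverse Fourier transform of `A(· - a) B(· - b)`, both in space and in
`b - a`. -/
theorem exists_enorm_invF_shiftMul_le (A B : 𝓢(Eucl n, ℂ)) (t r : ℝ) :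
    ∃ C : ℝ≥0∞, C ≠ ∞ ∧ ∀ a b x, ‖invF (fun ξ => A (ξ - a) * B (ξ - b)) x‖ₑ ≤
      C * weight (-t) (a - b) * weight (-r) x := by
  obtain ⟨m, hm⟩ := exists_nat_ge r
  obtain ⟨C, hC, h⟩ := exists_ofReal_seminorm_shiftMul_le A B
    (continuous_sup_seminorm_comp (Finset.Iic (m, 0)) (schwartzFourierInv n)) t
  refine ⟨2 ^ m * C, by finiteness, fun a b x => ?_⟩
  have e : (fun ξ => A (ξ - a) * B (ξ - b)) = fun ξ => shiftMul A B (b - a) (ξ - a) := by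
    ext ξ; simp
  have h1 := SchwartzMap.one_add_le_sup_seminorm_apply (𝕜 := ℂ) (m := (m, 0)) le_rfl le_rfl
    (schwartzFourierInv n (shiftMul A B (b - a))) x
  rw [norm_iteratedFDeriv_zero] at h1
  have hb := bracket_pos x
  have hw : 1 ≤ weight (-r) x * ENNReal.ofReal ((1 + ‖x‖) ^ m) := by
    calc (1 : ℝ≥0∞) = weight (-r) x * weight r x := by
          rw [← weight_add, neg_add_cancel, weight_zero]
      _ ≤ _ := by
        gcongr
        refine ENNReal.ofReal_le_ofReal ?_
        calc bracket x ^ r ≤ bracket x ^ (m : ℝ) :=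
              Real.rpow_le_rpow_of_exponent_le (one_le_bracket x) hm
          _ = bracket x ^ m := Real.rpow_natCast _ _
          _ ≤ _ := by gcongr; exact bracket_le_one_add_norm x
  have h2 := ENNReal.ofReal_le_ofReal h1
  rw [ENNReal.ofReal_mul (by positivity), ofReal_norm,
    ENNReal.ofReal_mul (by positivity)] at h2
  rw [e, ← ofReal_norm, norm_invF_comp_sub, ofReal_norm, invF_schwartz]
  calc ‖schwartzFourierInv n (shiftMul A B (b - a)) x‖ₑ
      ≤ (weight (-r) x * ENNReal.ofReal ((1 + ‖x‖) ^ m)) *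
          ‖schwartzFourierInv n (shiftMul A B (b - a)) x‖ₑ := le_mul_of_one_le_left' hw
    _ ≤ weight (-r) x * (ENNReal.ofReal (2 ^ m) * (C * weight (-t) (b - a))) := by
        rw [mul_assoc]
        exact mul_le_mul_right (h2.trans (mul_le_mul_right (h (b - a)) _)) _
    _ = _ := by
        rw [← weight_neg (-t) (b - a), neg_sub]
        simp only [ENNReal.ofReal_pow zero_le_two, ENNReal.ofReal_ofNat]
        ring

/-- The `L^r` norm of the Fourier transform of `A(· - a) B(· - b)` decays rapidly in `b - a`. -/
theorem exists_eLpNorm_schwartzFourier_le (A B : 𝓢(Eucl n, ℂ)) (t : ℝ) (r : ℝ≥0∞) :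
    ∃ C : ℝ≥0∞, C ≠ ∞ ∧ ∀ a b, eLpNorm (schwartzFourier n (shiftMul (compSubConstCLM ℂ a A) B b))
      r volume ≤ C * weight (-t) (a - b) := by
  obtain ⟨k, C₁, h₁⟩ := SchwartzMap.eLpNorm_le_seminorm ℂ ℂ (E := Eucl n) r volume
  obtain ⟨C, hC, h⟩ := exists_ofReal_seminorm_shiftMul_le A B
    (continuous_sup_seminorm_comp (Finset.Iic (k, 0)) (schwartzFourier n)) t
  refine ⟨C₁ * C, by finiteness, fun a b => ?_⟩
  have e : eLpNorm (schwartzFourier n (shiftMul (compSubConstCLM ℂ a A) B b)) r volume =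
      eLpNorm (schwartzFourier n (shiftMul A B (b - a))) r volume := by
    refine eLpNorm_congr_norm_ae (ae_of_all _ fun ξ => ?_)
    have h := congrFun (VectorFourier.fourierIntegral_comp_add_right Real.fourierChar
      (volume : Measure (Eucl n)) (innerₗ (Eucl n)) (shiftMul A B (b - a)) (-a))
      ((2 * Real.pi)⁻¹ • ξ)
    have e' : (fun η => shiftMul A B (b - a) (η + -a)) = shiftMul (compSubConstCLM ℂ a A) B b := by
      ext η; simp [← sub_eq_add_neg]
    have h' : 𝓕 (shiftMul (compSubConstCLM ℂ a A) B b : Eucl n → ℂ) ((2 * Real.pi)⁻¹ • ξ) =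
        Real.fourierChar (innerₗ (Eucl n) (-a) ((2 * Real.pi)⁻¹ • ξ)) •
          𝓕 (shiftMul A B (b - a) : Eucl n → ℂ) ((2 * Real.pi)⁻¹ • ξ) := by
      rw [← e']
      exact h
    rw [schwartzFourier_apply, h', Circle.norm_smul, schwartzFourier_apply]
  rw [e]
  refine (h₁ _).trans ?_
  rw [mul_assoc]
  gcongr
  rw [← weight_neg, neg_sub]
  exact h (b - a)

/-! ### Band-limited `L^p` functions, `p ≤ 2`, have integrable Fourier transforms -/

/-- Interpolation: a bound in `L^2` and in `L^∞` is a bound in `L^r` for `2 ≤ r ≤ ∞`. -/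
theorem eLpNorm_le_of_two_of_top {α E : Type*} [MeasurableSpace α] [NormedAddCommGroup E]
    (μ : Measure α) {f : α → E} {r A : ℝ≥0∞} (hr : 2 ≤ r) (h2 : eLpNorm f 2 μ ≤ A)
    (ht : ∀ x, ‖f x‖ₑ ≤ A) : eLpNorm f r μ ≤ A := by
  rcases eq_or_ne r ∞ with rfl | hr'
  · rw [eLpNorm_exponent_top]
    exact essSup_le_of_ae_le _ (ae_of_all _ ht)
  have hr2 : 2 ≤ r.toReal := by
    rwa [← ENNReal.toReal_ofNat, ENNReal.toReal_le_toReal (by simp) hr']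
  have hr0 : r ≠ 0 := by rintro rfl; simp at hr
  rw [eLpNorm_eq_lintegral_rpow_enorm_toReal hr0 hr', one_div,
    ENNReal.rpow_inv_le_iff (by linarith)]
  rw [eLpNorm_eq_lintegral_rpow_enorm_toReal two_ne_zero ENNReal.ofNat_ne_top, one_div,
    ENNReal.rpow_inv_le_iff (by simp)] at h2
  set s := r.toReal
  rcases eq_or_ne A ∞ with rfl | hA
  · simp [ENNReal.top_rpow_of_pos (show 0 < s by linarith)]
  have hsplit : ∀ B : ℝ≥0∞, B ^ s = B ^ (s - 2) * B ^ (ENNReal.toReal 2) := by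
    intro B
    rw [← ENNReal.rpow_add_of_nonneg _ _ (by linarith) (by simp)]
    simp
  calc ∫⁻ x, ‖f x‖ₑ ^ s ∂μ ≤ ∫⁻ x, A ^ (s - 2) * ‖f x‖ₑ ^ (ENNReal.toReal 2) ∂μ := by
        refine lintegral_mono fun x => ?_
        rw [hsplit]
        exact mul_le_mul_left (ENNReal.rpow_le_rpow (ht x) (by linarith)) _
    _ = A ^ (s - 2) * ∫⁻ x, ‖f x‖ₑ ^ (ENNReal.toReal 2) ∂μ :=
        lintegral_const_mul' _ _ (ENNReal.rpow_ne_top_of_nonneg (by linarith) hA)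
    _ ≤ _ := by
        rw [hsplit]
        gcongr

theorem lintegral_enorm_mul_le_two {f g : Eucl n → ℂ} (hf : AEStronglyMeasurable f)
    (hg : AEStronglyMeasurable g) :
    ∫⁻ x, ‖f x * g x‖ₑ ≤ eLpNorm f 2 volume * eLpNorm g 2 volume := by
  have := eLpNorm_smul_le_mul_eLpNorm (p := 2) (q := 2) (r := 1) hg hf
  rwa [eLpNorm_one_eq_lintegral_enorm] at this

/-- Hölder's inequality for a pairing. -/
theorem enorm_integral_mul_le {f g : Eucl n → ℂ} {p : ℝ≥0∞} (hp : 1 ≤ p)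
    (hf : AEStronglyMeasurable f) (hg : AEStronglyMeasurable g) :
    ‖∫ x, f x * g x‖ₑ ≤ eLpNorm f p.conjExponent volume * eLpNorm g p volume := by
  have : ENNReal.HolderConjugate p p.conjExponent := ENNReal.HolderConjugate.conjExponent hp
  have h := eLpNorm_smul_le_mul_eLpNorm (p := p.conjExponent) (q := p) (r := 1) hg hf
  rw [eLpNorm_one_eq_lintegral_enorm] at h
  exact (enorm_integral_le_lintegral_enorm _).trans h

theorem two_le_conjExponent {p : ℝ≥0∞} (hp : 1 ≤ p) (hp2 : p ≤ 2) : 2 ≤ p.conjExponent := by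
  have : ENNReal.HolderConjugate p p.conjExponent := ENNReal.HolderConjugate.conjExponent hp
  have h := this.inv_add_inv_eq_one
  by_contra hc
  push Not at hc
  have h1 : (2 : ℝ≥0∞)⁻¹ ≤ p⁻¹ := ENNReal.inv_le_inv.2 hp2
  have h2 : (2 : ℝ≥0∞)⁻¹ < p.conjExponent⁻¹ := ENNReal.inv_lt_inv.2 hc
  have h3 := ENNReal.add_lt_add_of_le_of_lt (by simp) h1 h2
  rw [h, ENNReal.inv_two_add_inv_two] at h3
  exact lt_irrefl _ h3

theorem eLpNorm_two_eq_ofReal_sqrt (ψ : 𝓢(Eucl n, ℂ)) :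
    eLpNorm ψ 2 volume = ENNReal.ofReal (Real.sqrt (∫ x, ‖ψ x‖ ^ 2)) := by
  rw [(ψ.memLp 2 volume).eLpNorm_eq_integral_rpow_norm two_ne_zero ENNReal.ofNat_ne_top]
  simp [Real.sqrt_eq_rpow]

/-- Plancherel's theorem. The sharp constant would be `(2π)^{n/2}`. -/
theorem eLpNorm_two_schwartzFourier_le (ψ : 𝓢(Eucl n, ℂ)) :
    eLpNorm (schwartzFourier n ψ) 2 volume ≤
      ENNReal.ofReal ((2 * Real.pi) ^ n) * eLpNorm ψ 2 volume := by
  rw [eLpNorm_two_eq_ofReal_sqrt, eLpNorm_two_eq_ofReal_sqrt,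
    ← ENNReal.ofReal_mul (by positivity)]
  refine ENNReal.ofReal_le_ofReal ?_
  have h := Measure.integral_comp_smul (volume : Measure (Eucl n))
    (fun ξ => ‖𝓕 (ψ : Eucl n → ℂ) ξ‖ ^ 2) (2 * Real.pi)⁻¹
  have hP : ∫ ξ, ‖𝓕 (ψ : Eucl n → ℂ) ξ‖ ^ 2 = ∫ x, ‖ψ x‖ ^ 2 :=
    SchwartzMap.integral_norm_sq_fourier ψ
  rw [finrank_euclideanSpace_fin, abs_of_pos (by positivity), inv_pow, inv_inv, hP,
    smul_eq_mul] at h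
  have h1 : (1 : ℝ) ≤ (2 * Real.pi) ^ n := one_le_pow₀ (by linarith [Real.pi_gt_three])
  simp only [schwartzFourier_apply]
  rw [h, Real.sqrt_mul (by positivity)]
  gcongr
  rw [Real.sqrt_le_left (by positivity)]
  nlinarith

theorem enorm_schwartzFourier_le (ψ : 𝓢(Eucl n, ℂ)) (ξ : Eucl n) :
    ‖schwartzFourier n ψ ξ‖ₑ ≤ ∫⁻ x, ‖ψ x‖ₑ := by
  rw [schwartzFourier_apply, Real.fourier_eq]
  refine (enorm_integral_le_lintegral_enorm _).trans_eq (lintegral_congr fun ξ => ?_)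
  rw [← ofReal_norm, Circle.norm_smul, ofReal_norm]

theorem eLpNorm_comp_sub (θ : 𝓢(Eucl n, ℂ)) (a : Eucl n) (p : ℝ≥0∞) :
    eLpNorm (fun ξ => θ (ξ - a)) p volume = eLpNorm θ p volume :=
  eLpNorm_comp_measurePreserving (g := θ) θ.continuous.aestronglyMeasurable
    (measurePreserving_sub_right volume a)

/-- For `2 ≤ r ≤ ∞` the `L^r` norm of the Fourier transform of `ψ(·) θ(· - a)` is controlled by the
`L^2` norm of `ψ`, uniformly in `a`. -/
theorem exists_eLpNorm_schwartzFourier_shiftMul_le (θ : 𝓢(Eucl n, ℂ)) {r : ℝ≥0∞} (hr : 2 ≤ r) :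
    ∃ C : ℝ≥0∞, C ≠ ∞ ∧ ∀ (a : Eucl n) (ψ : 𝓢(Eucl n, ℂ)),
      eLpNorm (schwartzFourier n (shiftMul ψ θ a)) r volume ≤ C * eLpNorm ψ 2 volume := by
  set S := ENNReal.ofReal (SchwartzMap.seminorm ℝ 0 0 θ) with hS
  refine ⟨eLpNorm θ 2 volume + ENNReal.ofReal ((2 * Real.pi) ^ n) * S,
    by have := (θ.eLpNorm_lt_top 2 volume).ne; finiteness, fun a ψ => ?_⟩
  refine eLpNorm_le_of_two_of_top volume hr ?_ fun ξ => ?_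
  · refine (eLpNorm_two_schwartzFourier_le _).trans ?_
    rw [add_mul, mul_assoc]
    refine le_add_left (mul_le_mul_right ?_ _)
    refine eLpNorm_le_mul_eLpNorm_of_ae_le_mul'' 2 ψ.continuous.aestronglyMeasurable
      (ae_of_all _ fun ξ => ?_)
    rw [shiftMul_apply, enorm_mul, mul_comm]
    gcongr
    rw [← ofReal_norm]
    exact ENNReal.ofReal_le_ofReal (SchwartzMap.norm_le_seminorm ℝ θ _)
  · refine (enorm_schwartzFourier_le _ ξ).trans ?_
    rw [add_mul]
    refine le_add_right ?_
    rw [mul_comm, ← eLpNorm_comp_sub θ a 2]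
    exact lintegral_enorm_mul_le_two ψ.continuous.aestronglyMeasurable
      (compSubConstCLM ℂ a θ).continuous.aestronglyMeasurable

/-- If the inverse Fourier transform of `T` is in `L^p`, `1 ≤ p ≤ 2`, and `T` is localized by a
translate of the Schwartz function `θ`, in the sense that `θ(· - a) T = T`, then `T` is an
integrable function, with a bound uniform over the translates. The functional `T` is bounded in the
`L^2` norm by the Hausdorff-Young type bound above, hence given by an `L^2` function. -/
theorem exists_integrable_of_eLpNorm_fourierInv (θ : 𝓢(Eucl n, ℂ)) {p : ℝ≥0∞} (hp : 1 ≤ p)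
    (hp2 : p ≤ 2) :
    ∃ C : ℝ≥0∞, C ≠ ∞ ∧ ∀ (a : Eucl n) (T : 𝓢'(Eucl n, ℂ)) (u : Eucl n → ℂ),
      IsGivenBy (distFourierInv T) u → eLpNorm u p volume < ∞ →
      (∀ ψ : 𝓢(Eucl n, ℂ), T (shiftMul ψ θ a) = T ψ) →
      ∃ G : Eucl n → ℂ, Integrable G ∧ IsGivenBy T G ∧
        ∫⁻ ξ, ‖G ξ‖ₑ ≤ C * eLpNorm u p volume := by
  obtain ⟨C, hC, hCle⟩ := exists_eLpNorm_schwartzFourier_shiftMul_le θ (two_le_conjExponent hp hp2)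
  have hθ2 := (θ.eLpNorm_lt_top 2 volume).ne
  refine ⟨C * eLpNorm θ 2 volume, by finiteness, fun a T u hu hup hT => ?_⟩
  set M : ℝ := (C * eLpNorm u p volume).toReal with hM
  have hMtop : C * eLpNorm u p volume ≠ ∞ := by finiteness
  have hbound : ∀ ψ : 𝓢(Eucl n, ℂ), ‖T ψ‖ ≤ M * ‖ψ.toLp 2 volume‖ := by
    intro ψ
    have h1 : T ψ = ∫ ξ, schwartzFourier n (shiftMul ψ θ a) ξ * u ξ := by
      rw [← hT, ← (hu _).2]
      change _ = T (schwartzFourierInv n (schwartzFourier n (shiftMul ψ θ a)))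
      simp
    have h2 := enorm_integral_mul_le hp
      (schwartzFourier n (shiftMul ψ θ a)).continuous.aestronglyMeasurable hu.aestronglyMeasurable
    rw [← h1] at h2
    have h3 : ‖T ψ‖ₑ ≤ C * eLpNorm u p volume * eLpNorm ψ 2 volume :=
      h2.trans ((mul_le_mul_left (hCle a ψ) _).trans_eq (by ring))
    have h4 := ENNReal.toReal_mono (by have := (ψ.eLpNorm_lt_top 2 volume).ne; finiteness) h3
    rwa [toReal_enorm, ENNReal.toReal_mul, ← SchwartzMap.norm_toLp] at h4
  have hM0 : 0 ≤ M := ENNReal.toReal_nonneg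
  have hdense : DenseRange ((SchwartzMap.toLpCLM ℂ ℂ 2 volume).toLinearMap :
      𝓢(Eucl n, ℂ) →ₗ[ℂ] Lp ℂ 2 (volume : Measure (Eucl n))) :=
    SchwartzMap.denseRange_toLpCLM (p := 2) ENNReal.ofNat_ne_top
  set L := LinearMap.extendOfNorm T.toLinearMap (SchwartzMap.toLpCLM ℂ ℂ 2 volume).toLinearMap
  have hL : ∀ ψ : 𝓢(Eucl n, ℂ), L (ψ.toLp 2 volume) = T ψ :=
    LinearMap.extendOfNorm_eq hdense ⟨M, hbound⟩
  have hLM : ‖L‖ ≤ M := ContinuousLinearMap.opNorm_le_bound _ hM0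
    (LinearMap.norm_extendOfNorm_apply_le hdense M hbound)
  set v : Lp ℂ 2 (volume : Measure (Eucl n)) := (InnerProductSpace.toDual ℂ _).symm L with hv
  have hvM : eLpNorm v 2 volume ≤ C * eLpNorm u p volume := by
    have : ‖v‖ ≤ M := by rwa [hv, LinearIsometryEquiv.norm_map]
    rw [Lp.norm_def] at this
    exact (ENNReal.toReal_le_toReal (Lp.eLpNorm_ne_top v) hMtop).1 this
  have hTv : ∀ ψ : 𝓢(Eucl n, ℂ), T ψ = ∫ ξ, ψ ξ * starRingEnd ℂ (v ξ) := by
    intro ψ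
    rw [← hL, ← InnerProductSpace.toDual_symm_apply (𝕜 := ℂ), L2.inner_def]
    refine integral_congr_ae ?_
    filter_upwards [ψ.coeFn_toLp 2 volume] with ξ hξ
    rw [hξ, RCLike.inner_apply]
  have hvm : AEStronglyMeasurable (fun ξ => starRingEnd ℂ (v ξ)) :=
    Complex.continuous_conj.comp_aestronglyMeasurable (Lp.aestronglyMeasurable v)
  have hθm : AEStronglyMeasurable (fun ξ => θ (ξ - a)) :=
    (compSubConstCLM ℂ a θ).continuous.aestronglyMeasurable
  have hle : ∫⁻ ξ, ‖θ (ξ - a) * starRingEnd ℂ (v ξ)‖ₑ ≤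
      C * eLpNorm θ 2 volume * eLpNorm u p volume := by
    refine (lintegral_enorm_mul_le_two hθm hvm).trans ?_
    have e : eLpNorm (fun ξ => starRingEnd ℂ (v ξ)) 2 volume = eLpNorm v 2 volume :=
      eLpNorm_congr_norm_ae (ae_of_all _ fun ξ => by simp)
    rw [eLpNorm_comp_sub, e]
    exact (mul_le_mul_right hvM _).trans_eq (by ring)
  have hint : Integrable fun ξ => θ (ξ - a) * starRingEnd ℂ (v ξ) :=
    ⟨hθm.mul hvm, hle.trans_lt (by finiteness)⟩
  refine ⟨_, hint, fun ψ => ⟨integrable_schwartz_mul hint ψ, ?_⟩, hle⟩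
  rw [← hT, hTv]
  simp only [shiftMul_apply, mul_assoc]

/-! ### Spectral synthesis in algebras of distributions with integrable Fourier transform -/

theorem ennreal_mul_lt_of_lt_div {C ε a : ℝ≥0∞} (hC : C ≠ ∞) (h : a < ε / (C + 1)) :
    C * a < ε := by
  rw [ENNReal.lt_div_iff_mul_lt (.inl (by simp)) (.inl (by finiteness)), mul_comm] at h
  exact lt_of_le_of_lt (by gcongr; exact le_self_add) h

/-- `f` has the integrable Fourier transform `F`. -/
def HasFourier (f : 𝓢'(Eucl n, ℂ)) (F : Eucl n → ℂ) : Prop :=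
  Integrable F ∧ IsGivenBy (distFourier f) F

theorem HasFourier.isGivenBy {f : 𝓢'(Eucl n, ℂ)} {F : Eucl n → ℂ} (h : HasFourier f F) :
    IsGivenBy f (invF F) := (isGivenBy_invF_iff h.1).2 h.2

theorem HasFourier.continuous {f : 𝓢'(Eucl n, ℂ)} {F : Eucl n → ℂ} (h : HasFourier f F) :
    Continuous (invF F) := continuous_invF h.1

theorem HasFourier.eq_invF {f : 𝓢'(Eucl n, ℂ)} {F u : Eucl n → ℂ} (h : HasFourier f F)
    (hu : IsGivenBy f u) (cu : Continuous u) : u = invF F :=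
  hu.eq_of_continuous h.isGivenBy cu h.continuous

theorem HasFourier.vanishesOn_iff {f : 𝓢'(Eucl n, ℂ)} {F : Eucl n → ℂ} (h : HasFourier f F)
    {A : Set (Eucl n)} : VanishesOn f A ↔ ∀ x ∈ A, invF F x = 0 := by
  constructor
  · rintro ⟨u, cu, hu, h0⟩
    rwa [← h.eq_invF hu cu]
  · exact fun h0 => ⟨_, h.continuous, h.isGivenBy, h0⟩

theorem HasFourier.add {f g : 𝓢'(Eucl n, ℂ)} {F G : Eucl n → ℂ} (hf : HasFourier f F)
    (hg : HasFourier g G) : HasFourier (f + g) (fun ξ => F ξ + G ξ) :=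
  ⟨hf.1.add hg.1, by
    have : distFourier (f + g) = distFourier f + distFourier g := map_add _ f g
    rw [this]; exact hf.2.add hg.2⟩

theorem HasFourier.const_smul {f : 𝓢'(Eucl n, ℂ)} {F : Eucl n → ℂ} (hf : HasFourier f F) (c : ℂ) :
    HasFourier (c • f) (fun ξ => c * F ξ) :=
  ⟨hf.1.const_mul c, by
    have : distFourier (c • f) = c • distFourier f := map_smul _ c f
    rw [this]; exact hf.2.const_smul c⟩

theorem HasFourier.sub {f g : 𝓢'(Eucl n, ℂ)} {F G : Eucl n → ℂ} (hf : HasFourier f F)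
    (hg : HasFourier g G) : HasFourier (f - g) (fun ξ => F ξ - G ξ) :=
  ⟨hf.1.sub hg.1, by
    have : distFourier (f - g) = distFourier f - distFourier g := map_sub _ f g
    rw [this]; exact hf.2.sub hg.2⟩

theorem HasFourier.invF_sub {f g : 𝓢'(Eucl n, ℂ)} {F G : Eucl n → ℂ} (hf : HasFourier f F)
    (hg : HasFourier g G) (x : Eucl n) :
    invF (fun ξ => F ξ - G ξ) x = invF F x - invF G x := by
  have h := (hf.isGivenBy.sub hg.isGivenBy).eq_of_continuous (hf.sub hg).isGivenBy
    (hf.continuous.sub hg.continuous) (hf.sub hg).continuous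
  exact (congrFun h x).symm

/-- Products exist, the Fourier transform turning them into convolutions. -/
theorem HasFourier.exists_mul {f g : 𝓢'(Eucl n, ℂ)} {F G : Eucl n → ℂ} (hf : HasFourier f F)
    (hg : HasFourier g G) :
    ∃ h : 𝓢'(Eucl n, ℂ), HasFourier h (nconv F G) ∧ IsPointwiseProduct f g h := by
  obtain ⟨h, hh⟩ := exists_distFourier_isGivenBy (integrable_nconv hf.1 hg.1)
  have hH : HasFourier h (nconv F G) := ⟨integrable_nconv hf.1 hg.1, hh⟩
  refine ⟨h, hH, _, _, hf.continuous, hg.continuous, hf.isGivenBy, hg.isGivenBy, ?_⟩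
  simp only [← invF_nconv hf.1 hg.1]
  exact hH.isGivenBy

theorem hasFourier_zero : HasFourier (0 : 𝓢'(Eucl n, ℂ)) (fun _ => 0) := by
  refine ⟨integrable_zero _ _ _, ?_⟩
  have : distFourier (0 : 𝓢'(Eucl n, ℂ)) = 0 := map_zero _
  rw [this]; exact isGivenBy_zero

/-- The space of the norm `N` is an algebra of functions with integrable Fourier transform, on which
`N` is given by a seminorm `NF` of the Fourier transform. This seminorm dominates the `L^1` norm and
is submultiplicative for the convolution, both up to constants. Completeness is not required. -/
structure IsFourierAlgebraNorm (N : 𝓢'(Eucl n, ℂ) → ℝ≥0∞) (NF : (Eucl n → ℂ) → ℝ≥0∞) :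
    Prop where
  exists_hasFourier : ∀ f, N f < ∞ → ∃ F, HasFourier f F
  eq : ∀ {f F}, HasFourier f F → N f = NF F
  add_le : ∀ F G, Integrable F → Integrable G → NF (fun ξ => F ξ + G ξ) ≤ NF F + NF G
  const_mul_le : ∀ (c : ℂ) F, Integrable F → NF (fun ξ => c * F ξ) ≤ ‖c‖ₑ * NF F
  lintegral_le : ∃ C : ℝ≥0∞, C ≠ ∞ ∧ ∀ F, Integrable F → ∫⁻ ξ, ‖F ξ‖ₑ ≤ C * NF F
  nconv_le : ∃ C : ℝ≥0∞, C ≠ ∞ ∧ ∀ F G, Integrable F → Integrable G →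
    NF (nconv F G) ≤ C * NF F * NF G

namespace IsFourierAlgebraNorm

variable {N : 𝓢'(Eucl n, ℂ) → ℝ≥0∞} {NF : (Eucl n → ℂ) → ℝ≥0∞} (hN : IsFourierAlgebraNorm N NF)
include hN

theorem dist_zero : N 0 = 0 := by
  rw [hN.eq hasFourier_zero]
  have := hN.const_mul_le 0 (fun _ => 0) (integrable_zero _ _ _)
  simpa using this

theorem dist_add_le (f g : 𝓢'(Eucl n, ℂ)) : N (f + g) ≤ N f + N g := by
  by_cases h : N f + N g = ∞
  · rw [h]; exact le_top
  rw [ENNReal.add_eq_top, not_or] at h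
  obtain ⟨F, hF⟩ := hN.exists_hasFourier f (lt_top_iff_ne_top.2 h.1)
  obtain ⟨G, hG⟩ := hN.exists_hasFourier g (lt_top_iff_ne_top.2 h.2)
  rw [hN.eq hF, hN.eq hG, hN.eq (hF.add hG)]
  exact hN.add_le F G hF.1 hG.1

theorem dist_smul_le (c : ℂ) {f : 𝓢'(Eucl n, ℂ)} (h : N f < ∞) : N (c • f) ≤ ‖c‖ₑ * N f := by
  obtain ⟨F, hF⟩ := hN.exists_hasFourier f h
  rw [hN.eq hF, hN.eq (hF.const_smul c)]
  exact hN.const_mul_le c F hF.1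

theorem dist_sub_lt_top {f g : 𝓢'(Eucl n, ℂ)} (hf : N f < ∞) (hg : N g < ∞) : N (f - g) < ∞ := by
  rw [sub_eq_add_neg, ← neg_one_smul ℂ g]
  refine (hN.dist_add_le _ _).trans_lt (ENNReal.add_lt_top.2 ⟨hf, ?_⟩)
  exact (hN.dist_smul_le _ hg).trans_lt (ENNReal.mul_lt_top (by simp) hg)

/-- The closure of `J₀(E)` in the space of `N`, as a linear subspace. -/
def closureNear (E : Set (Eucl n)) : Submodule ℂ (𝓢'(Eucl n, ℂ)) where
  carrier := {f | f ∈ space N ∧ ∀ ε : ℝ≥0∞, 0 < ε → ∃ g ∈ vanishingNear N E, N (f - g) < ε}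
  zero_mem' := by
    have h0 : (0 : 𝓢'(Eucl n, ℂ)) ∈ space N := by simp [space, hN.dist_zero]
    exact ⟨h0, fun ε hε => ⟨0, ⟨h0, Set.univ, isOpen_univ, Set.subset_univ _, fun _ => 0,
      continuous_const, isGivenBy_zero, fun _ _ => rfl⟩, by simpa [hN.dist_zero] using hε⟩⟩
  add_mem' := by
    rintro f₁ f₂ ⟨h₁, a₁⟩ ⟨h₂, a₂⟩
    refine ⟨(hN.dist_add_le _ _).trans_lt (ENNReal.add_lt_top.2 ⟨h₁, h₂⟩), fun ε hε => ?_⟩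
    obtain ⟨g₁, ⟨s₁, U₁, o₁, e₁, u₁, c₁, i₁, z₁⟩, l₁⟩ := a₁ (ε / 2) (ENNReal.half_pos hε.ne')
    obtain ⟨g₂, ⟨s₂, U₂, o₂, e₂, u₂, c₂, i₂, z₂⟩, l₂⟩ := a₂ (ε / 2) (ENNReal.half_pos hε.ne')
    refine ⟨g₁ + g₂, ⟨(hN.dist_add_le _ _).trans_lt (ENNReal.add_lt_top.2 ⟨s₁, s₂⟩), U₁ ∩ U₂,
      o₁.inter o₂, Set.subset_inter e₁ e₂, _, c₁.add c₂, i₁.add i₂, fun x hx => ?_⟩, ?_⟩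
    · simp [z₁ x hx.1, z₂ x hx.2]
    · rw [add_sub_add_comm, ← ENNReal.add_halves ε]
      exact (hN.dist_add_le _ _).trans_lt (ENNReal.add_lt_add l₁ l₂)
  smul_mem' := by
    rintro c f ⟨h, a⟩
    refine ⟨(hN.dist_smul_le c h).trans_lt (ENNReal.mul_lt_top (by simp) h), fun ε hε => ?_⟩
    obtain ⟨g, ⟨s, U, o, e, u, cu, i, z⟩, l⟩ := a (ε / (‖c‖ₑ + 1))
      (ENNReal.div_pos hε.ne' (by finiteness))
    refine ⟨c • g, ⟨(hN.dist_smul_le c s).trans_lt (ENNReal.mul_lt_top (by simp) s), U, o, e, _,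
      continuous_const.mul cu, i.const_smul c, fun x hx => by simp [z x hx]⟩, ?_⟩
    rw [← smul_sub]
    exact (hN.dist_smul_le c (hN.dist_sub_lt_top h s)).trans_lt
      (ennreal_mul_lt_of_lt_div (by simp) l)

theorem isClosedIdeal_closureNear (E : Set (Eucl n)) : IsClosedIdeal N (hN.closureNear E) where
  subset_space := fun f hf => hf.1
  mul_mem := by
    rintro f hf g ⟨hg, ag⟩
    obtain ⟨F, hF⟩ := hN.exists_hasFourier f hf
    obtain ⟨G, hG⟩ := hN.exists_hasFourier g hg
    obtain ⟨h, hh, hprod⟩ := hF.exists_mul hG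
    obtain ⟨C, hC, hmul⟩ := hN.nconv_le
    have hNf : N f ≠ ∞ := ne_of_lt hf
    have bound : ∀ {g' : 𝓢'(Eucl n, ℂ)} {G' : Eucl n → ℂ} {h' : 𝓢'(Eucl n, ℂ)}, HasFourier g' G' →
        HasFourier h' (nconv F G') → N h' ≤ C * N f * N g' := fun hg' hh' => by
      rw [hN.eq hh', hN.eq hF, hN.eq hg']
      exact hmul _ _ hF.1 hg'.1
    refine ⟨h, ⟨(bound hG hh).trans_lt
      (ENNReal.mul_lt_top (ENNReal.mul_lt_top hC.lt_top hf) hg), fun ε hε => ?_⟩, hprod⟩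
    obtain ⟨g', ⟨s, U, o, e, hv⟩, l⟩ := ag (ε / (C * N f + 1))
      (ENNReal.div_pos hε.ne' (by finiteness))
    obtain ⟨G', hG'⟩ := hN.exists_hasFourier g' s
    rw [hG'.vanishesOn_iff] at hv
    obtain ⟨h', hh', -⟩ := hF.exists_mul hG'
    refine ⟨h', ⟨(bound hG' hh').trans_lt
      (ENNReal.mul_lt_top (ENNReal.mul_lt_top hC.lt_top hf) s), U, o, e,
      hh'.vanishesOn_iff.2 fun x hx => ?_⟩, ?_⟩
    · rw [invF_nconv hF.1 hG'.1, hv x hx, mul_zero]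
    have hsub : HasFourier (h - h') (nconv F fun ξ => G ξ - G' ξ) := by
      obtain ⟨d, hd, -⟩ := hF.exists_mul (hG.sub hG')
      have : h - h' = d := by
        refine (hh.isGivenBy.sub hh'.isGivenBy).unique ?_
        convert hd.isGivenBy using 1
        ext x
        rw [invF_nconv hF.1 hG.1, invF_nconv hF.1 hG'.1, invF_nconv hF.1 (hG.sub hG').1,
          hG.invF_sub hG', mul_sub]
      rwa [this]
    exact (bound (hG.sub hG') hsub).trans_lt (ennreal_mul_lt_of_lt_div (by finiteness) l)
  closed := by
    rintro f hf h
    refine ⟨hf, fun ε hε => ?_⟩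
    obtain ⟨g, ⟨hg, ag⟩, l₁⟩ := h (ε / 2) (ENNReal.half_pos hε.ne')
    obtain ⟨g', hg', l₂⟩ := ag (ε / 2) (ENNReal.half_pos hε.ne')
    refine ⟨g', hg', ?_⟩
    rw [← sub_add_sub_cancel f g g', ← ENNReal.add_halves ε]
    exact (hN.dist_add_le _ _).trans_lt (ENNReal.add_lt_add l₁ l₂)

/-- In an algebra of this kind, `J(E)` is the closure of `J₀(E)`. -/
theorem minimalIdeal_eq (E : Set (Eucl n)) : minimalIdeal N E = hN.closureNear E := by
  ext f
  constructor
  · rintro ⟨-, h⟩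
    refine h _ (hN.isClosedIdeal_closureNear E) fun g hg => ⟨hg.1, fun ε hε => ⟨g, hg, ?_⟩⟩
    rwa [sub_self, hN.dist_zero]
  · rintro ⟨hf, h⟩
    refine ⟨hf, fun I hI hJ => hI.closed f hf fun ε hε => ?_⟩
    obtain ⟨g, hg, l⟩ := h ε hε
    exact ⟨g, hJ hg, l⟩

theorem minimalIdeal_subset (E : Set (Eucl n)) : minimalIdeal N E ⊆ vanishingIdeal N E := by
  rw [hN.minimalIdeal_eq]
  rintro f ⟨hf, h⟩
  obtain ⟨F, hF⟩ := hN.exists_hasFourier f hf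
  refine ⟨hf, hF.vanishesOn_iff.2 fun x hx => ?_⟩
  obtain ⟨C, hC, hle⟩ := hN.lintegral_le
  rw [← enorm_eq_zero, ← nonpos_iff_eq_zero]
  refine ENNReal.le_of_forall_pos_le_add fun ε hε _ => ?_
  rw [zero_add]
  obtain ⟨g, ⟨hg, U, -, hEU, hv⟩, l⟩ := h (ε / (C + 1))
    (ENNReal.div_pos (by simpa using hε.ne') (by finiteness))
  obtain ⟨G, hG⟩ := hN.exists_hasFourier g hg
  have hGx := hG.vanishesOn_iff.1 hv x (hEU hx)
  have h1 := enorm_invF_le (fun ξ => F ξ - G ξ) x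
  rw [hF.invF_sub hG, hGx, sub_zero] at h1
  have h2 := hle _ (hF.sub hG).1
  rw [← hN.eq (hF.sub hG)] at h2
  exact (h1.trans h2).trans (ennreal_mul_lt_of_lt_div hC l).le

end IsFourierAlgebraNorm

/-- Multiplication by Schwartz functions maps the space of `NF₁` to the space of `NF₂`, both norms
being expressed on the side of the Fourier transform. -/
def LocallyLE (NF₁ NF₂ : (Eucl n → ℂ) → ℝ≥0∞) : Prop :=
  ∀ X : 𝓢(Eucl n, ℂ), ∃ C : ℝ≥0∞, C ≠ ∞ ∧ ∀ F, Integrable F → NF₂ (nconv X F) ≤ C * NF₁ F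

/-- Spectral synthesis of compact sets only depends on the local behavior of the algebra: an element
`f` of the second algebra vanishing on `K` is `χ f + (1 - χ) f` for a cutoff `χ` near `K`, where
`(1 - χ) f` vanishes near `K` and `χ f` belongs to the first algebra. -/
theorem IsSetOfSpectralSynthesis.of_locallyLE {N₁ N₂ : 𝓢'(Eucl n, ℂ) → ℝ≥0∞}
    {NF₁ NF₂ : (Eucl n → ℂ) → ℝ≥0∞} (h₁ : IsFourierAlgebraNorm N₁ NF₁)
    (h₂ : IsFourierAlgebraNorm N₂ NF₂) (h₁₂ : LocallyLE NF₁ NF₂) (h₂₁ : LocallyLE NF₂ NF₁)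
    {K : Set (Eucl n)} (hK : IsCompact K) (h : IsSetOfSpectralSynthesis N₁ K) :
    IsSetOfSpectralSynthesis N₂ K := by
  refine Set.Subset.antisymm ?_ (h₂.minimalIdeal_subset K)
  rintro f ⟨hf, hv⟩
  obtain ⟨R, hR⟩ := hK.isBounded.subset_closedBall 0
  have hinv : ∀ r, invF (schwartzFourier n (cutoff n r)) = cutoff n r := fun r => by
    rw [invF_schwartz, schwartzFourierInv_schwartzFourier]
  have hχ : ∀ r, Integrable (schwartzFourier n (cutoff n r)) := fun r => SchwartzMap.integrable _
  -- The second cutoff is equal to `1` on the support of the first.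
  set X := schwartzFourier n (cutoff n R)
  set X' := schwartzFourier n (cutoff n (|R| + 1))
  have hXX : ∀ x, cutoff n (|R| + 1) x * cutoff n R x = cutoff n R x := fun x => by
    rcases le_total ‖x‖ (|R| + 2) with hx | hx
    · rw [cutoff_eq_one, one_mul]
      rw [abs_of_nonneg (by positivity)]
      linarith
    · rw [cutoff_eq_zero hx, mul_zero]
  obtain ⟨C₁, hC₁, loc₁⟩ := h₂₁ X
  obtain ⟨C₂, hC₂, loc₂⟩ := h₁₂ X'
  obtain ⟨F, hF⟩ := h₂.exists_hasFourier f hf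
  rw [hF.vanishesOn_iff] at hv
  obtain ⟨f₁, hf₁⟩ := exists_distFourier_isGivenBy (integrable_nconv (hχ R) hF.1)
  have hF₁ : HasFourier f₁ (nconv X F) := ⟨integrable_nconv (hχ R) hF.1, hf₁⟩
  have hval : ∀ x, invF (nconv X F) x = cutoff n R x * invF F x := fun x => by
    rw [invF_nconv (hχ R) hF.1, hinv]
  have hNf₁ : N₁ f₁ < ∞ := by
    rw [h₁.eq hF₁]
    refine (loc₁ F hF.1).trans_lt (ENNReal.mul_lt_top hC₁.lt_top ?_)
    rw [← h₂.eq hF]; exact hf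
  -- Multiplication by `χ'` maps the first space to the second.
  have key : ∀ {g : 𝓢'(Eucl n, ℂ)} {G : Eucl n → ℂ}, HasFourier g G → N₁ g < ∞ →
      ∃ g', HasFourier g' (nconv X' G) ∧ N₂ g' ≤ C₂ * N₁ g := fun {g G} hG _ => by
    obtain ⟨g', hg'⟩ := exists_distFourier_isGivenBy (integrable_nconv (hχ (|R| + 1)) hG.1)
    have hG' : HasFourier g' (nconv X' G) := ⟨integrable_nconv (hχ _) hG.1, hg'⟩
    refine ⟨g', hG', ?_⟩
    rw [h₂.eq hG', h₁.eq hG]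
    exact loc₂ G hG.1
  have hNf₂ : N₂ f₁ < ∞ := by
    obtain ⟨g', hg', hle⟩ := key hF₁ hNf₁
    have : g' = f₁ := by
      refine hg'.isGivenBy.unique ?_
      convert hF₁.isGivenBy using 1
      ext x
      rw [invF_nconv (hχ _) hF₁.1, hinv, hval, ← mul_assoc, hXX]
    rw [this] at hle
    exact hle.trans_lt (ENNReal.mul_lt_top hC₂.lt_top hNf₁)
  -- `χ f` vanishes on `K` and is in both spaces, so that synthesis in the first applies to it.
  have hmem : f₁ ∈ vanishingIdeal N₁ K :=
    ⟨hNf₁, hF₁.vanishesOn_iff.2 fun x hx => by rw [hval, hv x hx, mul_zero]⟩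
  rw [h, h₁.minimalIdeal_eq] at hmem
  rw [h₂.minimalIdeal_eq]
  refine ⟨hf, fun ε hε => ?_⟩
  obtain ⟨g, ⟨hg, U, oU, hKU, hgv⟩, l⟩ := hmem.2 (ε / (C₂ + 1))
    (ENNReal.div_pos hε.ne' (by finiteness))
  obtain ⟨G, hG⟩ := h₁.exists_hasFourier g hg
  rw [hG.vanishesOn_iff] at hgv
  obtain ⟨g', hg', hg'le⟩ := key hG hg
  have hfar := hF.sub hF₁
  -- `f = (1 - χ) f + χ f` is approximated by `(1 - χ) f + χ' g`.
  refine ⟨(f - f₁) + g', ⟨?_, U ∩ Metric.ball 0 (|R| + 1), oU.inter Metric.isOpen_ball,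
    Set.subset_inter hKU (hR.trans ?_), (hfar.add hg').vanishesOn_iff.2 ?_⟩, ?_⟩
  · refine (h₂.dist_add_le _ _).trans_lt (ENNReal.add_lt_top.2 ⟨h₂.dist_sub_lt_top hf hNf₂, ?_⟩)
    exact hg'le.trans_lt (ENNReal.mul_lt_top hC₂.lt_top hg)
  · exact Metric.closedBall_subset_ball (by linarith [le_abs_self R])
  · rintro x ⟨hxU, hxb⟩
    have hx : ‖x‖ ≤ |R| + 1 := by simpa using (Metric.mem_ball.1 hxb).le
    rw [invF_add hfar.1 hg'.1, hF.invF_sub hF₁, hval, cutoff_eq_one hx, one_mul, sub_self, zero_add,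
      invF_nconv (hχ _) hG.1, hgv x hxU, mul_zero]
  · obtain ⟨d, hd, hdle⟩ := key (hF₁.sub hG) (h₁.dist_sub_lt_top hNf₁ hg)
    have : f - (f - f₁ + g') = d := by
      rw [show f - (f - f₁ + g') = f₁ - g' by abel]
      refine (hF₁.isGivenBy.sub hg'.isGivenBy).unique ?_
      convert hd.isGivenBy using 1
      ext x
      rw [invF_nconv (hχ _) hG.1, invF_nconv (hχ _) (hF₁.sub hG).1, hF₁.invF_sub hG, hinv, hval,
        mul_sub, ← mul_assoc, hXX]
    rw [this]
    exact hdle.trans_lt (ennreal_mul_lt_of_lt_div hC₂ l)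

/-! ### The Fourier-Wermer algebra -/

/-- The norm of `𝓕L^q_s` on the side of the Fourier transform. -/
def wermerNormF (q : ℝ≥0∞) (s : ℝ) (F : Eucl n → ℂ) : ℝ≥0∞ :=
  eLpNorm (fun ξ => weight s ξ * ‖F ξ‖ₑ) q volume

theorem aemeasurable_weight_mul_enorm (s : ℝ) {F : Eucl n → ℂ} (hF : AEStronglyMeasurable F) :
    AEMeasurable fun ξ => weight s ξ * ‖F ξ‖ₑ :=
  (measurable_weight s).aemeasurable.mul hF.enorm

theorem isFourierAlgebraNorm_fourierWermerNorm {q : ℝ≥0∞} {s : ℝ} (h : AdmissibleWeight n q s) :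
    IsFourierAlgebraNorm (n := n) (fourierWermerNorm q s) (wermerNormF q s) where
  exists_hasFourier := fun f hf => by
    obtain ⟨F, hF⟩ := exists_isGivenBy_of_weightedLpNorm_lt_top hf
    obtain ⟨D, hD, hle⟩ := exists_lintegral_le_mul_eLpNorm_weight_volume h
    refine ⟨F, ⟨hF.aestronglyMeasurable, ?_⟩, hF⟩
    rw [fourierWermerNorm, weightedLpNorm_eq hF] at hf
    exact (hle _ hF.aestronglyMeasurable.enorm).trans_lt (ENNReal.mul_lt_top hD.lt_top hf)
  eq := fun hF => weightedLpNorm_eq hF.2 q s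
  add_le := fun F G hF hG => by
    refine le_trans (eLpNorm_mono_enorm fun ξ => ?_) (eLpNorm_add_le
      (aemeasurable_weight_mul_enorm s hF.1).aestronglyMeasurable
      (aemeasurable_weight_mul_enorm s hG.1).aestronglyMeasurable h.one_le)
    simp only [enorm_eq_self, Pi.add_apply, ← mul_add]
    gcongr
    exact enorm_add_le _ _
  const_mul_le := fun c F hF => by
    refine eLpNorm_le_mul_eLpNorm_of_ae_le_mul'' q
      (aemeasurable_weight_mul_enorm s hF.1).aestronglyMeasurable (ae_of_all _ fun ξ => ?_)
    simp only [enorm_eq_self, enorm_mul]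
    exact (mul_left_comm _ _ _).le
  lintegral_le := by
    obtain ⟨D, hD, hle⟩ := exists_lintegral_le_mul_eLpNorm_weight_volume h
    exact ⟨D, hD, fun F hF => hle _ hF.1.enorm⟩
  nconv_le := by
    obtain ⟨C, hC, hle⟩ := exists_eLpNorm_weight_conv_le_volume h
    refine ⟨C, hC, fun F G hF hG => le_trans (eLpNorm_mono_enorm fun ξ => ?_)
      (hle (fun ξ => ‖F ξ‖ₑ) (fun ξ => ‖G ξ‖ₑ) hF.1.enorm hG.1.enorm)⟩
    simp only [enorm_eq_self]
    gcongr
    refine (enorm_nconv_le F G ξ).trans_eq ?_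
    rw [lintegral_sub_left_mul_comm volume (fun η => ‖F η‖ₑ)]
    simp only [mul_comm]

/-! ### The frequency-localized pieces -/

/-- The piece `φ(· - k) F` of `F`, the Fourier transform of `φ(D - k) f` if `F` is that of `f`. -/
def piece (φ : 𝓢(Eucl n, ℂ)) (k : Fin n → ℤ) (F : Eucl n → ℂ) (ξ : Eucl n) : ℂ :=
  φ (ξ - latticePt k) * F ξ

/-- The norm of `M^{p,q}_s` on the side of the Fourier transform. -/
def modulationNormF (φ : 𝓢(Eucl n, ℂ)) (p q : ℝ≥0∞) (s : ℝ) (F : Eucl n → ℂ) : ℝ≥0∞ :=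
  eLpNorm (fun k : Fin n → ℤ =>
    weight s (latticePt k) * eLpNorm (invF (piece φ k F)) p volume) q Measure.count

theorem integrable_piece (φ : 𝓢(Eucl n, ℂ)) (k : Fin n → ℤ) {F : Eucl n → ℂ} (hF : Integrable F) :
    Integrable (piece φ k F) :=
  integrable_schwartz_mul hF (compSubConstCLM ℂ (latticePt k) φ)

theorem continuous_invF_piece (φ : 𝓢(Eucl n, ℂ)) (k : Fin n → ℤ) {F : Eucl n → ℂ}
    (hF : Integrable F) : Continuous (invF (piece φ k F)) :=
  continuous_invF (integrable_piece φ k hF)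

theorem isGivenBy_freqPiece_piece (φ : 𝓢(Eucl n, ℂ)) (k : Fin n → ℤ) {f : 𝓢'(Eucl n, ℂ)}
    {F : Eucl n → ℂ} (h : HasFourier f F) : IsGivenBy (freqPiece φ k f) (invF (piece φ k F)) :=
  isGivenBy_freqPiece φ k h.1 h.2

theorem modulationNorm_eq (φ : 𝓢(Eucl n, ℂ)) (p q : ℝ≥0∞) (s : ℝ) {f : 𝓢'(Eucl n, ℂ)}
    {F : Eucl n → ℂ} (h : HasFourier f F) :
    modulationNorm φ p q s f = modulationNormF φ p q s F := by
  rw [modulationNorm, modulationNormF]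
  congr 1
  ext k
  rw [weightedLpNorm_zero_eq (isGivenBy_freqPiece_piece φ k h)]
  rfl

theorem modulationNormF_add_le (φ : 𝓢(Eucl n, ℂ)) {p q : ℝ≥0∞} (hp : 1 ≤ p) (hq : 1 ≤ q) (s : ℝ)
    {F G : Eucl n → ℂ} (hF : Integrable F) (hG : Integrable G) :
    modulationNormF φ p q s (fun ξ => F ξ + G ξ) ≤
      modulationNormF φ p q s F + modulationNormF φ p q s G := by
  refine le_trans (eLpNorm_mono_enorm fun k => ?_) (eLpNorm_add_le
    (measurable_of_countable _).aestronglyMeasurable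
    (measurable_of_countable _).aestronglyMeasurable hq)
  simp only [enorm_eq_self, Pi.add_apply, ← mul_add]
  gcongr
  have e : invF (piece φ k fun ξ => F ξ + G ξ) = invF (piece φ k F) + invF (piece φ k G) := by
    have e' : (piece φ k fun ξ => F ξ + G ξ) = fun ξ => piece φ k F ξ + piece φ k G ξ := by
      ext ξ; simp only [piece, mul_add]
    ext x
    rw [e', invF_add (integrable_piece φ k hF) (integrable_piece φ k hG), Pi.add_apply]
  rw [e]
  exact eLpNorm_add_le (continuous_invF_piece φ k hF).aestronglyMeasurable
    (continuous_invF_piece φ k hG).aestronglyMeasurable hp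

theorem modulationNormF_const_mul_le (φ : 𝓢(Eucl n, ℂ)) (p q : ℝ≥0∞) (s : ℝ) (c : ℂ)
    {F : Eucl n → ℂ} (hF : Integrable F) :
    modulationNormF φ p q s (fun ξ => c * F ξ) ≤ ‖c‖ₑ * modulationNormF φ p q s F := by
  refine eLpNorm_le_mul_eLpNorm_of_ae_le_mul'' q
    (measurable_of_countable _).aestronglyMeasurable (ae_of_all _ fun k => ?_)
  simp only [enorm_eq_self]
  have e : eLpNorm (invF (piece φ k fun ξ => c * F ξ)) p volume ≤
      ‖c‖ₑ * eLpNorm (invF (piece φ k F)) p volume := by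
    refine eLpNorm_le_mul_eLpNorm_of_ae_le_mul'' p
      (continuous_invF_piece φ k hF).aestronglyMeasurable (ae_of_all _ fun x => ?_)
    have e' : (piece φ k fun ξ => c * F ξ) = fun ξ => c * piece φ k F ξ := by
      ext ξ; simp only [piece]; ring
    rw [e', invF_const_mul, enorm_mul]
  calc _ ≤ weight s (latticePt k) * (‖c‖ₑ * eLpNorm (invF (piece φ k F)) p volume) := by gcongr
    _ = _ := mul_left_comm _ _ _

theorem IsUnifPartition.abs_le_one {φ : 𝓢(Eucl n, ℂ)} (h : IsUnifPartition φ) {ξ : Eucl n}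
    (hξ : φ ξ ≠ 0) (i : Fin n) : |ξ i| ≤ 1 := by
  have := h.1 (subset_tsupport _ hξ) i
  exact abs_le.2 this

theorem IsUnifPartition.norm_le {φ : 𝓢(Eucl n, ℂ)} (h : IsUnifPartition φ) {ξ : Eucl n}
    (hξ : φ ξ ≠ 0) : ‖ξ‖ ≤ n := by
  have h1 : ‖ξ‖ ^ 2 ≤ n := by
    rw [EuclideanSpace.norm_sq_eq]
    calc _ ≤ ∑ i : Fin n, (1 : ℝ) := by
          refine Finset.sum_le_sum fun i _ => ?_
          have := h.abs_le_one hξ i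
          rw [Real.norm_eq_abs]
          nlinarith [abs_nonneg (ξ i)]
      _ = n := by simp
  have h2 : (n : ℝ) ≤ (n : ℝ) ^ 2 := by
    norm_cast; exact Nat.le_self_pow two_ne_zero n
  exact (sq_le_sq₀ (norm_nonneg _) (by positivity)).1 (h1.trans h2)

/-- The cutoff `cutoff n n` equals `1` on the support of `φ`. -/
theorem IsUnifPartition.mul_cutoff {φ : 𝓢(Eucl n, ℂ)} (h : IsUnifPartition φ) (ξ : Eucl n) :
    φ ξ * cutoff n n ξ = φ ξ := by
  by_cases hξ : φ ξ = 0
  · rw [hξ, zero_mul]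
  · rw [cutoff_eq_one, mul_one]
    have := h.norm_le hξ
    rw [abs_of_nonneg (by positivity)]; linarith

theorem IsUnifPartition.hasSum_piece {φ : 𝓢(Eucl n, ℂ)} (h : IsUnifPartition φ) (F : Eucl n → ℂ)
    (ξ : Eucl n) : HasSum (fun k => piece φ k F ξ) (F ξ) := by
  have := (h.2 ξ).mul_right (F ξ)
  rwa [one_mul] at this

theorem enorm_piece_le (φ : 𝓢(Eucl n, ℂ)) (k : Fin n → ℤ) (H : Eucl n → ℂ) (ξ : Eucl n) :
    ‖piece φ k H ξ‖ₑ ≤ ENNReal.ofReal (SchwartzMap.seminorm ℝ 0 0 φ) * ‖H ξ‖ₑ := by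
  rw [piece, enorm_mul]
  gcongr
  rw [← ofReal_norm]
  exact ENNReal.ofReal_le_ofReal (SchwartzMap.norm_le_seminorm ℝ φ _)

/-- At each point only boundedly many of the translates of `φ` are nonzero. This is expressed by
comparison with the lattice sums of `⟨·⟩^{-n-1}`. -/
theorem IsUnifPartition.tsum_lintegral_piece_ne_top {φ : 𝓢(Eucl n, ℂ)} (h : IsUnifPartition φ)
    {F : Eucl n → ℂ} (hF : Integrable F) : ∑' k, ∫⁻ ξ, ‖piece φ k F ξ‖ₑ ≠ ∞ := by
  have hn : (n : ℝ) < n + 1 := by linarith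
  obtain ⟨A, hA, hAle⟩ := exists_tsum_weight_neg_le hn
  set M := ENNReal.ofReal ((1 + n : ℝ) ^ (n + 1 : ℝ))
  set S := ENNReal.ofReal (SchwartzMap.seminorm ℝ 0 0 φ)
  have hF' := hF.2.ne
  rw [← lintegral_tsum fun k => (integrable_piece φ k hF).1.enorm]
  refine ne_top_of_le_ne_top (b := ∫⁻ ξ, S * M * A * ‖F ξ‖ₑ) ?_ (lintegral_mono fun ξ => ?_)
  · rw [lintegral_const_mul' _ _ (by finiteness)]
    exact ENNReal.mul_ne_top (by finiteness) hF'
  calc ∑' k, ‖piece φ k F ξ‖ₑ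
      ≤ ∑' k, S * M * ‖F ξ‖ₑ * weight (-(n + 1 : ℝ)) (ξ - latticePt k) := by
        refine ENNReal.tsum_le_tsum fun k => ?_
        rw [piece, enorm_mul]
        by_cases h0 : φ (ξ - latticePt k) = 0
        · simp [h0]
        have h1 : ‖φ (ξ - latticePt k)‖ₑ ≤ S := by
          rw [← ofReal_norm]
          exact ENNReal.ofReal_le_ofReal (SchwartzMap.norm_le_seminorm ℝ φ _)
        calc _ ≤ S * ‖F ξ‖ₑ * 1 := by rw [mul_one]; exact mul_le_mul_left h1 _
          _ ≤ S * ‖F ξ‖ₑ * (M * weight (-(n + 1 : ℝ)) (ξ - latticePt k)) :=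
              mul_le_mul_right (one_le_mul_weight_neg (by positivity) (h.norm_le h0)) _
          _ = _ := by ring
    _ ≤ S * M * ‖F ξ‖ₑ * A := by
        rw [ENNReal.tsum_mul_left]
        exact mul_le_mul_right (hAle ξ) _
    _ = _ := by ring

/-- Bernstein's inequality: `‖φ(· - k) F‖_1` is controlled by the `L^p` norm of the inverse Fourier
transform, for `1 ≤ p ≤ 2`. -/
theorem IsUnifPartition.exists_lintegral_piece_le {φ : 𝓢(Eucl n, ℂ)} (h : IsUnifPartition φ)
    {p : ℝ≥0∞} (hp : 1 ≤ p) (hp2 : p ≤ 2) :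
    ∃ C : ℝ≥0∞, C ≠ ∞ ∧ ∀ (k : Fin n → ℤ) (F : Eucl n → ℂ), Integrable F →
      ∫⁻ ξ, ‖piece φ k F ξ‖ₑ ≤ C * eLpNorm (invF (piece φ k F)) p volume := by
  obtain ⟨C, hC, hle⟩ := exists_integrable_of_eLpNorm_fourierInv (cutoff n n) hp hp2
  refine ⟨C + 1, by finiteness, fun k F hF => ?_⟩
  rcases eq_or_ne (eLpNorm (invF (piece φ k F)) p volume) ∞ with htop | htop
  · rw [htop, ENNReal.mul_top (by simp)]; exact le_top
  obtain ⟨T, hT⟩ := exists_isGivenBy_of_integrable (integrable_piece φ k hF)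
  obtain ⟨G, hG, hTG, hGle⟩ := hle (latticePt k) T _
    (isGivenBy_distFourierInv (integrable_piece φ k hF) hT) htop.lt_top (fun ψ => by
      rw [(hT _).2, (hT _).2]
      congr 1; ext ξ
      rw [shiftMul_apply, piece]
      linear_combination (ψ ξ * F ξ) * h.mul_cutoff (ξ - latticePt k))
  rw [lintegral_congr_ae ((hT.ae_eq hTG).mono fun ξ hξ => by rw [hξ])]
  exact hGle.trans (by gcongr; exact le_self_add)

/-! ### Distributions of finite modulation space norm -/

/-- A series of Schwartz functions with summable Schwartz seminorms converges to its pointwise sum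
in the Schwartz space. -/
theorem hasSum_of_summable_seminorm {ι : Type*} {f : ι → 𝓢(Eucl n, ℂ)} {ψ : 𝓢(Eucl n, ℂ)}
    (hs : ∀ a b, Summable fun i => SchwartzMap.seminorm ℂ a b (f i))
    (hp : ∀ x, HasSum (fun i => f i x) (ψ x)) : HasSum f ψ := by
  have hd : ∀ (b i x), ‖iteratedFDeriv ℝ b (f i) x‖ ≤ SchwartzMap.seminorm ℂ 0 b (f i) := by
    intro b i x
    simpa using SchwartzMap.le_seminorm ℂ 0 b (f i) x
  have hD : ∀ b x, HasSum (fun i => iteratedFDeriv ℝ b (f i) x) (iteratedFDeriv ℝ b ψ x) := by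
    intro b x
    have h := iteratedFDeriv_tsum_apply (𝕜 := ℝ) (N := ⊤) (f := fun i => (f i : Eucl n → ℂ))
      (fun i => (f i).smooth ⊤) (fun k _ => hs 0 k) (fun k i x _ => hd k i x) (k := b)
      (mod_cast le_top) x
    have e : (fun y => ∑' i, f i y) = ψ := funext fun y => (hp y).tsum_eq
    rw [e] at h
    rw [h]
    exact (Summable.of_norm_bounded (hs 0 b) fun i => hd b i x).hasSum
  rw [HasSum, (schwartz_withSeminorms ℂ (Eucl n) ℂ).tendsto_nhds]
  rintro ⟨a, b⟩ ε hε
  have ht := tendsto_tsum_compl_atTop_zero fun i => SchwartzMap.seminorm ℂ a b (f i)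
  filter_upwards [(tendsto_order.1 ht).2 ε hε] with S hS
  refine lt_of_le_of_lt ?_ hS
  refine SchwartzMap.seminorm_le_bound ℂ a b _
    (tsum_nonneg fun i => apply_nonneg _ _) fun x => ?_
  have h1 : HasSum (fun i : {i // i ∉ S} => iteratedFDeriv ℝ b (f i) x)
      (iteratedFDeriv ℝ b ψ x - ∑ i ∈ S, iteratedFDeriv ℝ b (f i) x) := by
    have := (hD b x).summable
    have h2 := this.sum_add_tsum_subtype_compl S
    rw [(hD b x).tsum_eq] at h2
    rw [← h2, add_sub_cancel_left]
    exact (this.subtype _).hasSum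
  have h3 : iteratedFDeriv ℝ b (∑ i ∈ S, f i - ψ : 𝓢(Eucl n, ℂ)) x =
      -(iteratedFDeriv ℝ b ψ x - ∑ i ∈ S, iteratedFDeriv ℝ b (f i) x) := by
    have e : ((∑ i ∈ S, f i - ψ : 𝓢(Eucl n, ℂ)) : Eucl n → ℂ) =
        (fun x => ∑ i ∈ S, f i x) - ψ := by
      ext y; simp
    rw [e, iteratedFDeriv_sub_apply, iteratedFDeriv_fun_sum_apply]
    · simp
    · exact fun i _ => ((f i).smooth _).contDiffAt
    · exact (ContDiff.sum fun i _ => (f i).smooth _).contDiffAt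
    · exact (ψ.smooth _).contDiffAt
  rw [h3, norm_neg, ← h1.tsum_eq, ← abs_of_nonneg (a := ‖x‖ ^ a) (by positivity),
    ← Real.norm_eq_abs, ← norm_smul, ← tsum_const_smul'']
  refine tsum_of_norm_bounded ((hs a b).subtype _).hasSum fun i => ?_
  rw [norm_smul, Real.norm_eq_abs, abs_of_nonneg (a := ‖x‖ ^ a) (by positivity)]
  exact SchwartzMap.le_seminorm ℂ a b (f i) x

/-- `∑ φ(· - k) ψ = ψ` in the Schwartz space, so that a tempered distribution is the sum of its
pieces. -/
theorem IsUnifPartition.hasSum_shiftMul {φ : 𝓢(Eucl n, ℂ)} (h : IsUnifPartition φ)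
    (ψ : 𝓢(Eucl n, ℂ)) : HasSum (fun k => shiftMul ψ φ (latticePt k)) ψ := by
  refine hasSum_of_summable_seminorm (fun a b => ?_) fun ξ => ?_
  · have hn : (n : ℝ) < n + 1 := by linarith
    obtain ⟨C, hC, hle⟩ := exists_ofReal_seminorm_shiftMul_le ψ φ
      ((schwartz_withSeminorms ℂ (Eucl n) ℂ).continuous_seminorm (a, b)) (n + 1)
    obtain ⟨A, hA, hsum⟩ := exists_tsum_weight_neg_le hn
    have hfin : ∑' k : Fin n → ℤ, ENNReal.ofReal
        (SchwartzMap.seminorm ℂ a b (shiftMul ψ φ (latticePt k))) ≠ ∞ := by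
      refine ne_top_of_le_ne_top (b := C * A) (by finiteness)
        ((ENNReal.tsum_le_tsum fun k => hle (latticePt k)).trans ?_)
      rw [ENNReal.tsum_mul_left]
      gcongr
      simpa only [zero_sub, weight_neg] using hsum 0
    simpa using ENNReal.summable_toReal hfin
  · have := (h.2 ξ).mul_left (ψ ξ)
    rwa [mul_one] at this

/-- A distribution of finite modulation space norm has an integrable Fourier transform: the pieces
of the Fourier transform are integrable by Bernstein's inequality, and `ℓ^q_s ⊆ ℓ^1` makes their
sum converge. -/
theorem IsUnifPartition.exists_hasFourier {φ : 𝓢(Eucl n, ℂ)} (h : IsUnifPartition φ)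
    {p q : ℝ≥0∞} {s : ℝ} (hp : 1 ≤ p) (hp2 : p ≤ 2) (hqs : AdmissibleWeight n q s)
    {f : 𝓢'(Eucl n, ℂ)} (hf : modulationNorm φ p q s f < ∞) : ∃ F, HasFourier f F := by
  obtain ⟨D, hD, hDle⟩ := exists_tsum_le_mul_eLpNorm_weight_count hqs
  have hsum : ∑' k, weightedLpNorm p 0 (freqPiece φ k f) < ∞ :=
    (hDle _).trans_lt (ENNReal.mul_lt_top hD.lt_top hf)
  obtain ⟨C, hC, hCle⟩ := exists_integrable_of_eLpNorm_fourierInv (cutoff n n) hp hp2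
  set T := fun k : Fin n → ℤ => TemperedDistribution.smulLeftCLM ℂ (fun ξ => φ (ξ - latticePt k))
    (distFourier f)
  have hT : ∀ k ψ, T k ψ = distFourier f (shiftMul ψ φ (latticePt k)) := by
    intro k ψ
    have hφ : (fun ξ => φ (ξ - latticePt k)).HasTemperateGrowth :=
      (compSubConstCLM ℂ (latticePt k) φ).hasTemperateGrowth
    change distFourier f (SchwartzMap.smulLeftCLM ℂ (fun ξ => φ (ξ - latticePt k)) ψ) = _
    congr 1
    ext ξ
    rw [SchwartzMap.smulLeftCLM_apply_apply hφ, smul_eq_mul, shiftMul_apply, mul_comm]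
  have hpiece : ∀ k, ∃ G : Eucl n → ℂ, Integrable G ∧ IsGivenBy (T k) G ∧
      ∫⁻ ξ, ‖G ξ‖ₑ ≤ C * weightedLpNorm p 0 (freqPiece φ k f) := by
    intro k
    have hlt : weightedLpNorm p 0 (freqPiece φ k f) < ∞ := (ENNReal.le_tsum k).trans_lt hsum
    obtain ⟨u, hu⟩ := exists_isGivenBy_of_weightedLpNorm_lt_top hlt
    rw [weightedLpNorm_zero_eq hu] at hlt ⊢
    refine hCle (latticePt k) (T k) u hu hlt fun ψ => ?_
    rw [hT, hT]
    congr 1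
    ext ξ
    simp only [shiftMul_apply]
    linear_combination ψ ξ * h.mul_cutoff (ξ - latticePt k)
  choose G hG hTG hGle using hpiece
  have hGsum : ∑' k, ∫⁻ ξ, ‖G k ξ‖ₑ ≠ ∞ := by
    refine ne_top_of_le_ne_top ?_ (ENNReal.tsum_le_tsum hGle)
    rw [ENNReal.tsum_mul_left]
    exact ENNReal.mul_ne_top hC hsum.ne
  have hF : Integrable fun ξ => ∑' k, G k ξ := by
    refine ⟨(AEMeasurable.tsum fun k => (hG k).1.aemeasurable).aestronglyMeasurable, ?_⟩
    calc ∫⁻ ξ, ‖∑' k, G k ξ‖ₑ ≤ ∫⁻ ξ, ∑' k, ‖G k ξ‖ₑ :=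
          lintegral_mono fun ξ => enorm_tsum_le_tsum_enorm
      _ = ∑' k, ∫⁻ ξ, ‖G k ξ‖ₑ := lintegral_tsum fun k => (hG k).1.enorm
      _ < ∞ := hGsum.lt_top
  refine ⟨_, hF, fun ψ => ⟨integrable_schwartz_mul hF ψ, ?_⟩⟩
  have h1 := ((h.hasSum_shiftMul ψ).map (distFourier f) (map_continuous _)).tsum_eq
  rw [← h1]
  simp only [← tsum_mul_left]
  rw [integral_tsum (fun k => (integrable_schwartz_mul (hG k) ψ).1)]
  · refine tsum_congr fun k => ?_
    rw [← (hTG k ψ).2, hT]; rfl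
  · set S := ENNReal.ofReal (SchwartzMap.seminorm ℝ 0 0 ψ)
    refine ne_top_of_le_ne_top (b := S * ∑' k, ∫⁻ ξ, ‖G k ξ‖ₑ) (by finiteness) ?_
    rw [← ENNReal.tsum_mul_left]
    refine ENNReal.tsum_le_tsum fun k => ?_
    rw [← lintegral_const_mul' _ _ (by finiteness)]
    refine lintegral_mono fun ξ => ?_
    rw [enorm_mul]
    gcongr
    rw [← ofReal_norm]
    exact ENNReal.ofReal_le_ofReal (SchwartzMap.norm_le_seminorm ℝ ψ ξ)

theorem IsUnifPartition.exists_tsum_lintegral_piece_le {φ : 𝓢(Eucl n, ℂ)} (h : IsUnifPartition φ)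
    {p q : ℝ≥0∞} {s : ℝ} (hp : 1 ≤ p) (hp2 : p ≤ 2) (hqs : AdmissibleWeight n q s) :
    ∃ C : ℝ≥0∞, C ≠ ∞ ∧ ∀ F : Eucl n → ℂ, Integrable F →
      ∑' k, ∫⁻ ξ, ‖piece φ k F ξ‖ₑ ≤ C * modulationNormF φ p q s F := by
  obtain ⟨D, hD, hDle⟩ := exists_tsum_le_mul_eLpNorm_weight_count hqs
  obtain ⟨C, hC, hCle⟩ := h.exists_lintegral_piece_le hp hp2
  refine ⟨C * D, by finiteness, fun F hF => ?_⟩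
  calc ∑' k, ∫⁻ ξ, ‖piece φ k F ξ‖ₑ
      ≤ ∑' k, C * eLpNorm (invF (piece φ k F)) p volume :=
        ENNReal.tsum_le_tsum fun k => hCle k F hF
    _ = C * ∑' k, eLpNorm (invF (piece φ k F)) p volume := ENNReal.tsum_mul_left
    _ ≤ C * (D * modulationNormF φ p q s F) := mul_le_mul_right (hDle _) _
    _ = _ := (mul_assoc _ _ _).symm

theorem IsUnifPartition.lintegral_enorm_le_tsum {φ : 𝓢(Eucl n, ℂ)} (h : IsUnifPartition φ)
    {F : Eucl n → ℂ} (hF : Integrable F) :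
    ∫⁻ ξ, ‖F ξ‖ₑ ≤ ∑' k, ∫⁻ ξ, ‖piece φ k F ξ‖ₑ := by
  rw [← lintegral_tsum fun k => (integrable_piece φ k hF).1.enorm]
  refine lintegral_mono fun ξ => ?_
  rw [← (h.hasSum_piece F ξ).tsum_eq]
  exact enorm_tsum_le_tsum_enorm

/-! ### Local comparison of the two norms -/

theorem nconv_comm (F G : Eucl n → ℂ) : nconv F G = nconv G F := by
  ext ξ
  rw [nconv, nconv, ← integral_sub_left_eq_self (fun η => G η * F (ξ - η)) volume ξ]
  simp only [sub_sub_cancel, mul_comm]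

/-- Fubini's theorem for the inverse Fourier transform. -/
theorem invF_integral {H : Eucl n × Eucl n → ℂ} (hH : Integrable H (volume.prod volume))
    (x : Eucl n) : invF (fun ξ => ∫ η, H (ξ, η)) x = ∫ η, invF (fun ξ => H (ξ, η)) x := by
  simp only [invF, Real.fourierInv_eq]
  rw [integral_const_mul]
  congr 1
  have hc : Continuous fun z : Eucl n × Eucl n =>
      (Real.fourierChar (inner ℝ z.1 ((2 * Real.pi)⁻¹ • x)) : ℂ) :=
    continuous_subtype_val.comp (Real.continuous_fourierChar.comp (by fun_prop))
  have h : Integrable (fun z : Eucl n × Eucl n =>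
      (Real.fourierChar (inner ℝ z.1 ((2 * Real.pi)⁻¹ • x)) : ℂ) * H z) (volume.prod volume) :=
    hH.bdd_mul (c := 1) hc.aestronglyMeasurable (ae_of_all _ fun z => (Circle.norm_coe _).le)
  simp only [Circle.smul_def, smul_eq_mul, ← integral_const_mul]
  exact integral_integral_swap h

/-- `φ(D - k)(χ f)` as a superposition of functions localized in space and in frequency, where `X`
is the Fourier transform of `χ`. -/
theorem invF_piece_nconv (φ X : 𝓢(Eucl n, ℂ)) (k : Fin n → ℤ) {F : Eucl n → ℂ}
    (hF : Integrable F) (x : Eucl n) : invF (piece φ k (nconv X F)) x =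
      fourierConst n * ∫ η, F η * invF (fun ξ => φ (ξ - latticePt k) * X (ξ - η)) x := by
  have e : piece φ k (nconv X F) = fun ξ => fourierConst n *
      ∫ η, F η * (φ (ξ - latticePt k) * X (ξ - η)) := by
    ext ξ
    rw [nconv_comm, piece, nconv, mul_left_comm, ← integral_const_mul]
    congr 2
    ext η; ring
  have hH : Integrable (fun z : Eucl n × Eucl n => F z.2 * (φ (z.1 - latticePt k) * X (z.1 - z.2)))
      (volume.prod volume) := by
    have h := Integrable.convolution_integrand (ContinuousLinearMap.mul ℂ ℂ) hF
      (X.integrable (μ := volume))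
    have h2 := h.bdd_mul (f := fun z : Eucl n × Eucl n => φ (z.1 - latticePt k))
      (c := SchwartzMap.seminorm ℝ 0 0 φ)
      (φ.continuous.comp (by fun_prop)).aestronglyMeasurable
      (ae_of_all _ fun z => SchwartzMap.norm_le_seminorm ℝ φ _)
    refine h2.congr (ae_of_all _ fun z => ?_)
    simp only [ContinuousLinearMap.mul_apply']; ring
  rw [e, invF_const_mul]
  congr 1
  refine (invF_integral hH x).trans ?_
  simp only [invF_const_mul]

theorem eLpNorm_weight_neg_lt_top {t : ℝ} (ht : n < t) {p : ℝ≥0∞} (hp : 1 ≤ p) (hp' : p ≠ ∞) :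
    eLpNorm (weight (-t) : Eucl n → ℝ≥0∞) p volume < ∞ := by
  have h1 : 1 ≤ p.toReal := by
    rwa [← ENNReal.toReal_one, ENNReal.toReal_le_toReal (by simp) hp']
  rw [eLpNorm_lt_top_iff_lintegral_rpow_enorm_lt_top (one_pos.trans_le hp).ne' hp']
  simp only [enorm_eq_self, weight_rpow, neg_mul]
  exact lintegral_weight_neg_lt_top (by nlinarith [(Nat.cast_nonneg n : (0 : ℝ) ≤ n)])

theorem locallyLE_wermerNormF_modulationNormF (φ : 𝓢(Eucl n, ℂ)) {p q : ℝ≥0∞} {s : ℝ}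
    (hp : 1 ≤ p) (hp' : p ≠ ∞) (hq : 1 ≤ q) (hs : 0 ≤ s) :
    LocallyLE (wermerNormF (n := n) q s) (modulationNormF φ p q s) := by
  intro X
  have hn : (n : ℝ) < n + 1 := by linarith
  obtain ⟨C, hC, hCle⟩ := exists_enorm_invF_shiftMul_le φ X (n + 1 + s) (n + 1)
  obtain ⟨A, hA, hAle⟩ := exists_tsum_weight_neg_le hn
  have hI := (lintegral_weight_neg_lt_top hn).ne
  set B := eLpNorm (weight (-(n + 1 : ℝ)) : Eucl n → ℝ≥0∞) p volume
  have hB : B ≠ ∞ := (eLpNorm_weight_neg_lt_top hn hp hp').ne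
  set A' := A + ∫⁻ x : Eucl n, weight (-(n + 1 : ℝ)) x
  refine ⟨C * B * (ENNReal.ofReal (2 ^ s) * A'), by finiteness, fun F hF => ?_⟩
  have hpt : ∀ (k : Fin n → ℤ), eLpNorm (invF (piece φ k (nconv X F))) p volume ≤
      C * B * ∫⁻ η, weight (-(n + 1 + s)) (latticePt k - η) * ‖F η‖ₑ := by
    intro k
    set I := ∫⁻ η, weight (-(n + 1 + s)) (latticePt k - η) * ‖F η‖ₑ
    calc eLpNorm (invF (piece φ k (nconv X F))) p volume ≤ (C * I) * B := by
          refine eLpNorm_le_mul_eLpNorm_of_ae_le_mul'' p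
            (measurable_weight _).aestronglyMeasurable (ae_of_all _ fun x => ?_)
          rw [invF_piece_nconv φ X k hF, enorm_mul, enorm_eq_self]
          calc _ ≤ 1 * ∫⁻ η, ‖F η * invF (fun ξ => φ (ξ - latticePt k) * X (ξ - η)) x‖ₑ :=
                mul_le_mul' enorm_fourierConst_le (enorm_integral_le_lintegral_enorm _)
            _ ≤ ∫⁻ η, (C * weight (-(n + 1 : ℝ)) x) *
                  (weight (-(n + 1 + s)) (latticePt k - η) * ‖F η‖ₑ) := by
                rw [one_mul]
                refine lintegral_mono fun η => ?_
                rw [enorm_mul]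
                exact (mul_le_mul_right (hCle (latticePt k) η x) _).trans_eq (by ring)
            _ = C * weight (-(n + 1 : ℝ)) x * I :=
                lintegral_const_mul' _ _ (ENNReal.mul_ne_top hC (weight_ne_top _ _))
            _ = _ := by ring
      _ = _ := by ring
  calc modulationNormF φ p q s (nconv X F)
      ≤ C * B * eLpNorm (fun k : Fin n → ℤ => weight s (latticePt k) *
          ∫⁻ η, weight (-(n + 1 + s)) (latticePt k - η) * ‖F η‖ₑ) q Measure.count := by
        refine eLpNorm_le_mul_eLpNorm_of_ae_le_mul'' q
          (measurable_of_countable _).aestronglyMeasurable (ae_of_all _ fun k => ?_)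
        rw [enorm_eq_self, enorm_eq_self]
        exact (mul_le_mul_right (hpt k) _).trans_eq (by ring)
    _ ≤ C * B * (ENNReal.ofReal (2 ^ s) * A' * wermerNormF q s F) := by
        refine mul_le_mul_right (eLpNorm_weight_kernel_le Measure.count volume
          (ι := latticePt) (κ := id) (measurable_of_countable _) measurable_id hq hs
          (fun x => ?_) (fun y => ?_) hF.1.enorm) _
        · simp only [id]
          rw [lintegral_sub_left_eq_self (fun y => weight (-(n + 1 : ℝ)) y) x]
          exact le_add_self
        · rw [lintegral_count]
          exact (hAle y).trans le_self_add
    _ = _ := by ring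

theorem IsUnifPartition.nconv_eq_tsum {φ : 𝓢(Eucl n, ℂ)} (h : IsUnifPartition φ)
    (X : 𝓢(Eucl n, ℂ)) {F : Eucl n → ℂ} (hF : Integrable F) (ξ : Eucl n) :
    nconv X F ξ = fourierConst n * ∑' k, ∫ η, piece φ k F η * X (ξ - η) := by
  have hsum := h.tsum_lintegral_piece_ne_top hF
  rw [nconv_comm, nconv]
  congr 1
  have hm : ∀ k, Integrable fun η => piece φ k F η * X (ξ - η) := fun k => by
    refine (integrable_piece φ k hF).mul_bdd (c := SchwartzMap.seminorm ℝ 0 0 X)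
      (X.continuous.comp (by fun_prop)).aestronglyMeasurable
      (ae_of_all _ fun z => SchwartzMap.norm_le_seminorm ℝ X _)
  rw [← integral_tsum fun k => (hm k).1]
  · congr 1; ext η
    rw [tsum_mul_right, (h.hasSum_piece F η).tsum_eq]
  · set S := ENNReal.ofReal (SchwartzMap.seminorm ℝ 0 0 X)
    refine ne_top_of_le_ne_top (b := (∑' k, ∫⁻ ξ, ‖piece φ k F ξ‖ₑ) * S) (by finiteness) ?_
    rw [← ENNReal.tsum_mul_right]
    refine ENNReal.tsum_le_tsum fun k => ?_
    rw [← lintegral_mul_const' _ _ (by finiteness)]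
    refine lintegral_mono fun η => ?_
    rw [enorm_mul]
    gcongr
    rw [← ofReal_norm]
    exact ENNReal.ofReal_le_ofReal (SchwartzMap.norm_le_seminorm ℝ X _)

/-- By `IsUnifPartition.nconv_eq_tsum` the Fourier transform of `χ f` at `ξ` is a sum of integrals,
each of which is turned by Parseval's formula into a pairing of `L^p` with `L^{p'}`. -/
theorem IsUnifPartition.locallyLE_modulationNormF_wermerNormF {φ : 𝓢(Eucl n, ℂ)}
    (h : IsUnifPartition φ) {p q : ℝ≥0∞} {s : ℝ} (hp : 1 ≤ p) (hq : 1 ≤ q)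
    (hs : 0 ≤ s) :
    LocallyLE (modulationNormF φ p q s) (wermerNormF (n := n) q s) := by
  intro X
  have hn : (n : ℝ) < n + 1 := by linarith
  -- the reflection of `X`, for which `X (ξ - η) = Xr (η - ξ)`
  set Xr : 𝓢(Eucl n, ℂ) := compCLMOfContinuousLinearEquiv ℂ (ContinuousLinearEquiv.neg ℝ) X
  obtain ⟨C, hC, hCle⟩ :=
    exists_eLpNorm_schwartzFourier_le (cutoff n n) Xr (n + 1 + s) p.conjExponent
  obtain ⟨A, hA, hAle⟩ := exists_tsum_weight_neg_le hn
  have hI := (lintegral_weight_neg_lt_top hn).ne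
  set A' := A + ∫⁻ x : Eucl n, weight (-(n + 1 : ℝ)) x
  refine ⟨C * (ENNReal.ofReal (2 ^ s) * A'), by finiteness, fun F hF => ?_⟩
  set a := fun k => eLpNorm (invF (piece φ k F)) p volume
  have hpt : ∀ ξ, ‖nconv X F ξ‖ₑ ≤
      C * ∫⁻ k, weight (-(n + 1 + s)) (ξ - latticePt k) * a k ∂Measure.count := by
    intro ξ
    rw [h.nconv_eq_tsum X hF, enorm_mul, lintegral_count, ← ENNReal.tsum_mul_left]
    calc _ ≤ 1 * ∑' k, ‖∫ η, piece φ k F η * X (ξ - η)‖ₑ :=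
          mul_le_mul' enorm_fourierConst_le enorm_tsum_le_tsum_enorm
      _ ≤ _ := by
        rw [one_mul]
        refine ENNReal.tsum_le_tsum fun k => ?_
        set Y := shiftMul (compSubConstCLM ℂ (latticePt k) (cutoff n n)) Xr ξ
        -- The factor `cutoff n n (· - k)`, which is `1` on the support of `φ(· - k)`, may be
        -- inserted and localizes the test function.
        have e : ∫ η, piece φ k F η * X (ξ - η) =
            ∫ x, schwartzFourier n Y x * invF (piece φ k F) x := by
          simp only [mul_comm (schwartzFourier n Y _)]
          rw [← integral_mul_eq_integral_invF_mul (integrable_piece φ k hF)]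
          congr 1; ext η
          have e1 : Y η = cutoff n n (η - latticePt k) * X (-(η - ξ)) := rfl
          rw [e1, neg_sub, piece]
          linear_combination (-F η * X (ξ - η)) * h.mul_cutoff (η - latticePt k)
        rw [e]
        refine (enorm_integral_mul_le hp (schwartzFourier n Y).continuous.aestronglyMeasurable
          (continuous_invF_piece φ k hF).aestronglyMeasurable).trans ?_
        rw [← mul_assoc, ← weight_neg _ (ξ - _), neg_sub]
        exact mul_le_mul_left (hCle _ _) _
  calc wermerNormF q s (nconv X F)
      ≤ C * eLpNorm (fun ξ => weight s ξ * ∫⁻ k, weight (-(n + 1 + s)) (ξ - latticePt k) * a k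
          ∂Measure.count) q volume := by
        refine eLpNorm_le_mul_eLpNorm_of_ae_le_mul'' q ?_ (ae_of_all _ fun ξ => ?_)
        · refine ((measurable_weight s).mul ?_).aestronglyMeasurable
          simp only [lintegral_count]
          exact Measurable.tsum fun k =>
            ((measurable_weight _).comp (measurable_id.sub_const _)).mul_const _
        · rw [enorm_eq_self, enorm_eq_self]
          exact (mul_le_mul_right (hpt ξ) _).trans_eq (by ring)
    _ ≤ C * (ENNReal.ofReal (2 ^ s) * A' * modulationNormF φ p q s F) := by
        refine mul_le_mul_right (eLpNorm_weight_kernel_le volume Measure.count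
          (ι := id) (κ := latticePt) measurable_id (measurable_of_countable _) hq
          hs (fun y => ?_) (fun x => ?_) (measurable_of_countable a).aemeasurable) _
        · rw [lintegral_count]
          exact (hAle y).trans le_self_add
        · simp only [id]
          rw [lintegral_sub_left_eq_self (fun y => weight (-(n + 1 : ℝ)) y) x]
          exact le_add_self
    _ = _ := by ring

/-! ### The modulation space is a Banach algebra -/

theorem invF_tsum {ι : Type*} [Countable ι] {F : ι → Eucl n → ℂ} {H : Eucl n → ℂ}
    (hF : ∀ i, Integrable (F i)) (hsum : ∑' i, ∫⁻ ξ, ‖F i ξ‖ₑ ≠ ∞)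
    (hH : ∀ᵐ ξ, H ξ = ∑' i, F i ξ) (x : Eucl n) : invF H x = ∑' i, invF (F i) x := by
  rw [invF_congr_ae hH]
  simp only [invF, Real.fourierInv_eq, tsum_mul_left]
  congr 1
  rw [← integral_tsum]
  · simp only [Circle.smul_def, smul_eq_mul, tsum_mul_left]
  · intro i
    simpa only [neg_neg, inner_neg_right] using
      ((Real.fourierIntegral_convergent_iff (-((2 * Real.pi)⁻¹ • x))).2 (hF i)).1
  · have e : ∀ (c : Circle) (z : ℂ), ‖c • z‖ₑ = ‖z‖ₑ := fun c z => by
      rw [← ofReal_norm, Circle.norm_smul, ofReal_norm]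
    simpa only [e] using hsum

theorem eLpNorm_invF_le_tsum {ι : Type*} [Countable ι] {F : ι → Eucl n → ℂ} {H : Eucl n → ℂ}
    (hF : ∀ i, Integrable (F i)) (hsum : ∑' i, ∫⁻ ξ, ‖F i ξ‖ₑ ≠ ∞)
    (hH : ∀ᵐ ξ, H ξ = ∑' i, F i ξ) {p : ℝ≥0∞} (hp : 1 ≤ p) :
    eLpNorm (invF H) p volume ≤ ∑' i, eLpNorm (invF (F i)) p volume := by
  have h := eLpNorm_tsum_le_tsum (μ := (volume : Measure (Eucl n)))
    (f := fun i x => ‖invF (F i) x‖ₑ) (fun i => (continuous_invF (hF i)).measurable.enorm) hp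
  simp only [eLpNorm_enorm] at h
  refine (eLpNorm_mono_enorm fun x => ?_).trans h
  rw [invF_tsum hF hsum hH, enorm_eq_self]
  exact enorm_tsum_le_tsum_enorm

theorem invF_fourierChar_mul (H : Eucl n → ℂ) (x y : Eucl n) :
    invF (fun ξ => Real.fourierChar (-inner ℝ y ((2 * Real.pi)⁻¹ • ξ)) * H ξ) x =
      invF H (x - y) := by
  simp only [invF, Real.fourierInv_eq]
  congr 1
  refine integral_congr_ae (ae_of_all _ fun ξ => ?_)
  simp only [Circle.smul_def, smul_eq_mul, ← mul_assoc, ← Circle.coe_mul, ← AddChar.map_add_eq_mul]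
  congr 3
  rw [inner_smul_right, inner_smul_right, inner_smul_right, inner_sub_right,
    real_inner_comm ξ y]
  ring

/-- The inverse Fourier transform turns a product into a convolution. -/
theorem invF_schwartz_mul (ψ : 𝓢(Eucl n, ℂ)) {H : Eucl n → ℂ} (hH : Integrable H) (x : Eucl n) :
    invF (fun ξ => ψ ξ * H ξ) x = ∫ y, schwartzFourierInv n ψ y * invF H (x - y) := by
  have e : (fun ξ => ψ ξ * H ξ) = fun ξ => ∫ y, schwartzFourierInv n ψ y *
      (Real.fourierChar (-inner ℝ y ((2 * Real.pi)⁻¹ • ξ)) * H ξ) := by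
    ext ξ
    conv_lhs => rw [← schwartzFourier_schwartzFourierInv ψ, schwartzFourier_apply, Real.fourier_eq,
      ← integral_mul_const]
    refine integral_congr_ae (ae_of_all _ fun y => ?_)
    simp only [Circle.smul_def, smul_eq_mul]
    ring
  have hint : Integrable (fun z : Eucl n × Eucl n => schwartzFourierInv n ψ z.2 *
      (Real.fourierChar (-inner ℝ z.2 ((2 * Real.pi)⁻¹ • z.1)) * H z.1))
      (volume.prod volume) := by
    have h := (hH.mul_prod (schwartzFourierInv n ψ).integrable (μ := volume) (ν := volume))
    have hc : Continuous fun z : Eucl n × Eucl n =>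
        (Real.fourierChar (-inner ℝ z.2 ((2 * Real.pi)⁻¹ • z.1)) : ℂ) :=
      continuous_subtype_val.comp (Real.continuous_fourierChar.comp (by fun_prop))
    have h2 := h.bdd_mul (c := 1) hc.aestronglyMeasurable
      (ae_of_all _ fun z => (Circle.norm_coe _).le)
    refine h2.congr (ae_of_all _ fun z => ?_)
    ring
  rw [e]
  refine (invF_integral hint x).trans ?_
  simp only [invF_const_mul, invF_fourierChar_mul]

/-- The frequency localizations are bounded on `L^p`, uniformly in `k`. -/
theorem exists_eLpNorm_invF_piece_le (φ : 𝓢(Eucl n, ℂ)) {p : ℝ≥0∞} (hp : 1 ≤ p) :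
    ∃ C : ℝ≥0∞, C ≠ ∞ ∧ ∀ (k : Fin n → ℤ) (H : Eucl n → ℂ), Integrable H →
      eLpNorm (invF (piece φ k H)) p volume ≤ C * eLpNorm (invF H) p volume := by
  refine ⟨∫⁻ y, ‖schwartzFourierInv n φ y‖ₑ, (schwartzFourierInv n φ).integrable.2.ne,
    fun k H hH => ?_⟩
  set Φ := schwartzFourierInv n (compSubConstCLM ℂ (latticePt k) φ)
  have hΦ : ∀ y, ‖Φ y‖ₑ = ‖schwartzFourierInv n φ y‖ₑ := by
    intro y
    rw [← invF_schwartz, ← invF_schwartz, ← ofReal_norm, ← ofReal_norm]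
    congr 1
    exact norm_invF_comp_sub φ (latticePt k) y
  have hpt : ∀ x, ‖invF (piece φ k H) x‖ₑ ≤ ∫⁻ y, ‖Φ (x - y)‖ₑ * ‖invF H y‖ₑ := by
    intro x
    have e : invF (piece φ k H) x = _ :=
      invF_schwartz_mul (compSubConstCLM ℂ (latticePt k) φ) hH x
    rw [e]
    refine (enorm_integral_le_lintegral_enorm _).trans_eq ?_
    rw [← lintegral_sub_left_eq_self _ x]
    simp only [enorm_mul, sub_sub_cancel]
    rfl
  calc _ ≤ eLpNorm (fun x => ∫⁻ y, ‖Φ (x - y)‖ₑ * ‖invF H y‖ₑ) p volume :=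
        eLpNorm_mono_enorm fun x => by rw [enorm_eq_self]; exact hpt x
    _ ≤ (∫⁻ y, ‖Φ y‖ₑ) * eLpNorm (fun y => ‖invF H y‖ₑ) p volume :=
        eLpNorm_lintegral_sub_left_mul_le volume Φ.continuous.measurable.enorm.aemeasurable
          (continuous_invF hH).measurable.enorm.aemeasurable hp
    _ = _ := by simp only [hΦ, eLpNorm_enorm]

/-- The support of the convolution of two pieces is contained in the sum of their supports. -/
theorem IsUnifPartition.norm_le_of_piece_nconv_ne_zero {φ : 𝓢(Eucl n, ℂ)} (h : IsUnifPartition φ)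
    {k l m : Fin n → ℤ} {F G : Eucl n → ℂ} {ξ : Eucl n}
    (h0 : piece φ k (nconv (piece φ l F) (piece φ m G)) ξ ≠ 0) :
    ‖(latticePt k - latticePt (l + m) : Eucl n)‖ ≤ 3 * n := by
  rw [piece, mul_ne_zero_iff, nconv, mul_ne_zero_iff] at h0
  obtain ⟨hk, -, hI⟩ := h0
  obtain ⟨η, hη⟩ : ∃ η, piece φ l F η * piece φ m G (ξ - η) ≠ 0 := by
    by_contra hc
    push Not at hc
    simp [hc] at hI
  simp only [piece, mul_ne_zero_iff] at hη
  have e : (latticePt k - latticePt (l + m) : Eucl n) =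
      (η - latticePt l) + (ξ - η - latticePt m) - (ξ - latticePt k) := by
    rw [latticePt_add]; abel
  rw [e]
  linarith [norm_sub_le ((η - latticePt l) + (ξ - η - latticePt m)) (ξ - latticePt k),
    norm_add_le (η - latticePt l) (ξ - η - latticePt m), h.norm_le hk, h.norm_le hη.1.1,
    h.norm_le hη.2.1]

/-- Fubini's theorem for the `L^1` norm of a convolution. -/
theorem lintegral_lintegral_enorm_mul_comp_sub {F G : Eucl n → ℂ} (hF : Integrable F)
    (hG : Integrable G) :
    ∫⁻ ξ, ∫⁻ η, ‖F η‖ₑ * ‖G (ξ - η)‖ₑ = (∫⁻ ξ, ‖F ξ‖ₑ) * ∫⁻ ξ, ‖G ξ‖ₑ := by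
  rw [lintegral_lintegral_swap]
  · have : ∀ η, ∫⁻ ξ, ‖F η‖ₑ * ‖G (ξ - η)‖ₑ = ‖F η‖ₑ * ∫⁻ ξ, ‖G ξ‖ₑ := fun η => by
      rw [lintegral_const_mul' _ _ enorm_ne_top,
        lintegral_sub_right_eq_self (fun ξ => ‖G ξ‖ₑ) η]
    simp only [this]
    exact lintegral_mul_const'' _ hF.1.enorm
  · have h := (Integrable.convolution_integrand (ContinuousLinearMap.mul ℂ ℂ) hF hG).1.enorm
    simp only [ContinuousLinearMap.mul_apply', enorm_mul] at h
    exact h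

/-- Only almost everywhere, since the convolution of integrable functions need not converge at every
point. -/
theorem IsUnifPartition.nconv_eq_tsum_nconv {φ : 𝓢(Eucl n, ℂ)} (h : IsUnifPartition φ)
    {F G : Eucl n → ℂ} (hF : Integrable F) (hG : Integrable G) :
    ∀ᵐ ξ, nconv F G ξ = ∑' i : (Fin n → ℤ) × (Fin n → ℤ),
      nconv (piece φ i.1 F) (piece φ i.2 G) ξ := by
  have hm : ∀ i : (Fin n → ℤ) × (Fin n → ℤ), AEMeasurable (fun z : Eucl n × Eucl n =>
      ‖piece φ i.1 F z.2‖ₑ * ‖piece φ i.2 G (z.1 - z.2)‖ₑ) (volume.prod volume) := fun i => by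
    have h := (Integrable.convolution_integrand (ContinuousLinearMap.mul ℂ ℂ)
      (integrable_piece φ i.1 hF) (integrable_piece φ i.2 hG)).1.enorm
    simpa only [ContinuousLinearMap.mul_apply', enorm_mul] using h
  have hfin : ∫⁻ ξ, ∑' i : (Fin n → ℤ) × (Fin n → ℤ),
      ∫⁻ η, ‖piece φ i.1 F η‖ₑ * ‖piece φ i.2 G (ξ - η)‖ₑ ≠ ∞ := by
    rw [lintegral_tsum fun i => (hm i).lintegral_prod_right']
    simp only [lintegral_lintegral_enorm_mul_comp_sub (integrable_piece φ _ hF)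
      (integrable_piece φ _ hG)]
    rw [ENNReal.tsum_prod']
    simp only [ENNReal.tsum_mul_left, ENNReal.tsum_mul_right]
    exact ENNReal.mul_ne_top (h.tsum_lintegral_piece_ne_top hF) (h.tsum_lintegral_piece_ne_top hG)
  have hmeas : AEMeasurable fun ξ => ∑' i : (Fin n → ℤ) × (Fin n → ℤ),
      ∫⁻ η, ‖piece φ i.1 F η‖ₑ * ‖piece φ i.2 G (ξ - η)‖ₑ :=
    AEMeasurable.tsum fun i => (hm i).lintegral_prod_right'
  have hslice : ∀ᵐ ξ : Eucl n, ∀ i : (Fin n → ℤ) × (Fin n → ℤ),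
      AEStronglyMeasurable fun η => piece φ i.1 F η * piece φ i.2 G (ξ - η) := by
    refine ae_of_all _ fun ξ i => (integrable_piece φ i.1 hF).1.mul ?_
    exact (integrable_piece φ i.2 hG).1.comp_quasiMeasurePreserving
      (quasiMeasurePreserving_sub_left volume ξ)
  filter_upwards [ae_lt_top' hmeas hfin, hslice] with ξ hξ hs
  simp only [nconv, tsum_mul_left]
  congr 1
  rw [← integral_tsum hs (by simpa only [enorm_mul] using hξ.ne)]
  refine integral_congr_ae (ae_of_all _ fun η => ?_)
  have h1 := h.hasSum_piece F η
  have h2 := h.hasSum_piece G (ξ - η)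
  have hfs : ∀ (F : Eucl n → ℂ) (ξ : Eucl n), Summable fun k => ‖piece φ k F ξ‖ := fun F ξ =>
    (h.hasSum_piece F ξ).summable.norm
  simp only
  rw [← h1.tsum_eq, ← h2.tsum_eq]
  exact tsum_mul_tsum_of_summable_norm (hfs F η) (hfs G (ξ - η))

theorem IsUnifPartition.eLpNorm_invF_piece_nconv_le_tsum {φ : 𝓢(Eucl n, ℂ)}
    (h : IsUnifPartition φ) {F G : Eucl n → ℂ} (hF : Integrable F) (hG : Integrable G)
    {p : ℝ≥0∞} (hp : 1 ≤ p) (k : Fin n → ℤ) :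
    eLpNorm (invF (piece φ k (nconv F G))) p volume ≤ ∑' i : (Fin n → ℤ) × (Fin n → ℤ),
      eLpNorm (invF (piece φ k (nconv (piece φ i.1 F) (piece φ i.2 G)))) p volume := by
  have hN : ∀ i : (Fin n → ℤ) × (Fin n → ℤ), Integrable (nconv (piece φ i.1 F) (piece φ i.2 G)) :=
    fun i => integrable_nconv (integrable_piece φ _ hF) (integrable_piece φ _ hG)
  refine eLpNorm_invF_le_tsum (fun i => integrable_piece φ k (hN i)) ?_ ?_ hp
  · set S := ENNReal.ofReal (SchwartzMap.seminorm ℝ 0 0 φ)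
    have h1 : ∀ i : (Fin n → ℤ) × (Fin n → ℤ),
        ∫⁻ ξ, ‖piece φ k (nconv (piece φ i.1 F) (piece φ i.2 G)) ξ‖ₑ ≤
          S * ((∫⁻ ξ, ‖piece φ i.1 F ξ‖ₑ) * ∫⁻ ξ, ‖piece φ i.2 G ξ‖ₑ) := fun i => by
      rw [← lintegral_lintegral_enorm_mul_comp_sub (integrable_piece φ _ hF)
        (integrable_piece φ _ hG), ← lintegral_const_mul' _ _ (by finiteness)]
      exact lintegral_mono fun ξ => (enorm_piece_le φ k _ ξ).trans
        (mul_le_mul_right (enorm_nconv_le _ _ ξ) _)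
    refine ne_top_of_le_ne_top ?_ (ENNReal.tsum_le_tsum h1)
    rw [ENNReal.tsum_mul_left, ENNReal.tsum_prod']
    simp only [ENNReal.tsum_mul_left, ENNReal.tsum_mul_right]
    have := h.tsum_lintegral_piece_ne_top hF
    have := h.tsum_lintegral_piece_ne_top hG
    finiteness
  · filter_upwards [h.nconv_eq_tsum_nconv hF hG] with ξ hξ
    rw [piece, hξ, ← tsum_mul_left]
    rfl

/-- The main estimate for products: the `k`-th piece of the product of two pieces vanishes unless
`l + m` is close to `k`, and Bernstein's inequality puts the second factor in `L^∞`. -/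
theorem IsUnifPartition.exists_eLpNorm_invF_piece_nconv_piece_le {φ : 𝓢(Eucl n, ℂ)}
    (h : IsUnifPartition φ) {p : ℝ≥0∞} (hp : 1 ≤ p) (hp2 : p ≤ 2) {t : ℝ} (ht : 0 ≤ t) :
    ∃ C : ℝ≥0∞, C ≠ ∞ ∧ ∀ (k l m : Fin n → ℤ) (F G : Eucl n → ℂ), Integrable F → Integrable G →
      eLpNorm (invF (piece φ k (nconv (piece φ l F) (piece φ m G)))) p volume ≤
        C * (weight (-t) (latticePt k - latticePt (l + m)) *
          (eLpNorm (invF (piece φ l F)) p volume * eLpNorm (invF (piece φ m G)) p volume)) := by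
  obtain ⟨C₁, hC₁, h₁⟩ := exists_eLpNorm_invF_piece_le φ hp
  obtain ⟨C₂, hC₂, h₂⟩ := h.exists_lintegral_piece_le hp hp2
  set M := ENNReal.ofReal ((1 + 3 * n : ℝ) ^ t)
  refine ⟨C₁ * C₂ * M, by finiteness, fun k l m F G hF hG => ?_⟩
  have hFl := integrable_piece φ l hF
  have hGm := integrable_piece φ m hG
  by_cases h0 : ∀ ξ, piece φ k (nconv (piece φ l F) (piece φ m G)) ξ = 0
  · have e : invF (piece φ k (nconv (piece φ l F) (piece φ m G))) = fun _ => 0 := by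
      ext x
      rw [← enorm_eq_zero, ← nonpos_iff_eq_zero]
      exact (enorm_invF_le _ x).trans_eq (by simp [h0])
    rw [e, eLpNorm_zero']
    exact zero_le
  push Not at h0
  obtain ⟨ξ, hξ⟩ := h0
  set a := eLpNorm (invF (piece φ l F)) p volume
  set c := eLpNorm (invF (piece φ m G)) p volume
  have hprod : eLpNorm (invF (nconv (piece φ l F) (piece φ m G))) p volume ≤ C₂ * c * a := by
    refine eLpNorm_le_mul_eLpNorm_of_ae_le_mul'' p (continuous_invF hFl).aestronglyMeasurable
      (ae_of_all _ fun x => ?_)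
    rw [invF_nconv hFl hGm, enorm_mul, mul_comm]
    exact mul_le_mul_left ((enorm_invF_le _ x).trans (h₂ m G hG)) _
  calc _ ≤ C₁ * (C₂ * c * a) := (h₁ k _ (integrable_nconv hFl hGm)).trans (mul_le_mul_right hprod _)
    _ = C₁ * (C₂ * c * a) * 1 := (mul_one _).symm
    _ ≤ C₁ * (C₂ * c * a) * (M * weight (-t) (latticePt k - latticePt (l + m))) :=
        mul_le_mul_right
          (one_le_mul_weight_neg ht (h.norm_le_of_piece_nconv_ne_zero hξ)) _
    _ = _ := by ring

/-- `M^{p,q}_s` is an algebra under pointwise multiplication: `‖φ(D - k)(f g)‖_p` is controlled by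
the convolution of the corresponding sequences for `f` and `g`, up to a kernel concentrated near
the diagonal. -/
theorem IsUnifPartition.exists_modulationNormF_nconv_le {φ : 𝓢(Eucl n, ℂ)}
    (h : IsUnifPartition φ) {p q : ℝ≥0∞} {s : ℝ} (hp : 1 ≤ p) (hp2 : p ≤ 2)
    (hqs : AdmissibleWeight n q s) :
    ∃ C : ℝ≥0∞, C ≠ ∞ ∧ ∀ F G : Eucl n → ℂ, Integrable F → Integrable G →
      modulationNormF φ p q s (nconv F G) ≤
        C * modulationNormF φ p q s F * modulationNormF φ p q s G := by
  have hn : (n : ℝ) < n + 1 := by linarith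
  obtain ⟨A, hA, hAle⟩ := exists_tsum_weight_neg_le hn
  have hs := hqs.nonneg
  obtain ⟨C, hC, hCle⟩ := h.exists_eLpNorm_invF_piece_nconv_piece_le hp hp2
    (t := n + 1 + s) (by positivity)
  obtain ⟨D, hD, hDle⟩ := exists_eLpNorm_weight_conv_le_count hqs
  refine ⟨C * (ENNReal.ofReal (2 ^ s) * A * D), by finiteness, fun F G hF hG => ?_⟩
  set a := fun l => eLpNorm (invF (piece φ l F)) p volume
  set c := fun m => eLpNorm (invF (piece φ m G)) p volume
  have hpt : ∀ k, eLpNorm (invF (piece φ k (nconv F G))) p volume ≤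
      C * ∫⁻ j, weight (-(n + 1 + s)) (latticePt k - latticePt j) * ∑' m, a (j - m) * c m
        ∂Measure.count := by
    intro k
    rw [lintegral_count]
    calc _ ≤ ∑' i : (Fin n → ℤ) × (Fin n → ℤ), C *
          (weight (-(n + 1 + s)) (latticePt k - latticePt (i.1 + i.2)) * (a i.1 * c i.2)) :=
          (h.eLpNorm_invF_piece_nconv_le_tsum hF hG hp k).trans
            (ENNReal.tsum_le_tsum fun i => hCle k i.1 i.2 F G hF hG)
      _ = C * ∑' (m : Fin n → ℤ) (l : Fin n → ℤ),
          weight (-(n + 1 + s)) (latticePt k - latticePt (l + m)) * (a l * c m) := by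
          rw [ENNReal.tsum_mul_left, ENNReal.tsum_prod', ENNReal.tsum_comm]
      _ = C * ∑' (m : Fin n → ℤ) (j : Fin n → ℤ),
          weight (-(n + 1 + s)) (latticePt k - latticePt j) * (a (j - m) * c m) := by
          congr 2
          ext m
          rw [← (Equiv.subRight m).tsum_eq]
          simp only [Equiv.subRight_apply, sub_add_cancel]
      _ = _ := by
          rw [ENNReal.tsum_comm]
          simp only [ENNReal.tsum_mul_left]
  calc modulationNormF φ p q s (nconv F G)
      ≤ C * eLpNorm (fun k : Fin n → ℤ => weight s (latticePt k) *
          ∫⁻ j, weight (-(n + 1 + s)) (latticePt k - latticePt j) * ∑' m, a (j - m) * c m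
            ∂Measure.count) q Measure.count := by
        refine eLpNorm_le_mul_eLpNorm_of_ae_le_mul'' q
          (measurable_of_countable _).aestronglyMeasurable (ae_of_all _ fun k => ?_)
        rw [enorm_eq_self, enorm_eq_self]
        exact (mul_le_mul_right (hpt k) _).trans_eq (by ring)
    _ ≤ C * (ENNReal.ofReal (2 ^ s) * A * (D * modulationNormF φ p q s F *
          modulationNormF φ p q s G)) := by
        refine mul_le_mul_right ((eLpNorm_weight_kernel_le Measure.count Measure.count
          (measurable_of_countable _) (measurable_of_countable _) hqs.one_le hs (fun x => ?_)
          (fun x => ?_) (measurable_of_countable _).aemeasurable).trans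
            (mul_le_mul_right (hDle a c) _)) _
        · rw [lintegral_count]; exact hAle x
        · rw [lintegral_count]; exact hAle x
    _ = _ := by ring

theorem IsUnifPartition.isFourierAlgebraNorm_modulationNorm {φ : 𝓢(Eucl n, ℂ)}
    (h : IsUnifPartition φ) {p q : ℝ≥0∞} {s : ℝ} (hp : 1 ≤ p) (hp2 : p ≤ 2)
    (hqs : AdmissibleWeight n q s) :
    IsFourierAlgebraNorm (modulationNorm φ p q s) (modulationNormF φ p q s) where
  exists_hasFourier := fun _ hf => h.exists_hasFourier hp hp2 hqs hf
  eq := modulationNorm_eq φ p q s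
  add_le := fun _ _ hF hG => modulationNormF_add_le φ hp hqs.one_le s hF hG
  const_mul_le := fun c _ hF => modulationNormF_const_mul_le φ p q s c hF
  lintegral_le := by
    obtain ⟨C, hC, hle⟩ := h.exists_tsum_lintegral_piece_le hp hp2 hqs
    exact ⟨C, hC, fun F hF => (h.lintegral_enorm_le_tsum hF).trans (hle F hF)⟩
  nconv_le := h.exists_modulationNormF_nconv_le hp hp2 hqs

end SpectralSynthesis

end

theorem theorem1 (n : ℕ) (p q : ℝ≥0∞) (s : ℝ) (hp : 1 ≤ p) (hp2 : p ≤ 2)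
    (hqs : (q = 1 ∧ 0 ≤ s) ∨
      (1 < q ∧ q ≤ ENNReal.conjExponent p ∧ (n : ℝ) / (ENNReal.conjExponent q).toReal < s))
    (φ : 𝓢(SpectralSynthesis.Eucl n, ℂ)) (hφ : SpectralSynthesis.IsUnifPartition φ)
    (K : Set (SpectralSynthesis.Eucl n)) (hK : IsCompact K) :
    SpectralSynthesis.IsSetOfSpectralSynthesis (SpectralSynthesis.modulationNorm φ p q s) K ↔
      SpectralSynthesis.IsSetOfSpectralSynthesis
        (SpectralSynthesis.fourierWermerNorm (n := n) q s) K := by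
  have hadm : SpectralSynthesis.AdmissibleWeight n q s := hqs.imp_right fun h => ⟨h.1, h.2.2⟩
  have hM := hφ.isFourierAlgebraNorm_modulationNorm hp hp2 hadm
  have hW := SpectralSynthesis.isFourierAlgebraNorm_fourierWermerNorm hadm
  have hMW := hφ.locallyLE_modulationNormF_wermerNormF hp hadm.one_le hadm.nonneg
  have hWM := SpectralSynthesis.locallyLE_wermerNormF_modulationNormF φ hp
    (ne_top_of_le_ne_top ENNReal.ofNat_ne_top hp2) hadm.one_le hadm.nonneg
  exact ⟨.of_locallyLE hM hW hMW hWM hK, .of_locallyLE hW hM hWM hMW hK⟩
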